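/- Let $\bar s,\beta,\rho>0$, $\mu\in\mathbb R$, $\lambda\in(0,1)$, and let $\Gamma,\Lambda\subset\mathbb R$ be nonempty and compact. Put $\mathcal H=L^2(0,\bar s)$ with norm $|\cdot|$ and inner product $\langle\cdot,\cdot\rangle$, $\|\Gamma\|=\sup_{a\in\Gamma}|a|$ and $\Sigma=\{\gamma\in\mathcal H:\gamma(r)\in\Lambda\text{ for a.e. }r\}$. Let $Af=-\beta f'$ on $D(A)=\{f\in H^1(0,\bar s):f(0)=0\}$, with adjoint $A^*f=\beta f'$ on $D(A^*)=\{f\in H^1(0,\bar s):f(\bar s)=0\}$, let $\delta_0f=f(0)$ for $f\in D(A^*)$, let $B=(A^*-\lambda I)^{-1}(A-\lambda I)^{-1}$ and $|x|_B=\sqrt{\langle Bx,x\rangle}$. Let $L$ be a real function, uniformly continuous on $\mathcal H\times\Sigma\times\Gamma$, such that for some $C_L\ge 0$ and all $x,y\in\mathcal H$, $(\alpha,a)\in\Sigma\times\Gamma$, $$\text{(L1)}\quad |L(x,\alpha,a)-L(y,\alpha,a)|\le C_L|x-y|_B,\qquad\qquad \text{(L2)}\quad |L(x,\alpha,a)|\le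 C_L .$$ Test functions. A function $\phi$ on $\mathcal H$ is in test1 if $\phi\in C^1(\mathcal H)$, $\phi(x)\le\liminf_n\phi(x_n)$ whenever $x_n\rightharpoonup x$ and $|B(x_n-x)|\to0$, $\nabla\phi(x)\in D(A^*)$ for all $x$, and $A^*\nabla\phi:\mathcal H\to\mathcal H$ is continuous. A function $g$ is in test2 if $g\in C^2(\mathcal H)$ and $g(x)=g_0(|x|)$ with $g_0:[0,\infty)\to\mathbb R$ nondecreasing; $g_0'(|x|)/|x|$ is read at $x=0$ as $\lim_{r\to0^+}g_0'(r)/r$. Sub- and supersolutions. Consider the HJB equation $$\rho u(x)-\langle\nabla u(x),Ax\rangle-\langle\nabla u(x),-\mu x\rangle-\inf_{(\alpha,a)\in\Sigma\times\Gamma}\big(\beta\,\delta_0(\nabla u(x))\,a+\langle\nabla u(x),\alpha\rangle+L(x,\alpha,a)\big)=0 .$$ A bounded continuous function $u:\mathcal H\to\mathbb R$ that is Lipschitz for $|\cdot|_B$ is a subsolution if for all $\phi\in$ test1, $g\in$ test2 and every local maximum point $x$ of $u-(\phi+g)$, $$\rho u(x)-\langle A^*\nabla\phi(x),x\rangle-\langle\nabla\phi(x)+\nabla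 g(x),-\mu x\rangle-\inf_{(\alpha,a)\in\Sigma\times\Gamma}\big(\beta\,\delta_0(\nabla\phi(x))\,a+\langle\nabla\phi(x)+\nabla g(x),\alpha\rangle+L(x,\alpha,a)\big)\le\frac{g_0'(|x|)}{|x|}\,\frac{\beta\|\Gamma\|^2}{2}.$$ A bounded continuous function $v:\mathcal H\to\mathbb R$ that is Lipschitz for $|\cdot|_B$ is a supersolution if for all $\phi\in$ test1, $g\in$ test2 and every local minimum point $x$ of $v+(\phi+g)$, $$\rho v(x)+\langle A^*\nabla\phi(x),x\rangle+\langle\nabla\phi(x)+\nabla g(x),-\mu x\rangle-\inf_{(\alpha,a)\in\Sigma\times\Gamma}\big(-\beta\,\delta_0(\nabla\phi(x))\,a-\langle\nabla\phi(x)+\nabla g(x),\alpha\rangle+L(x,\alpha,a)\big)\ge-\frac{g_0'(|x|)}{|x|}\,\frac{\beta\|\Gamma\|^2}{2}.$$ A solution is a function that is both a subsolution and a supersolution. Value function. For measurable controls $\alpha:[0,\infty)\to\Sigma$ and $a:[0,\infty)\to\Gamma$, let $x(\cdot)\in C([0,\infty);\mathcal H)$ be the trajectory from $x$, i.e. the solution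 in $D(A^*)'$ of $\dot x(t)=Ax(t)-\mu x(t)+\alpha(t)+\beta\delta_0a(t)$, $x(0)=x$. This means that for all $p\in D(A^*)$ and $t\ge0$ $$\langle x(t),p\rangle=\langle x,p\rangle+\int_0^t\big(\langle x(\tau),A^*p\rangle-\mu\langle x(\tau),p\rangle+\langle\alpha(\tau),p\rangle+\beta\,\delta_0(p)\,a(\tau)\big)\,d\tau .$$ Let $V(x)=\inf_{\alpha(\cdot),a(\cdot)}\int_0^\infty e^{-\rho t}L(x(t),\alpha(t),a(t))\,dt$. Theorem. If $u$ is a subsolution and $v$ a supersolution of the HJB equation, then $u(x)\le v(x)$ for every $x\in\mathcal H$. Consequently the HJB equation has at most one solution. The value function $V$ is a solution, and hence the only one. -/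

import Mathlib

open MeasureTheory Set Filter Topology
open scoped ContDiff

noncomputable section

namespace TransportHJB

/-- The Hilbert space `L²(0, s)` of real valued functions. -/
abbrev H (s : ℝ) : Type := Lp ℝ 2 (volume.restrict (Ioo (0 : ℝ) s))

/-! ### The Volterra operator `(A - lam)⁻¹` -/

/-- `r ↦ (1/β) (-e^{-(lam/β) r} ∫₀ʳ e^{(lam/β) τ} f(τ) dτ)`. -/
def resolventFun (β lam : ℝ) (f : ℝ → ℝ) (r : ℝ) : ℝ :=
  (1 / β) * (-(Real.exp (-(lam / β) * r)) * ∫ τ in (0 : ℝ)..r, Real.exp (lam / β * τ) * f τ)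

/-- A bound for the weight `e^{(lam/β) τ}` on `[0, s]`. -/
def weightBound (s β lam : ℝ) : ℝ := Real.exp (|lam / β| * s)

theorem exp_le_weightBound {s c r : ℝ} (hr : r ∈ Ioo 0 s) :
    Real.exp (c * r) ≤ Real.exp (|c| * s) := by
  apply Real.exp_le_exp.2
  calc c * r ≤ |c| * r := by
        exact mul_le_mul_of_nonneg_right (le_abs_self c) hr.1.le
    _ ≤ |c| * s := mul_le_mul_of_nonneg_left hr.2.le (abs_nonneg c)

theorem H.integrable {s : ℝ} (f : H s) : Integrable f (volume.restrict (Ioo (0 : ℝ) s)) :=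
  (Lp.memLp f).integrable (by norm_num)

theorem integrableOn_weight {s : ℝ} (c : ℝ) (f : H s) :
    IntegrableOn (fun τ => Real.exp (c * τ) * f τ) (Ioo 0 s) := by
  have h := (H.integrable f).bdd_mul (c := Real.exp (|c| * s))
    (f := fun τ => Real.exp (c * τ)) (by fun_prop) ?_
  · exact h
  · refine (ae_restrict_iff' measurableSet_Ioo).2 (Eventually.of_forall fun r hr => ?_)
    rw [Real.norm_eq_abs, abs_of_pos (Real.exp_pos _)]
    exact exp_le_weightBound hr

theorem intervalIntegrable_weight {s : ℝ} (c : ℝ) (f : H s) {r : ℝ} (hr : r ∈ Icc 0 s) :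
    IntervalIntegrable (fun τ => Real.exp (c * τ) * f τ) volume 0 r := by
  rw [intervalIntegrable_iff_integrableOn_Ioo_of_le hr.1]
  exact (integrableOn_weight c f).mono_set (Ioo_subset_Ioo_right hr.2)

theorem aestronglyMeasurable_resolventFun {s : ℝ} (β lam : ℝ) (f : H s) :
    AEStronglyMeasurable (resolventFun β lam f) (volume.restrict (Ioo (0 : ℝ) s)) := by
  rcases le_or_gt s 0 with hs | hs
  · simp [Ioo_eq_empty (not_lt.2 hs)]
  have hc : ContinuousOn (resolventFun β lam f) (Icc 0 s) := by
    unfold resolventFun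
    refine continuousOn_const.mul (ContinuousOn.mul (by fun_prop) ?_)
    have := intervalIntegral.continuousOn_primitive_interval'
      (intervalIntegrable_weight (lam / β) f (right_mem_Icc.2 hs.le)) (left_mem_uIcc)
    rwa [uIcc_of_le hs.le] at this
  exact (hc.mono Ioo_subset_Icc_self).aestronglyMeasurable measurableSet_Ioo

theorem resolventFun_bound {s : ℝ} (β lam : ℝ) (f : H s) {r : ℝ} (hr : r ∈ Ioo 0 s) :
    ‖resolventFun β lam f r‖ ≤
      |1 / β| * (weightBound s β lam * (weightBound s β lam *
        ∫ τ in Ioo (0 : ℝ) s, ‖f τ‖)) := by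
  unfold resolventFun
  rw [norm_mul, norm_mul, Real.norm_eq_abs]
  have hI : ‖∫ τ in (0 : ℝ)..r, Real.exp (lam / β * τ) * f τ‖ ≤
      weightBound s β lam * ∫ τ in Ioo (0 : ℝ) s, ‖f τ‖ := by
    rw [intervalIntegral.integral_of_le hr.1.le, integral_Ioc_eq_integral_Ioo,
      ← integral_const_mul]
    refine (norm_integral_le_integral_norm _).trans ?_
    have hsub : Ioo (0 : ℝ) r ⊆ Ioo 0 s := Ioo_subset_Ioo_right hr.2.le
    have hint : IntegrableOn (fun τ => weightBound s β lam * ‖f τ‖) (Ioo 0 s) :=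
      (H.integrable f).norm.const_mul _
    calc ∫ τ in Ioo (0 : ℝ) r, ‖Real.exp (lam / β * τ) * f τ‖
        ≤ ∫ τ in Ioo (0 : ℝ) r, weightBound s β lam * ‖f τ‖ := by
          refine setIntegral_mono_on ((integrableOn_weight _ f).mono_set hsub).norm
            (hint.mono_set hsub) measurableSet_Ioo fun τ hτ => ?_
          rw [norm_mul, Real.norm_eq_abs (Real.exp _), abs_of_pos (Real.exp_pos _)]
          exact mul_le_mul_of_nonneg_right (exp_le_weightBound (hsub hτ)) (norm_nonneg _)
      _ ≤ ∫ τ in Ioo (0 : ℝ) s, weightBound s β lam * ‖f τ‖ := by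
          refine setIntegral_mono_set hint (Eventually.of_forall fun τ => ?_) hsub.eventuallyLE
          exact mul_nonneg (Real.exp_pos _).le (norm_nonneg _)
  have hE : ‖-Real.exp (-(lam / β) * r)‖ ≤ weightBound s β lam := by
    rw [norm_neg, Real.norm_eq_abs, abs_of_pos (Real.exp_pos _), weightBound,
      ← abs_neg (lam / β)]
    exact exp_le_weightBound hr
  gcongr
  exact (Real.exp_pos _).le

theorem memLp_resolventFun {s : ℝ} (β lam : ℝ) (f : H s) :
    MemLp (resolventFun β lam f) 2 (volume.restrict (Ioo (0 : ℝ) s)) :=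
  MemLp.of_bound (aestronglyMeasurable_resolventFun β lam f) _
    ((ae_restrict_iff' measurableSet_Ioo).2
      (Eventually.of_forall fun _ hr => resolventFun_bound β lam f hr))

/-- `(A - lam)⁻¹` as a linear map on `L²(0, s)`. -/
def resolventLin (s β lam : ℝ) : H s →ₗ[ℝ] H s where
  toFun f := (memLp_resolventFun β lam f).toLp (resolventFun β lam f)
  map_add' f g := by
    rw [← MemLp.toLp_add]
    refine MemLp.toLp_congr _ _ ?_
    refine (ae_restrict_iff' measurableSet_Ioo).2 (Eventually.of_forall fun r hr => ?_)
    have hr' : r ∈ Icc 0 s := Ioo_subset_Icc_self hr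
    have : ∫ τ in (0 : ℝ)..r, Real.exp (lam / β * τ) * (f + g : H s) τ =
        ∫ τ in (0 : ℝ)..r, (Real.exp (lam / β * τ) * f τ + Real.exp (lam / β * τ) * g τ) := by
      refine intervalIntegral.integral_congr_ae_restrict ?_
      rw [uIoc_of_le hr.1.le, restrict_Ioo_eq_restrict_Ioc.symm]
      filter_upwards [ae_restrict_of_ae_restrict_of_subset (Ioo_subset_Ioo_right hr.2.le)
        (Lp.coeFn_add f g)] with τ hτ
      rw [hτ, Pi.add_apply, mul_add]
    simp only [resolventFun, Pi.add_apply]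
    rw [this, intervalIntegral.integral_add (intervalIntegrable_weight _ f hr')
      (intervalIntegrable_weight _ g hr')]
    ring
  map_smul' c f := by
    rw [RingHom.id_apply, ← MemLp.toLp_const_smul]
    refine MemLp.toLp_congr _ _ ?_
    refine (ae_restrict_iff' measurableSet_Ioo).2 (Eventually.of_forall fun r hr => ?_)
    have : ∫ τ in (0 : ℝ)..r, Real.exp (lam / β * τ) * (c • f : H s) τ =
        ∫ τ in (0 : ℝ)..r, c * (Real.exp (lam / β * τ) * f τ) := by
      refine intervalIntegral.integral_congr_ae_restrict ?_
      rw [uIoc_of_le hr.1.le, restrict_Ioo_eq_restrict_Ioc.symm]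
      filter_upwards [ae_restrict_of_ae_restrict_of_subset (Ioo_subset_Ioo_right hr.2.le)
        (Lp.coeFn_smul c f)] with τ hτ
      rw [hτ, Pi.smul_apply, smul_eq_mul]
      ring
    simp only [resolventFun, Pi.smul_apply, smul_eq_mul]
    rw [this, intervalIntegral.integral_const_mul]
    ring

theorem H.integral_norm_le {s : ℝ} (f : H s) :
    ∫ τ in Ioo (0 : ℝ) s, ‖f τ‖ ≤
      ‖f‖ * ((volume.restrict (Ioo (0 : ℝ) s) univ) ^ (1 / 2 : ℝ)).toReal := by
  have h := eLpNorm_le_eLpNorm_mul_rpow_measure_univ (p := 1) (q := 2) (by norm_num)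
    (Lp.aestronglyMeasurable f)
  have e : (1 / (1 : ENNReal).toReal - 1 / (2 : ENNReal).toReal) = (1 / 2 : ℝ) := by norm_num
  rw [e] at h
  rw [integral_norm_eq_lintegral_enorm (Lp.aestronglyMeasurable f), ← eLpNorm_one_eq_lintegral_enorm,
    Lp.norm_def, ← ENNReal.toReal_mul]
  refine ENNReal.toReal_mono (ENNReal.mul_ne_top (Lp.eLpNorm_ne_top f) ?_) h
  exact ENNReal.rpow_ne_top_of_nonneg (by norm_num) (measure_ne_top _ _)

theorem exists_bound_resolventLin (s β lam : ℝ) :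
    ∃ C : ℝ, ∀ f : H s, ‖resolventLin s β lam f‖ ≤ C * ‖f‖ := by
  set m := ((volume.restrict (Ioo (0 : ℝ) s) univ) ^ (1 / 2 : ℝ)).toReal with hm
  set M := ((volume.restrict (Ioo (0 : ℝ) s) univ).toNNReal ^ ((2 : ENNReal).toReal)⁻¹ : NNReal)
  set W := weightBound s β lam with hW
  have hW0 : 0 ≤ W := (Real.exp_pos _).le
  refine ⟨M * (|1 / β| * (W * (W * m))), fun f => ?_⟩
  have hI : 0 ≤ ∫ τ in Ioo (0 : ℝ) s, ‖f τ‖ := integral_nonneg fun _ => norm_nonneg _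
  have key : ‖resolventLin s β lam f‖ ≤
      M * (|1 / β| * (W * (W * ∫ τ in Ioo (0 : ℝ) s, ‖f τ‖))) := by
    refine Lp.norm_le_of_ae_bound (by positivity) ?_
    filter_upwards [MemLp.coeFn_toLp (memLp_resolventFun β lam f),
      ae_restrict_mem measurableSet_Ioo] with r hr hr'
    have : (resolventLin s β lam f) r = resolventFun β lam f r := hr
    rw [this]
    exact resolventFun_bound β lam f hr'
  refine key.trans ?_
  have := H.integral_norm_le f
  calc (M : ℝ) * (|1 / β| * (W * (W * ∫ τ in Ioo (0 : ℝ) s, ‖f τ‖)))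
      ≤ M * (|1 / β| * (W * (W * (‖f‖ * m)))) := by gcongr
    _ = M * (|1 / β| * (W * (W * m))) * ‖f‖ := by ring

/-- The bounded operator `(A - lam)⁻¹` on `L²(0, s)`, where `A f = -β f'` on
`D(A) = {f ∈ H¹(0, s) : f(0) = 0}`. -/
def resolvent (s β lam : ℝ) : H s →L[ℝ] H s where
  toLinearMap := resolventLin s β lam
  cont := by
    obtain ⟨C, hC⟩ := exists_bound_resolventLin s β lam
    exact AddMonoidHomClass.continuous_of_bound (resolventLin s β lam) C hC

/-- `B = ((A - lam)⁻¹)* (A - lam)⁻¹ = (A* - lam)⁻¹ (A - lam)⁻¹`. -/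
def opB (s β lam : ℝ) : H s →L[ℝ] H s :=
  (ContinuousLinearMap.adjoint (resolvent s β lam)).comp (resolvent s β lam)

/-- The `B`-norm `|x|_B = √⟨B x, x⟩`. -/
def normB (s β lam : ℝ) (x : H s) : ℝ := Real.sqrt (inner ℝ (opB s β lam x) x)

/-! ### Weak derivatives on `(0, s)`, the operator `A*` and the evaluation at `0` -/

/-- `h` is the weak derivative of `f` on `(0, s)`. -/
def IsWeakDeriv {s : ℝ} (f h : H s) : Prop :=
  ∀ ψ : ℝ → ℝ, ContDiff ℝ ∞ ψ → HasCompactSupport ψ → tsupport ψ ⊆ Ioo 0 s →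
    ∫ r in Ioo 0 s, f r * deriv ψ r = -∫ r in Ioo 0 s, h r * ψ r

/-- `F` is a representative of `f` that is continuous on the closed interval `[0, s]`. -/
def IsContRep {s : ℝ} (f : H s) (F : ℝ → ℝ) : Prop :=
  ContinuousOn F (Icc 0 s) ∧ ∀ᵐ r ∂(volume.restrict (Ioo 0 s)), f r = F r

/-- `D(A*) = {f ∈ H¹(0, s) : f(s) = 0}`. -/
def domAstar (s : ℝ) : Set (H s) :=
  {f | (∃ h : H s, IsWeakDeriv f h) ∧ ∃ F : ℝ → ℝ, IsContRep f F ∧ F s = 0}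

open Classical in
/-- `A* f = β f'` for `f ∈ D(A*)` (and `0` if `f` has no weak derivative in `L²`). -/
def Astar {s : ℝ} (β : ℝ) (f : H s) : H s :=
  if h : ∃ h : H s, IsWeakDeriv f h then β • h.choose else 0

open Classical in
/-- `δ₀ f = f(0)`, the value at `0` of the continuous representative of `f`
(and `0` if there is none). -/
def delta0 {s : ℝ} (f : H s) : ℝ :=
  if h : ∃ F : ℝ → ℝ, IsContRep f F then h.choose 0 else 0

/-! ### The control problem -/

/-- The data of the control problem: the length `s` of the interval, the coefficients `β`, `μ`
of the transport equation, the discount rate `ρ`, the number `lam` used to define `B`, the sets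
`Γ`, `Λ` of boundary and distributed control values, and the running cost `L(x, α, a)`. -/
structure Problem where
  s : ℝ
  β : ℝ
  μ : ℝ
  ρ : ℝ
  lam : ℝ
  Γ : Set ℝ
  Λ : Set ℝ
  L : H s → H s → ℝ → ℝ

namespace Problem

variable (P : Problem)

/-- `Σ`: the elements of `L²(0, s)` with values in `Λ`. -/
def Sig : Set (H P.s) := {γ | ∀ᵐ r ∂(volume.restrict (Ioo 0 P.s)), γ r ∈ P.Λ}

/-- `‖Γ‖ = sup {|a| : a ∈ Γ}`. -/
def normΓ : ℝ := sSup ((fun a : ℝ => |a|) '' P.Γ)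

/-- Admissible boundary controls (only the values at times `t ≥ 0` matter). -/
def boundaryControls : Set (ℝ → ℝ) := {a | Measurable a ∧ ∀ t, 0 ≤ t → a t ∈ P.Γ}

/-- Admissible distributed controls (only the values at times `t ≥ 0` matter). -/
def distributedControls : Set (ℝ → H P.s) :=
  {α | StronglyMeasurable α ∧ ∀ t, 0 ≤ t → α t ∈ P.Sig}

/-- `X` is the trajectory starting at `x` with controls `α`, `a`: the function in
`C([0, ∞); L²(0, s))` with `X(0) = x` that solves, in the dual of `D(A*)`, the state equation
`d/dt X = A X - μ X + α + β δ₀ a`, written in integrated form. -/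
def IsTrajectory (x : H P.s) (α : ℝ → H P.s) (a : ℝ → ℝ) (X : ℝ → H P.s) : Prop :=
  ContinuousOn X (Ici 0) ∧ X 0 = x ∧
    ∀ p ∈ domAstar P.s, ∀ t, 0 ≤ t →
      inner ℝ (X t) p = inner ℝ x p +
        ∫ τ in (0 : ℝ)..t, (inner ℝ (X τ) (Astar P.β p) - P.μ * inner ℝ (X τ) p
          + inner ℝ (α τ) p + P.β * delta0 p * a τ)

/-- The cost `∫₀^∞ e^{-ρ t} L(X(t), α(t), a(t)) dt`. -/
def cost (X : ℝ → H P.s) (α : ℝ → H P.s) (a : ℝ → ℝ) : ℝ :=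
  ∫ t in Ioi (0 : ℝ), Real.exp (-P.ρ * t) * P.L (X t) (α t) (a t)

/-- The value function: the infimum of the cost over all admissible controls. -/
def value (x : H P.s) : ℝ :=
  sInf {c | ∃ α ∈ P.distributedControls, ∃ a ∈ P.boundaryControls, ∃ X : ℝ → H P.s,
    P.IsTrajectory x α a X ∧ c = P.cost X α a}

/-! ### Viscosity sub- and supersolutions -/

/-- Lipschitz continuity with respect to the `B`-norm. -/
def BLipschitz (v : H P.s → ℝ) : Prop :=
  ∃ C : ℝ, ∀ x y, |v x - v y| ≤ C * normB P.s P.β P.lam (x - y)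

/-- `B`-lower semicontinuity: `φ(x) ≤ liminf φ(xₙ)` if `xₙ ⇀ x` and `|B (xₙ - x)| → 0`. -/
def BLowerSemicontinuous (φ : H P.s → ℝ) : Prop :=
  ∀ (x : H P.s) (X : ℕ → H P.s),
    (∀ z : H P.s, Tendsto (fun n => inner ℝ (X n) z) atTop (𝓝 (inner ℝ x z))) →
    Tendsto (fun n => ‖opB P.s P.β P.lam (X n - x)‖) atTop (𝓝 0) →
    ∀ c < φ x, ∀ᶠ n in atTop, c < φ (X n)

/-- Test functions of type 1. -/
def Test1 (φ : H P.s → ℝ) : Prop :=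
  ContDiff ℝ 1 φ ∧ P.BLowerSemicontinuous φ ∧ (∀ x, gradient φ x ∈ domAstar P.s) ∧
    Continuous fun x => Astar P.β (gradient φ x)

/-- Test functions of type 2: `g ∈ C²` with `g(x) = g₀(|x|)`, `g₀` nondecreasing on `[0, ∞)`. -/
def Test2 (g : H P.s → ℝ) (g₀ : ℝ → ℝ) : Prop :=
  ContDiff ℝ 2 g ∧ MonotoneOn g₀ (Ici 0) ∧ ∀ x, g x = g₀ ‖x‖

open Classical in
/-- `g₀'(r) / r`, continued to `r = 0` by its limit (which is `g₀''(0)`). -/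
def radialCoeff (g₀ : ℝ → ℝ) (r : ℝ) : ℝ :=
  if r = 0 then limUnder (𝓝[>] (0 : ℝ)) (fun t => deriv g₀ t / t) else deriv g₀ r / r

/-- `inf_{(α, a) ∈ Σ × Γ} (c a + ⟨q, α⟩ + L(x, α, a))`. -/
def infTerm (x : H P.s) (c : ℝ) (q : H P.s) : ℝ :=
  sInf ((fun w : H P.s × ℝ => c * w.2 + inner ℝ q w.1 + P.L x w.1 w.2) '' (P.Sig ×ˢ P.Γ))

/-- The regularity required of sub- and supersolutions:
continuous, bounded and Lipschitz with respect to the `B`-norm. -/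
def Admissible (u : H P.s → ℝ) : Prop :=
  Continuous u ∧ (∃ M : ℝ, ∀ x, |u x| ≤ M) ∧ P.BLipschitz u

/-- Subsolutions of the HJB equation. -/
def IsSubsolution (u : H P.s → ℝ) : Prop :=
  P.Admissible u ∧
    ∀ (φ g : H P.s → ℝ) (g₀ : ℝ → ℝ), P.Test1 φ → P.Test2 g g₀ →
    ∀ x : H P.s, IsLocalMax (fun y => u y - (φ y + g y)) x →
      P.ρ * u x - inner ℝ (Astar P.β (gradient φ x)) x
        - inner ℝ (gradient φ x + gradient g x) (-P.μ • x)
        - P.infTerm x (P.β * delta0 (gradient φ x)) (gradient φ x + gradient g x)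
      ≤ radialCoeff g₀ ‖x‖ * (P.β * P.normΓ ^ 2 / 2)

/-- Supersolutions of the HJB equation. -/
def IsSupersolution (v : H P.s → ℝ) : Prop :=
  P.Admissible v ∧
    ∀ (φ g : H P.s → ℝ) (g₀ : ℝ → ℝ), P.Test1 φ → P.Test2 g g₀ →
    ∀ x : H P.s, IsLocalMin (fun y => v y + (φ y + g y)) x →
      -(radialCoeff g₀ ‖x‖ * (P.β * P.normΓ ^ 2 / 2)) ≤
      P.ρ * v x + inner ℝ (Astar P.β (gradient φ x)) x
        + inner ℝ (gradient φ x + gradient g x) (-P.μ • x)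
        - P.infTerm x (-(P.β * delta0 (gradient φ x))) (-(gradient φ x + gradient g x))

/-- Solutions of the HJB equation. -/
def IsSolution (w : H P.s → ℝ) : Prop := P.IsSubsolution w ∧ P.IsSupersolution w

end Problem

end TransportHJB

end

noncomputable section

namespace TransportHJB

section

/-! ### Integration by parts for primitives -/

/-! Everything about `A` is reduced to the explicit Volterra operators `resolvent s β lam`, written
`R` below; for `lam = 0` this is `A⁻¹`. The adjoint `invAstar` of `A⁻¹` is a bijection of `L²` onto
`D(A*)`. An element of `D(A*)` is therefore always written `p = invAstar q`, and then `A* p = q` and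
`β δ₀ p = -⟨1, q⟩`: weak derivatives and continuous representatives disappear after the first part.
The one structural fact is dissipativity with boundary data: `⟨f, c + A⁻¹ f⟩ ≤ β c² / 2`
(`inner_const_add_resolvent_le`).

Comparison (`Standing.comparison`) doubles the variables: maximise `u(x) - v(y) - (c/2)|x - y|_B² -
(δ/2)(|x|² + |y|²)`. A maximum exists because `R` is compact, so `B`-Lipschitz functions are weakly
sequentially continuous on bounded sets. With `z = x₀ - y₀`, the gradient `c B z` of the `B`-penalty
lies in `D(A*)`. On subtracting the two viscosity inequalities the `δ₀` terms cancel, and `⟨A* c B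
z, z⟩ = c (⟨R z, z⟩ + lam |z|_B²) ≤ 0` by dissipativity. The remainders contain `c |z|_B²` and
`|z|_B`, which are `O(1/c)` by the Lipschitz bounds, and terms that vanish as `δ → 0`. Let `δ → 0`
first, then `c → ∞`.

The value function is `B`-Lipschitz because trajectories with equal controls differ by the semigroup
applied to the difference of initial states, and the semigroup is bounded in `B`-norm uniformly in
time (`norm_resolvent_semigroup_le`). Its two viscosity inequalities follow from dynamic programming
and short-time expansions of `φ` and `g` along trajectories, uniform in the controls. Both
inequalities need only upper bounds for `φ + g` along the trajectory. For `φ` this is the weak state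
equation tested with `∇φ`. For `g` it is a one-sided energy inequality: the boundary control is no
element of `L²`, but by dissipativity it adds at most `β‖Γ‖²` to the growth rate of `|X|²`, which is
the origin of the right-hand sides in the definitions of sub- and supersolution. -/

theorem integral_mul_eq_sub_integral_deriv_mul {F g : ℝ → ℝ} {a b : ℝ}
    (hF : AbsolutelyContinuousOnInterval F a b) (hg : IntervalIntegrable g volume a b) :
    ∫ x in a..b, F x * g x =
      F b * (∫ t in a..b, g t) - ∫ x in a..b, deriv F x * ∫ t in a..x, g t := by
  have hG := hg.absolutelyContinuousOnInterval_intervalIntegral (c := a) (by simp)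
  have h := hF.integral_mul_deriv_eq_deriv_mul hG
  simp only [intervalIntegral.integral_same, mul_zero, sub_zero] at h
  rw [← h]
  refine intervalIntegral.integral_congr_ae ?_
  filter_upwards [hg.ae_hasDerivAt_integral] with x hx hx'
  rw [(hx (uIoc_subset_uIcc hx') a (by simp)).deriv]

theorem integral_primitive_mul {f g : ℝ → ℝ} {a b : ℝ}
    (hf : IntervalIntegrable f volume a b) (hg : IntervalIntegrable g volume a b) :
    ∫ x in a..b, (∫ t in a..x, f t) * g x =
      (∫ t in a..b, f t) * (∫ t in a..b, g t) - ∫ x in a..b, f x * ∫ t in a..x, g t := by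
  rw [integral_mul_eq_sub_integral_deriv_mul
    (hf.absolutelyContinuousOnInterval_intervalIntegral (c := a) (by simp)) hg]
  congr 1
  refine intervalIntegral.integral_congr_ae ?_
  filter_upwards [hf.ae_hasDerivAt_integral] with x hx hx'
  rw [(hx (uIoc_subset_uIcc hx') a (by simp)).deriv]

theorem integral_contDiff_mul {φ g : ℝ → ℝ} {a b : ℝ} (hφ : ContDiff ℝ 1 φ)
    (hg : IntervalIntegrable g volume a b) :
    ∫ x in a..b, φ x * g x =
      φ b * (∫ t in a..b, g t) - ∫ x in a..b, deriv φ x * ∫ t in a..x, g t :=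
  integral_mul_eq_sub_integral_deriv_mul
    (hφ.contDiffOn.absolutelyContinuousOnInterval) hg

/-! ### The space `L²(0, s)` -/

variable {s : ℝ}

theorem H.inner_eq (f g : H s) : inner ℝ f g = ∫ r in Ioo 0 s, f r * g r := by
  rw [L2.inner_def]
  refine integral_congr_ae (Eventually.of_forall fun r => ?_)
  simp [mul_comm]

theorem H.inner_eq_interval (hs : 0 ≤ s) (f g : H s) :
    inner ℝ f g = ∫ r in (0 : ℝ)..s, f r * g r := by
  rw [H.inner_eq, intervalIntegral.integral_of_le hs, integral_Ioc_eq_integral_Ioo]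

theorem H.intervalIntegrable (f : H s) {r : ℝ} (hr : r ∈ Icc 0 s) :
    IntervalIntegrable f volume 0 r := by
  simpa using intervalIntegrable_weight 0 f hr

theorem H.ae_congr_interval {f g : ℝ → ℝ} (h : f =ᵐ[volume.restrict (Ioo 0 s)] g) {r : ℝ}
    (hr : r ∈ Icc 0 s) : ∫ t in (0 : ℝ)..r, f t = ∫ t in (0 : ℝ)..r, g t := by
  refine intervalIntegral.integral_congr_ae_restrict ?_
  rw [uIoc_of_le hr.1, restrict_Ioo_eq_restrict_Ioc.symm]
  exact ae_restrict_of_ae_restrict_of_subset (Ioo_subset_Ioo_right hr.2) h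

/-- The constant function `c` as an element of `L²(0, s)`. -/
def constH (s c : ℝ) : H s := (memLp_const c).toLp (fun _ => c)

theorem coeFn_constH (s c : ℝ) : constH s c =ᵐ[volume.restrict (Ioo 0 s)] fun _ => c :=
  MemLp.coeFn_toLp _

theorem inner_constH_one (hs : 0 ≤ s) (f : H s) :
    inner ℝ (constH s 1) f = ∫ r in (0 : ℝ)..s, f r := by
  rw [H.inner_eq_interval hs]
  refine H.ae_congr_interval ?_ (right_mem_Icc.2 hs)
  filter_upwards [coeFn_constH s 1] with r hr
  rw [hr, one_mul]

variable {β lam : ℝ}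

theorem coeFn_resolvent (β lam : ℝ) (f : H s) :
    resolvent s β lam f =ᵐ[volume.restrict (Ioo 0 s)] resolventFun β lam f :=
  MemLp.coeFn_toLp (memLp_resolventFun β lam f)

theorem coeFn_resolvent_zero (β : ℝ) (f : H s) :
    resolvent s β 0 f =ᵐ[volume.restrict (Ioo 0 s)]
      fun r => -(1 / β) * ∫ t in (0 : ℝ)..r, f t := by
  filter_upwards [coeFn_resolvent β 0 f] with r hr
  rw [hr, resolventFun]
  simp

/-- The adjoint of `A⁻¹`, i.e. the inverse of `A*`. -/
def invAstar (s β : ℝ) : H s →L[ℝ] H s := ContinuousLinearMap.adjoint (resolvent s β 0)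

theorem inner_invAstar (f q : H s) :
    inner ℝ f (invAstar s β q) = inner ℝ (resolvent s β 0 f) q :=
  ContinuousLinearMap.adjoint_inner_right _ _ _

theorem continuousOn_primitive (hs : 0 ≤ s) (f : H s) :
    ContinuousOn (fun r => ∫ t in (0 : ℝ)..r, f t) (Icc 0 s) := by
  have := intervalIntegral.continuousOn_primitive_interval'
    (f.intervalIntegrable (right_mem_Icc.2 hs)) (left_mem_uIcc)
  rwa [uIcc_of_le hs] at this

/-- The adjoint is only given by duality. Integration by parts identifies it with a primitive that
vanishes at `s`, from which membership in `D(A*)`, the weak derivative and the value at `0` can be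
read off. -/
theorem coeFn_invAstar (hs : 0 ≤ s) (β : ℝ) (q : H s) :
    invAstar s β q =ᵐ[volume.restrict (Ioo 0 s)]
      fun r => -(1 / β) * ((∫ t in (0 : ℝ)..s, q t) - ∫ t in (0 : ℝ)..r, q t) := by
  set G : ℝ → ℝ := fun r => -(1 / β) * ((∫ t in (0 : ℝ)..s, q t) - ∫ t in (0 : ℝ)..r, q t)
    with hG
  have hGc : ContinuousOn G (Icc 0 s) :=
    continuousOn_const.mul (continuousOn_const.sub (continuousOn_primitive hs q))
  have hGm : MemLp G 2 (volume.restrict (Ioo 0 s)) := by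
    obtain ⟨C, hC⟩ := isCompact_Icc.exists_bound_of_continuousOn hGc
    refine MemLp.of_bound ((hGc.mono Ioo_subset_Icc_self).aestronglyMeasurable
      measurableSet_Ioo) C ?_
    exact (ae_restrict_iff' measurableSet_Ioo).2
      (Eventually.of_forall fun r hr => hC r (Ioo_subset_Icc_self hr))
  suffices h : invAstar s β q = hGm.toLp G by
    rw [h]; exact MemLp.coeFn_toLp hGm
  refine ext_inner_left ℝ fun f => ?_
  have hss := right_mem_Icc.2 hs
  rw [inner_invAstar, H.inner_eq_interval hs, H.inner_eq_interval hs]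
  have h1 : ∫ r in (0 : ℝ)..s, (resolvent s β 0 f) r * q r =
      ∫ r in (0 : ℝ)..s, -(1 / β) * ((∫ t in (0 : ℝ)..r, f t) * q r) := by
    refine H.ae_congr_interval ?_ hss
    filter_upwards [coeFn_resolvent_zero β f] with r hr
    rw [hr]; ring
  have h2 : ∫ r in (0 : ℝ)..s, f r * (hGm.toLp G) r =
      ∫ r in (0 : ℝ)..s, -(1 / β) * (f r * (∫ t in (0 : ℝ)..s, q t)
        - f r * ∫ t in (0 : ℝ)..r, q t) := by
    refine H.ae_congr_interval ?_ hss
    filter_upwards [MemLp.coeFn_toLp hGm] with r hr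
    rw [hr, hG]; ring
  rw [h1, h2, intervalIntegral.integral_const_mul, intervalIntegral.integral_const_mul,
    integral_primitive_mul (f.intervalIntegrable hss) (q.intervalIntegrable hss),
    intervalIntegral.integral_sub, intervalIntegral.integral_mul_const]
  · exact (f.intervalIntegrable hss).mul_const _
  · refine (f.intervalIntegrable hss).mul_continuousOn ?_
    rw [uIcc_of_le hs]
    exact continuousOn_primitive hs q

/-- `A` with an inhomogeneous boundary value is dissipative up to a boundary term. -/
theorem inner_const_add_resolvent_le (hs : 0 ≤ s) (hβ : 0 < β) (f : H s) (c : ℝ) :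
    inner ℝ f (constH s c + resolvent s β 0 f) ≤ β * c ^ 2 / 2 := by
  have hss := right_mem_Icc.2 hs
  have hi := f.intervalIntegrable hss
  set I := ∫ r in (0 : ℝ)..s, f r
  have h1 : inner ℝ f (constH s c) = c * I := by
    rw [H.inner_eq_interval hs, ← intervalIntegral.integral_const_mul]
    refine H.ae_congr_interval ?_ hss
    filter_upwards [coeFn_constH s c] with r hr
    rw [hr, mul_comm]
  have h2 : inner ℝ f (resolvent s β 0 f) = -(1 / β) * (I ^ 2 / 2) := by
    have := integral_primitive_mul hi hi
    rw [H.inner_eq_interval hs]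
    have h3 : ∫ r in (0 : ℝ)..s, f r * (resolvent s β 0 f) r =
        ∫ r in (0 : ℝ)..s, -(1 / β) * (f r * ∫ t in (0 : ℝ)..r, f t) := by
      refine H.ae_congr_interval ?_ hss
      filter_upwards [coeFn_resolvent_zero β f] with r hr
      rw [hr]; ring
    rw [h3, intervalIntegral.integral_const_mul]
    congr 1
    simp_rw [mul_comm (∫ t in (0 : ℝ).._, f t)] at this
    linarith
  rw [inner_add_right, h1, h2]
  -- For `y = c + A⁻¹ f` one has `y(s) = c - I/β`. The defect in the inequality is the outflow
  -- energy `β y(s)² / 2`.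
  have : β * c ^ 2 / 2 - (c * I + -(1 / β) * (I ^ 2 / 2)) = (β * c - I) ^ 2 / (2 * β) := by
    field_simp; ring
  have h3 : 0 ≤ (β * c - I) ^ 2 / (2 * β) := by positivity
  linarith

theorem inner_resolvent_zero_nonpos (hs : 0 ≤ s) (hβ : 0 < β) (f : H s) :
    inner ℝ f (resolvent s β 0 f) ≤ 0 := by
  have h0 : constH s 0 = 0 := by
    exact MemLp.toLp_zero (memLp_const 0)
  simpa [h0] using inner_const_add_resolvent_le hs hβ f 0

end

section

variable {s β lam : ℝ}

/-! ### Resolvent identities -/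

/-- This is `A g = f + lam g` for `g = R f`, with `A⁻¹` applied to both sides. It holds for every
real `lam`, since the Volterra formula needs no sign. -/
theorem resolvent_eq_resolvent_zero (β lam : ℝ) (f : H s) :
    resolvent s β lam f = resolvent s β 0 (f + lam • resolvent s β lam f) := by
  refine Lp.ext ?_
  filter_upwards [coeFn_resolvent β lam f,
    coeFn_resolvent_zero β (f + lam • resolvent s β lam f), ae_restrict_mem measurableSet_Ioo]
    with r h1 h2 hr
  rw [h1, h2]
  have hr' : r ∈ Icc 0 s := Ioo_subset_Icc_self hr
  set κ := lam / β with hκ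
  set G : ℝ → ℝ := fun r => ∫ τ in (0 : ℝ)..r, Real.exp (κ * τ) * f τ with hG
  have hGi : IntervalIntegrable (fun x => Real.exp (-κ * x) * G x) volume 0 r := by
    refine ContinuousOn.intervalIntegrable ?_
    refine ContinuousOn.mul (by fun_prop) ?_
    exact intervalIntegral.continuousOn_primitive_interval'
      (intervalIntegrable_weight κ f hr') left_mem_uIcc
  have e1 : ∫ t in (0 : ℝ)..r, (f + lam • resolvent s β lam f : H s) t =
      ∫ t in (0 : ℝ)..r, (f t - κ * (Real.exp (-κ * t) * G t)) := by
    refine H.ae_congr_interval ?_ hr'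
    filter_upwards [coeFn_resolvent β lam f, Lp.coeFn_add f (lam • resolvent s β lam f),
      Lp.coeFn_smul lam (resolvent s β lam f)] with t h3 h4 h5
    rw [h4, Pi.add_apply, h5, Pi.smul_apply, h3, resolventFun, smul_eq_mul, hG, hκ]
    ring
  -- Write `f = e^{-κt} (e^{κt} f)` and integrate by parts, with `G` the primitive of the second
  -- factor.
  have e2 : ∫ t in (0 : ℝ)..r, f t = Real.exp (-κ * r) * G r
      + κ * ∫ t in (0 : ℝ)..r, Real.exp (-κ * t) * G t := by
    have h := integral_contDiff_mul (φ := fun x => Real.exp (-κ * x)) (by fun_prop)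
      (intervalIntegrable_weight κ f hr')
    have hd : ∀ x, deriv (fun x => Real.exp (-κ * x)) x = -κ * Real.exp (-κ * x) := by
      intro x
      have : HasDerivAt (fun x => Real.exp (-κ * x)) (Real.exp (-κ * x) * (-κ * 1)) x :=
        ((hasDerivAt_id x).const_mul (-κ)).exp
      rw [this.deriv]; ring
    simp_rw [hd, ← mul_assoc, ← Real.exp_add] at h
    simp only [neg_mul, neg_add_cancel, Real.exp_zero, one_mul, mul_assoc,
      intervalIntegral.integral_neg, intervalIntegral.integral_const_mul, sub_neg_eq_add] at h
    simpa only [neg_mul] using h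
  rw [e1, intervalIntegral.integral_sub (f.intervalIntegrable hr') (hGi.const_mul _),
    intervalIntegral.integral_const_mul, e2, resolventFun]
  ring

/-- The commutator `z` satisfies `z = lam A⁻¹ z`. Pairing with `z`, dissipativity and `lam > 0`
force `‖z‖² ≤ 0`. -/
theorem resolvent_resolvent_zero_comm (hs : 0 ≤ s) (hβ : 0 < β) (hlam : 0 < lam) (f : H s) :
    resolvent s β lam (resolvent s β 0 f) = resolvent s β 0 (resolvent s β lam f) := by
  set z := resolvent s β lam (resolvent s β 0 f) - resolvent s β 0 (resolvent s β lam f) with hz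
  have h1 : z = lam • resolvent s β 0 z := by
    have e1 := resolvent_eq_resolvent_zero β lam (resolvent s β 0 f)
    have e2 := congrArg (resolvent s β 0) (resolvent_eq_resolvent_zero β lam f)
    calc z = _ := by rw [hz, e1, e2]
      _ = _ := by simp only [hz, map_add, map_sub, map_smul, smul_sub]; abel
  have h2 : ‖z‖ ^ 2 ≤ 0 := by
    rw [← real_inner_self_eq_norm_sq]
    nth_rewrite 2 [h1]
    rw [inner_smul_right]
    exact mul_nonpos_of_nonneg_of_nonpos hlam.le (inner_resolvent_zero_nonpos hs hβ z)
  have h3 : z = 0 := by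
    have : ‖z‖ = 0 := by nlinarith [norm_nonneg z]
    exact norm_eq_zero.1 this
  exact sub_eq_zero.1 h3

/-- The range of `R*` lies in `D(A*)`, with `A* R* q = q + lam R* q`. This makes `|x - y|_B²` an
admissible test function of type 1. -/
theorem adjoint_resolvent_eq (hs : 0 ≤ s) (hβ : 0 < β) (hlam : 0 < lam) (q : H s) :
    ContinuousLinearMap.adjoint (resolvent s β lam) q =
      invAstar s β (q + lam • ContinuousLinearMap.adjoint (resolvent s β lam) q) := by
  refine ext_inner_left ℝ fun f => ?_
  rw [inner_invAstar, ContinuousLinearMap.adjoint_inner_right, inner_add_right,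
    inner_smul_right, ContinuousLinearMap.adjoint_inner_right,
    resolvent_resolvent_zero_comm hs hβ hlam]
  nth_rewrite 1 [resolvent_eq_resolvent_zero β lam f]
  rw [map_add, map_smul, inner_add_left, real_inner_smul_left]

/-- Dissipativity applied to `f + lam R f`, whose image under `A⁻¹` is `R f`. It fixes the sign of
the unbounded term in the comparison argument. -/
theorem inner_resolvent_le (hs : 0 ≤ s) (hβ : 0 < β) (lam : ℝ) (f : H s) :
    inner ℝ f (resolvent s β lam f) ≤ -lam * ‖resolvent s β lam f‖ ^ 2 := by
  have h := inner_resolvent_zero_nonpos hs hβ (f + lam • resolvent s β lam f)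
  rw [← resolvent_eq_resolvent_zero, inner_add_left, real_inner_smul_left,
    real_inner_self_eq_norm_sq] at h
  linarith

theorem inner_opB (x y : H s) :
    inner ℝ (opB s β lam x) y = inner ℝ (resolvent s β lam x) (resolvent s β lam y) := by
  rw [opB, ContinuousLinearMap.comp_apply, ContinuousLinearMap.adjoint_inner_left]

theorem normB_eq (x : H s) : normB s β lam x = ‖resolvent s β lam x‖ := by
  rw [normB, inner_opB, real_inner_self_eq_norm_sq, Real.sqrt_sq (norm_nonneg _)]

/-! ### The domain of `A*` -/

theorem memLp_of_continuous {ψ : ℝ → ℝ} (hψ : Continuous ψ) :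
    MemLp ψ 2 (volume.restrict (Ioo 0 s)) := by
  obtain ⟨C, hC⟩ := isCompact_Icc.exists_bound_of_continuousOn
    (hψ.continuousOn (s := Icc (0 : ℝ) s))
  refine MemLp.of_bound hψ.aestronglyMeasurable C ?_
  exact (ae_restrict_iff' measurableSet_Ioo).2
    (Eventually.of_forall fun r hr => hC r (Ioo_subset_Icc_self hr))

/-- A continuous function as an element of `L²(0, s)`. -/
def ofContinuous (s : ℝ) {ψ : ℝ → ℝ} (hψ : Continuous ψ) : H s :=
  (memLp_of_continuous (s := s) hψ).toLp ψ

theorem inner_ofContinuous (f : H s) {ψ : ℝ → ℝ} (hψ : Continuous ψ) :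
    inner ℝ f (ofContinuous s hψ) = ∫ r in Ioo 0 s, f r * ψ r := by
  rw [H.inner_eq]
  refine integral_congr_ae ?_
  filter_upwards [MemLp.coeFn_toLp (memLp_of_continuous (s := s) hψ)] with r hr
  rw [ofContinuous, hr]

/-- A smooth function vanishing at `0` is in `D(A)`, and `A⁻¹` undoes its derivative. By duality
this yields the weak derivative of `invAstar q`. -/
theorem resolvent_zero_ofContinuous_deriv (β : ℝ) {ψ : ℝ → ℝ} (hψ : ContDiff ℝ ∞ ψ)
    (h0 : ψ 0 = 0) :
    resolvent s β 0 (ofContinuous s (hψ.continuous_deriv (by simp))) =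
      -(1 / β) • ofContinuous s hψ.continuous := by
  refine Lp.ext ?_
  filter_upwards [coeFn_resolvent_zero β (ofContinuous s (hψ.continuous_deriv (by simp))),
    Lp.coeFn_smul (-(1 / β)) (ofContinuous s hψ.continuous),
    MemLp.coeFn_toLp (memLp_of_continuous (s := s) hψ.continuous),
    ae_restrict_mem measurableSet_Ioo] with r h1 h2 h3 hr
  rw [h1, h2, Pi.smul_apply, ofContinuous, ofContinuous, h3, smul_eq_mul]
  congr 1
  rw [H.ae_congr_interval (MemLp.coeFn_toLp
    (memLp_of_continuous (s := s) (hψ.continuous_deriv (by simp)))) (Ioo_subset_Icc_self hr),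
    intervalIntegral.integral_deriv_eq_sub (fun x _ => hψ.differentiable (by simp) x)
      ((hψ.continuous_deriv (by simp)).intervalIntegrable _ _), h0, sub_zero]

theorem eq_zero_of_tsupport_subset {ψ : ℝ → ℝ} (h : tsupport ψ ⊆ Ioo 0 s) : ψ 0 = 0 := by
  by_contra h0
  exact (h (subset_tsupport ψ h0)).1.false

theorem isWeakDeriv_invAstar (β : ℝ) (q : H s) :
    IsWeakDeriv (invAstar s β q) ((1 / β) • q) := by
  intro ψ hψ _ hsupp
  rw [← inner_ofContinuous _ (hψ.continuous_deriv (by simp)), ← inner_ofContinuous _ hψ.continuous,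
    real_inner_comm, inner_invAstar, resolvent_zero_ofContinuous_deriv β hψ
      (eq_zero_of_tsupport_subset hsupp), real_inner_smul_left, real_inner_smul_left,
    real_inner_comm]
  ring

theorem H.locallyIntegrableOn (f : H s) : LocallyIntegrableOn f (Ioo 0 s) :=
  IntegrableOn.locallyIntegrableOn f.integrable

theorem H.eq_of_test {f g : H s} (h : ∀ ψ : ℝ → ℝ, ContDiff ℝ ∞ ψ → HasCompactSupport ψ →
    tsupport ψ ⊆ Ioo 0 s → ∫ r in Ioo 0 s, f r * ψ r = ∫ r in Ioo 0 s, g r * ψ r) : f = g := by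
  rw [← sub_eq_zero]
  refine Lp.ext ?_
  have key : ∀ᵐ r, r ∈ Ioo 0 s → (f - g : H s) r = 0 := by
    refine isOpen_Ioo.ae_eq_zero_of_integral_contDiff_smul_eq_zero
      (f - g).locallyIntegrableOn fun ψ hψ hc hsupp => ?_
    have hout : ∀ r, r ∉ Ioo 0 s → ψ r • (f - g : H s) r = 0 := by
      intro r hr
      rw [image_eq_zero_of_notMem_tsupport fun h' => hr (hsupp h'), zero_smul]
    rw [← setIntegral_eq_integral_of_forall_compl_eq_zero hout]
    have h' := h ψ hψ hc hsupp
    rw [← inner_ofContinuous _ hψ.continuous, ← inner_ofContinuous _ hψ.continuous,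
      ← sub_eq_zero, ← inner_sub_left, inner_ofContinuous] at h'
    simpa [mul_comm] using h'
  filter_upwards [(ae_restrict_iff' measurableSet_Ioo).2 key,
    Lp.coeFn_zero ℝ 2 (volume.restrict (Ioo 0 s))] with r h1 h2
  rw [h1, h2]; rfl

theorem IsWeakDeriv.unique {f h₁ h₂ : H s} (H₁ : IsWeakDeriv f h₁) (H₂ : IsWeakDeriv f h₂) :
    h₁ = h₂ :=
  H.eq_of_test fun ψ hψ hc hsupp => by
    have := (H₁ ψ hψ hc hsupp).symm.trans (H₂ ψ hψ hc hsupp)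
    linarith

theorem IsWeakDeriv.sub {f₁ f₂ h₁ h₂ : H s} (H₁ : IsWeakDeriv f₁ h₁) (H₂ : IsWeakDeriv f₂ h₂) :
    IsWeakDeriv (f₁ - f₂) (h₁ - h₂) := by
  intro ψ hψ hc hsupp
  have e₁ := H₁ ψ hψ hc hsupp
  have e₂ := H₂ ψ hψ hc hsupp
  rw [← inner_ofContinuous _ (hψ.continuous_deriv (by simp)),
    ← inner_ofContinuous _ hψ.continuous] at e₁ e₂ ⊢
  rw [inner_sub_left, inner_sub_left, e₁, e₂]
  ring

theorem Astar_eq_of_isWeakDeriv (β : ℝ) {f h : H s} (hf : IsWeakDeriv f h) :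
    Astar β f = β • h := by
  have hex : ∃ h : H s, IsWeakDeriv f h := ⟨h, hf⟩
  rw [Astar, dif_pos hex, hex.choose_spec.unique hf]

theorem IsContRep.eqOn (hs : 0 < s) {f : H s} {F G : ℝ → ℝ} (hF : IsContRep f F)
    (hG : IsContRep f G) : EqOn F G (Icc 0 s) := by
  have h : ∀ᵐ r ∂(volume.restrict (Ioo 0 s)), F r = G r := by
    filter_upwards [hF.2, hG.2] with r h1 h2
    rw [← h1, h2]
  have h1 : EqOn F G (Ioo 0 s) :=
    Measure.eqOn_open_of_ae_eq h isOpen_Ioo (hF.1.mono Ioo_subset_Icc_self)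
      (hG.1.mono Ioo_subset_Icc_self)
  have := h1.of_subset_closure hF.1 hG.1 Ioo_subset_Icc_self
    (by rw [closure_Ioo hs.ne])
  exact this

theorem delta0_eq (hs : 0 < s) {f : H s} {F : ℝ → ℝ} (hF : IsContRep f F) :
    delta0 f = F 0 := by
  have hex : ∃ F : ℝ → ℝ, IsContRep f F := ⟨F, hF⟩
  rw [delta0, dif_pos hex]
  exact hex.choose_spec.eqOn hs hF (left_mem_Icc.2 hs.le)

theorem isContRep_invAstar (hs : 0 ≤ s) (β : ℝ) (q : H s) :
    IsContRep (invAstar s β q)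
      fun r => -(1 / β) * ((∫ t in (0 : ℝ)..s, q t) - ∫ t in (0 : ℝ)..r, q t) :=
  ⟨continuousOn_const.mul (continuousOn_const.sub (continuousOn_primitive hs q)),
    coeFn_invAstar hs β q⟩

theorem invAstar_mem_domAstar (hs : 0 ≤ s) (β : ℝ) (q : H s) :
    invAstar s β q ∈ domAstar s :=
  ⟨⟨_, isWeakDeriv_invAstar β q⟩, _, isContRep_invAstar hs β q, by simp⟩

theorem Astar_invAstar (hβ : β ≠ 0) (q : H s) : Astar β (invAstar s β q) = q := by
  rw [Astar_eq_of_isWeakDeriv β (isWeakDeriv_invAstar β q), smul_smul, mul_one_div_cancel hβ,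
    one_smul]

theorem delta0_invAstar (hs : 0 < s) (hβ : β ≠ 0) (q : H s) :
    β * delta0 (invAstar s β q) = -inner ℝ (constH s 1) q := by
  rw [delta0_eq hs (isContRep_invAstar hs.le β q), inner_constH_one hs.le]
  simp only [intervalIntegral.integral_same, sub_zero]
  field_simp

theorem exists_Icc_of_isCompact {K : Set ℝ} (hK : IsCompact K) (hne : K.Nonempty)
    (hsub : K ⊆ Ioo 0 s) : ∃ a b, 0 < a ∧ b < s ∧ K ⊆ Icc a b :=
  ⟨sInf K, sSup K, (hsub (hK.sInf_mem hne)).1, (hsub (hK.sSup_mem hne)).2, fun _ hx =>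
    ⟨csInf_le hK.bddBelow hx, le_csSup hK.bddAbove hx⟩⟩

/-- A function in `L²(0, s)` with vanishing weak derivative is constant. -/
theorem IsWeakDeriv.eq_constH (hs : 0 < s) {u : H s} (hu : IsWeakDeriv u 0) :
    ∃ c, u = constH s c := by
  let b : ContDiffBump (s / 2) := ⟨s / 8, s / 4, by positivity, by linarith⟩
  set χ₀ : ℝ → ℝ := b.normed volume with hχ₀
  have hχ₀s : ContDiff ℝ ∞ χ₀ := b.contDiff_normed
  have hχ₀c : HasCompactSupport χ₀ := b.hasCompactSupport_normed
  have hχ₀t : tsupport χ₀ ⊆ Ioo 0 s := by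
    rw [hχ₀, b.tsupport_normed_eq, Real.closedBall_eq_Icc]
    refine Icc_subset_Ioo ?_ ?_ <;> simp only [b] <;> linarith
  have hint : ∀ χ : ℝ → ℝ, tsupport χ ⊆ Ioo 0 s → ∫ x, χ x = ∫ x in (0 : ℝ)..s, χ x := by
    intro χ hχ
    rw [intervalIntegral.integral_of_le hs.le, integral_Ioc_eq_integral_Ioo]
    exact (setIntegral_eq_integral_of_forall_compl_eq_zero fun r hr =>
      image_eq_zero_of_notMem_tsupport fun h' => hr (hχ h')).symm
  have hχ₀i : ∫ x, χ₀ x = 1 := b.integral_normed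
  refine ⟨∫ r in Ioo 0 s, u r * χ₀ r, H.eq_of_test fun χ hχ hχc hχt => ?_⟩
  set m := ∫ x, χ x with hm
  -- The du Bois-Reymond argument: subtracting the multiple `m χ₀` gives mean zero, so the primitive
  -- of `η` has compact support in `(0, s)` and may be used to test the weak derivative.
  set η : ℝ → ℝ := fun r => χ r - m * χ₀ r with hη
  have hηs : ContDiff ℝ ∞ η := hχ.sub (contDiff_const.mul hχ₀s)
  obtain ⟨a, d, ha, hd, hK⟩ := exists_Icc_of_isCompact (s := s) (hχ₀c.isCompact.union hχc.isCompact)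
    ⟨s / 2, Or.inl (subset_tsupport _ (by
      rw [hχ₀, b.support_normed_eq]; exact Metric.mem_ball_self b.rOut_pos))⟩
    (union_subset hχ₀t hχt)
  have hη0 : ∀ r, r ∉ Icc a d → η r = 0 := by
    intro r hr
    have h1 : χ r = 0 := image_eq_zero_of_notMem_tsupport fun h' => hr (hK (Or.inr h'))
    have h2 : χ₀ r = 0 := image_eq_zero_of_notMem_tsupport fun h' => hr (hK (Or.inl h'))
    simp [hη, h1, h2]
  set ψ : ℝ → ℝ := fun r => ∫ t in (0 : ℝ)..r, η t with hψ
  have hψd : ∀ r, HasDerivAt ψ (η r) r := fun r =>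
    intervalIntegral.integral_hasDerivAt_right (hηs.continuous.intervalIntegrable _ _)
      hηs.continuous.stronglyMeasurable.stronglyMeasurableAtFilter hηs.continuous.continuousAt
  have hψd' : deriv ψ = η := funext fun r => (hψd r).deriv
  have hψs : ContDiff ℝ ∞ ψ := by
    rw [contDiff_infty_iff_deriv, hψd']
    exact ⟨fun r => (hψd r).differentiableAt, hηs⟩
  have hηi : ∫ t in (0 : ℝ)..s, η t = 0 := by
    rw [hη, intervalIntegral.integral_sub (hχ.continuous.intervalIntegrable _ _)
      ((hχ₀s.continuous.intervalIntegrable _ _).const_mul _),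
      intervalIntegral.integral_const_mul, ← hint χ hχt, ← hint χ₀ hχ₀t, hχ₀i, ← hm]
    ring
  -- To the left of `a` the integrand vanishes. To the right of `d` the total integral is zero, so
  -- one may integrate from `s` instead of `0`.
  have hψ0 : ∀ r, r ∉ Icc a d → ψ r = 0 := by
    intro r hr
    rw [mem_Icc, not_and_or, not_le, not_le] at hr
    rcases hr with hr | hr
    · rw [hψ]
      refine intervalIntegral.integral_zero_ae (Eventually.of_forall fun t ht => hη0 t fun h' => ?_)
      rcases le_total 0 r with h0 | h0
      · rw [uIoc_of_le h0] at ht; linarith [ht.2, h'.1]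
      · rw [uIoc_of_ge h0] at ht; linarith [ht.2, h'.1]
    · have h1 : ψ r = ∫ t in s..r, η t := by
        rw [hψ]
        dsimp only
        rw [← intervalIntegral.integral_add_adjacent_intervals
          (hηs.continuous.intervalIntegrable 0 s) (hηs.continuous.intervalIntegrable s r), hηi,
          zero_add]
      rw [h1]
      refine intervalIntegral.integral_zero_ae (Eventually.of_forall fun t ht => hη0 t fun h' => ?_)
      rcases le_total s r with h0 | h0
      · rw [uIoc_of_le h0] at ht; linarith [ht.1, h'.2]
      · rw [uIoc_of_ge h0] at ht; linarith [ht.1, h'.2]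
  have hψt : tsupport ψ ⊆ Icc a d := closure_minimal (fun r hr => by
    by_contra h'; exact hr (hψ0 r h')) isClosed_Icc
  have key := hu ψ hψs (HasCompactSupport.of_support_subset_isCompact isCompact_Icc
    ((subset_tsupport ψ).trans hψt)) (hψt.trans (Icc_subset_Ioo ha hd))
  have hz : ∫ r in Ioo 0 s, (0 : H s) r * ψ r = 0 := by
    rw [← inner_ofContinuous _ hψs.continuous, inner_zero_left]
  rw [hz, neg_zero, hψd'] at key
  have hi : ∀ {θ : ℝ → ℝ}, Continuous θ → Integrable (fun r => u r * θ r)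
      (volume.restrict (Ioo 0 s)) := fun hθ => by
    have := (Lp.memLp u).integrable_mul (memLp_of_continuous (s := s) hθ)
    exact this
  have e1 : ∫ r in Ioo 0 s, u r * η r =
      (∫ r in Ioo 0 s, u r * χ r) - m * ∫ r in Ioo 0 s, u r * χ₀ r := by
    rw [← integral_const_mul, ← integral_sub (hi hχ.continuous) ((hi hχ₀s.continuous).const_mul _)]
    refine integral_congr_ae (Eventually.of_forall fun r => ?_)
    simp only [hη]; ring
  have e2 : ∫ r in Ioo 0 s, constH s (∫ r in Ioo 0 s, u r * χ₀ r) r * χ r =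
      (∫ r in Ioo 0 s, u r * χ₀ r) * m := by
    rw [hm, hint χ hχt, intervalIntegral.integral_of_le hs.le, integral_Ioc_eq_integral_Ioo,
      ← integral_const_mul]
    refine integral_congr_ae ?_
    filter_upwards [coeFn_constH s (∫ r in Ioo 0 s, u r * χ₀ r)] with r hr
    rw [hr]
  rw [e2]
  linarith

/-- `p` and `invAstar (A* p)` have the same weak derivative, so they differ by a constant, which is
zero because both continuous representatives vanish at `s`. -/
theorem invAstar_Astar (hs : 0 < s) (hβ : β ≠ 0) {p : H s} (hp : p ∈ domAstar s) :
    invAstar s β (Astar β p) = p := by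
  obtain ⟨⟨h, hh⟩, F, hF, hFs⟩ := hp
  have hA := Astar_eq_of_isWeakDeriv β hh
  have h1 := isWeakDeriv_invAstar (s := s) β (Astar β p)
  rw [hA, smul_smul, one_div_mul_cancel hβ, one_smul, ← hA] at h1
  have h2 := hh.sub h1
  rw [sub_self] at h2
  obtain ⟨c, hc⟩ := h2.eq_constH hs
  have hG := isContRep_invAstar hs.le β (Astar β p)
  set G : ℝ → ℝ := fun r => -(1 / β) * ((∫ t in (0 : ℝ)..s, (Astar β p) t)
    - ∫ t in (0 : ℝ)..r, (Astar β p) t) with hGdef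
  have h3 : IsContRep p fun r => G r + c := by
    refine ⟨hG.1.add continuousOn_const, ?_⟩
    have e : p = invAstar s β (Astar β p) + constH s c := by rw [← hc]; abel
    have h4 := Lp.coeFn_add (invAstar s β (Astar β p)) (constH s c)
    rw [← e] at h4
    filter_upwards [h4, hG.2, coeFn_constH s c] with r h5 h6 h7
    rw [h5, Pi.add_apply, h6, h7]
  have h5 := hF.eqOn hs h3 (right_mem_Icc.2 hs.le)
  have h6 : c = 0 := by
    have : G s = 0 := by simp [hGdef]
    simp only [hFs, this, zero_add] at h5
    exact h5.symm
  rw [h6] at hc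
  have h0 : constH s 0 = 0 := MemLp.toLp_zero (memLp_const 0)
  rw [h0, sub_eq_zero] at hc
  exact hc.symm

/-- The trace at `0` becomes a bounded functional of `A* p`; boundary terms can thus be estimated by
the norm of `A* p`. -/
theorem delta0_of_mem_domAstar (hs : 0 < s) (hβ : β ≠ 0) {p : H s} (hp : p ∈ domAstar s) :
    β * delta0 p = -inner ℝ (constH s 1) (Astar β p) := by
  rw [← delta0_invAstar hs hβ, invAstar_Astar hs hβ hp]

theorem eq_zero_of_resolvent_zero_eq_zero (hs : 0 < s) (hβ : β ≠ 0) {f : H s}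
    (hf : resolvent s β 0 f = 0) : f = 0 := by
  refine H.eq_of_test fun ψ hψ _ hsupp => ?_
  have hss := right_mem_Icc.2 hs.le
  have hψs : ψ s = 0 := by
    by_contra h0
    exact (hsupp (subset_tsupport ψ h0)).2.false
  rw [← inner_ofContinuous 0 hψ.continuous, inner_zero_left, ← integral_Ioc_eq_integral_Ioo,
    ← intervalIntegral.integral_of_le hs.le]
  simp_rw [mul_comm (f _)]
  rw [integral_contDiff_mul (hψ.of_le (by simp)) (f.intervalIntegrable hss), hψs, zero_mul,
    zero_sub, neg_eq_zero]
  have h0 := Lp.coeFn_zero ℝ 2 (volume.restrict (Ioo 0 s))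
  rw [← hf] at h0
  have h : (fun x => deriv ψ x * ∫ t in (0 : ℝ)..x, f t) =ᵐ[volume.restrict (Ioo 0 s)]
      fun _ => 0 := by
    filter_upwards [coeFn_resolvent_zero β f, h0] with r h1 h2
    rw [h2] at h1
    have : (∫ t in (0 : ℝ)..r, f t) = 0 := by
      have h3 : -(1 / β) ≠ 0 := neg_ne_zero.2 (one_div_ne_zero hβ)
      exact (mul_eq_zero.1 h1.symm).resolve_left h3
    rw [this, mul_zero]
  rw [H.ae_congr_interval h hss, intervalIntegral.integral_zero]

/-- `D(A*)` is dense. -/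
theorem exists_invAstar_near (hs : 0 < s) (hβ : β ≠ 0) (x : H s) {ε : ℝ} (hε : 0 < ε) :
    ∃ q : H s, ‖x - invAstar s β q‖ < ε := by
  -- The orthogonal complement of the range of the adjoint is the kernel of `A⁻¹`, which is trivial.
  have h : (LinearMap.range (invAstar s β : H s →ₗ[ℝ] H s)).topologicalClosure = ⊤ := by
    rw [Submodule.topologicalClosure_eq_top_iff, Submodule.eq_bot_iff]
    intro f hf
    refine eq_zero_of_resolvent_zero_eq_zero hs hβ (ext_inner_right ℝ fun q => ?_)
    rw [← inner_invAstar, inner_zero_left, real_inner_comm]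
    exact hf _ ⟨q, rfl⟩
  have hx : x ∈ (LinearMap.range (invAstar s β : H s →ₗ[ℝ] H s)).topologicalClosure := by
    rw [h]; trivial
  obtain ⟨_, ⟨q, rfl⟩, hq⟩ := Metric.mem_closure_iff.1 hx ε hε
  exact ⟨q, by rwa [dist_eq_norm] at hq⟩

/-! ### Compactness of the resolvent -/

theorem tendsto_primitive_of_weak {X : ℕ → H s} {x : H s}
    (h : ∀ z : H s, Tendsto (fun n => inner ℝ (X n) z) atTop (𝓝 (inner ℝ x z))) {r : ℝ}
    (hr : r ∈ Ioo 0 s) :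
    Tendsto (fun n => ∫ t in (0 : ℝ)..r, X n t) atTop (𝓝 (∫ t in (0 : ℝ)..r, x t)) := by
  have hm : MemLp ((Iic r).indicator fun _ => (1 : ℝ)) 2 (volume.restrict (Ioo 0 s)) :=
    (memLp_const 1).indicator measurableSet_Iic
  have key : ∀ f : H s, ∫ t in (0 : ℝ)..r, f t = inner ℝ f (hm.toLp _) := by
    intro f
    rw [H.inner_eq, intervalIntegral.integral_of_le hr.1.le]
    have : ∫ t in Ioo 0 s, f t * (hm.toLp _) t = ∫ t in Ioo 0 s, (Iic r).indicator f t := by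
      refine integral_congr_ae ?_
      filter_upwards [MemLp.coeFn_toLp hm] with t ht
      rw [ht]
      by_cases h' : t ∈ Iic r <;> simp [h']
    rw [this, setIntegral_indicator measurableSet_Iic]
    congr 2
    ext t
    simp only [mem_Ioc, mem_inter_iff, mem_Ioo, mem_Iic]
    exact ⟨fun h => ⟨⟨h.1, h.2.trans_lt hr.2⟩, h.2⟩, fun h => ⟨h.1.1, h.2⟩⟩
  simp_rw [key]
  exact h _

theorem abs_primitive_le (f : H s) {r : ℝ} (hr : r ∈ Icc 0 s) :
    |∫ t in (0 : ℝ)..r, f t| ≤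
      ‖f‖ * ((volume.restrict (Ioo (0 : ℝ) s) univ) ^ (1 / 2 : ℝ)).toReal := by
  refine le_trans ?_ f.integral_norm_le
  rw [intervalIntegral.integral_of_le hr.1, integral_Ioc_eq_integral_Ioo, ← Real.norm_eq_abs]
  refine (norm_integral_le_integral_norm _).trans ?_
  exact setIntegral_mono_set f.integrable.norm (Eventually.of_forall fun _ => norm_nonneg _)
    (Ioo_subset_Ioo_right hr.2).eventuallyLE

theorem norm_sq_resolvent_zero (f : H s) :
    ‖resolvent s β 0 f‖ ^ 2 = ∫ r in Ioo 0 s, (1 / β) ^ 2 * (∫ t in (0 : ℝ)..r, f t) ^ 2 := by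
  rw [← real_inner_self_eq_norm_sq, H.inner_eq]
  refine integral_congr_ae ?_
  filter_upwards [coeFn_resolvent_zero β f] with r hr
  rw [hr]; ring

/-- Primitives evaluated at a point are inner products with indicators, so weak convergence makes
them converge pointwise. They are uniformly bounded, and dominated convergence gives the norm limit.
-/
theorem tendsto_resolvent_zero_of_weak (hs : 0 ≤ s) {X : ℕ → H s} {x : H s} {M : ℝ}
    (hM : ∀ n, ‖X n‖ ≤ M)
    (h : ∀ z : H s, Tendsto (fun n => inner ℝ (X n) z) atTop (𝓝 (inner ℝ x z))) :
    Tendsto (fun n => resolvent s β 0 (X n)) atTop (𝓝 (resolvent s β 0 x)) := by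
  rw [tendsto_iff_norm_sub_tendsto_zero]
  simp_rw [← map_sub]
  set C := ((volume.restrict (Ioo (0 : ℝ) s) univ) ^ (1 / 2 : ℝ)).toReal with hC
  have hC0 : 0 ≤ C := ENNReal.toReal_nonneg
  have h2 : Tendsto (fun n => ‖resolvent s β 0 (X n - x)‖ ^ 2) atTop (𝓝 0) := by
    simp_rw [norm_sq_resolvent_zero]
    rw [show 𝓝 (0 : ℝ) = 𝓝 (∫ r in Ioo 0 s, (fun _ => (0 : ℝ)) r) by simp]
    refine tendsto_integral_of_dominated_convergence
      (fun _ => (1 / β) ^ 2 * ((M + ‖x‖) * C) ^ 2) (fun n => ?_) (integrable_const _)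
      (fun n => ?_) ?_
    · refine ContinuousOn.aestronglyMeasurable ?_ measurableSet_Ioo
      exact (continuousOn_const.mul
        ((continuousOn_primitive hs (X n - x)).pow 2)).mono Ioo_subset_Icc_self
    · refine (ae_restrict_iff' measurableSet_Ioo).2 (Eventually.of_forall fun r hr => ?_)
      rw [Real.norm_eq_abs, abs_of_nonneg (by positivity), ← sq_abs (∫ t in (0 : ℝ)..r, _)]
      gcongr
      refine (abs_primitive_le _ (Ioo_subset_Icc_self hr)).trans ?_
      gcongr
      exact (norm_sub_le _ _).trans (by gcongr; exact hM n)
    · refine (ae_restrict_iff' measurableSet_Ioo).2 (Eventually.of_forall fun r hr => ?_)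
      have h3 : Tendsto (fun n => ∫ t in (0 : ℝ)..r, (X n - x : H s) t) atTop
          (𝓝 (∫ t in (0 : ℝ)..r, (0 : H s) t)) := by
        refine tendsto_primitive_of_weak (fun z => ?_) hr
        simp_rw [inner_sub_left, inner_zero_left]
        simpa using (h z).sub_const (inner ℝ x z)
      have h4 : ∫ t in (0 : ℝ)..r, (0 : H s) t = 0 := by
        rw [H.ae_congr_interval (Lp.coeFn_zero ℝ 2 _) (Ioo_subset_Icc_self hr)]
        simp
      rw [h4] at h3
      have h5 := (h3.pow 2).const_mul ((1 / β) ^ 2)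
      rwa [zero_pow two_ne_zero, mul_zero] at h5
  have h3 := h2.sqrt
  simpa [Real.sqrt_sq (norm_nonneg _)] using h3

/-- Compactness passes from `A⁻¹` to `R` through `R = A⁻¹ + lam R A⁻¹`. -/
theorem tendsto_resolvent_of_weak (hs : 0 < s) (hβ : 0 < β) (hlam : 0 < lam) {X : ℕ → H s}
    {x : H s} {M : ℝ} (hM : ∀ n, ‖X n‖ ≤ M)
    (h : ∀ z : H s, Tendsto (fun n => inner ℝ (X n) z) atTop (𝓝 (inner ℝ x z))) :
    Tendsto (fun n => resolvent s β lam (X n)) atTop (𝓝 (resolvent s β lam x)) := by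
  have e : ∀ f : H s, resolvent s β lam f =
      resolvent s β 0 f + lam • resolvent s β lam (resolvent s β 0 f) := by
    intro f
    rw [resolvent_resolvent_zero_comm hs.le hβ hlam]
    nth_rewrite 1 [resolvent_eq_resolvent_zero β lam f]
    rw [map_add, map_smul]
  have h0 := tendsto_resolvent_zero_of_weak (β := β) hs.le hM h
  simp_rw [fun n => e (X n)]
  rw [e x]
  exact h0.add ((((resolvent s β lam).continuous.tendsto _).comp h0).const_smul lam)

instance fact_two_ne_top : Fact ((2 : ENNReal) ≠ ⊤) := ⟨by norm_num⟩

theorem exists_weak_limit {X : ℕ → H s} {M : ℝ} (hM : ∀ n, ‖X n‖ ≤ M) :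
    ∃ (x : H s) (k : ℕ → ℕ), StrictMono k ∧
      ∀ z : H s, Tendsto (fun n => inner ℝ (X (k n)) z) atTop (𝓝 (inner ℝ x z)) := by
  have hc := WeakDual.isSeqCompact_closedBall (𝕜 := ℝ) (E := H s) 0 M
  obtain ⟨a, -, k, hk, hlim⟩ := hc (x := fun n => StrongDual.toWeakDual
    (InnerProductSpace.toDual ℝ (H s) (X n))) (fun n => by simpa using hM n)
  refine ⟨(InnerProductSpace.toDual ℝ (H s)).symm (WeakDual.toStrongDual a), k, hk, fun z => ?_⟩
  have := (WeakDual.eval_continuous z).continuousAt.tendsto.comp hlim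
  rw [InnerProductSpace.toDual_symm_apply]
  exact this

end

section

variable {s β : ℝ}

/-! ### The translation semigroup -/

/-- Extension by zero of an element of `L²(0, s)`. -/
def H.ext (z : H s) : ℝ → ℝ := (Ioo 0 s).indicator z

theorem H.memLp_ext (z : H s) : MemLp z.ext 2 volume :=
  (memLp_indicator_iff_restrict measurableSet_Ioo).2 (Lp.memLp z)

theorem H.integrable_ext (z : H s) : Integrable z.ext :=
  (integrable_indicator_iff measurableSet_Ioo).2 z.integrable

theorem H.ext_of_nonpos (z : H s) {r : ℝ} (hr : r ≤ 0) : z.ext r = 0 :=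
  indicator_of_notMem (fun h => absurd h.1 hr.not_gt) _

theorem H.ext_of_mem (z : H s) {r : ℝ} (hr : r ∈ Ioo 0 s) : z.ext r = z r :=
  indicator_of_mem hr _

/-- Translation to the right by `σ`: the function `r ↦ z(r - σ)` on `(0, s)`, with `z` extended
by zero. -/
def translate (σ : ℝ) (z : H s) : H s :=
  LpToLpRestrictCLM ℝ ℝ ℝ volume 2 (Ioo 0 s) (DomAddAct.mk (-σ) +ᵥ (z.memLp_ext.toLp z.ext))

theorem coeFn_translate (σ : ℝ) (z : H s) :
    translate σ z =ᵐ[volume.restrict (Ioo 0 s)] fun r => z.ext (r - σ) := by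
  have h1 := LpToLpRestrictCLM_coeFn ℝ (Ioo 0 s)
    (DomAddAct.mk (-σ) +ᵥ (z.memLp_ext.toLp z.ext) : Lp ℝ 2 (volume : Measure ℝ))
  have h2 := DomAddAct.vadd_Lp_ae_eq (DomAddAct.mk (-σ)) (z.memLp_ext.toLp z.ext)
  have h3 := (measurePreserving_vadd (-σ) (volume : Measure ℝ)).quasiMeasurePreserving.ae_eq_comp
    z.memLp_ext.coeFn_toLp
  filter_upwards [h1, ae_restrict_of_ae h2, ae_restrict_of_ae h3] with r e1 e2 e3
  rw [translate, e1, e2]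
  simp only [Function.comp, vadd_eq_add] at e3
  simp only [DomAddAct.mk, vadd_eq_add]
  rw [sub_eq_neg_add]
  exact e3

theorem continuous_translate (z : H s) : Continuous fun σ : ℝ => translate σ z := by
  refine (LpToLpRestrictCLM ℝ ℝ ℝ volume 2 (Ioo 0 s)).continuous.comp ?_
  have h : Continuous fun σ : ℝ => (DomAddAct.mk (-σ) : ℝᵈᵃᵃ) :=
    DomAddAct.continuous_mk.comp continuous_neg
  exact h.vadd continuous_const

theorem translate_zero (z : H s) : translate 0 z = z := by
  refine Lp.ext ?_
  filter_upwards [coeFn_translate 0 z, ae_restrict_mem measurableSet_Ioo] with r h hr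
  rw [h, sub_zero, z.ext_of_mem hr]

theorem translate_of_le {σ : ℝ} (hσ : s ≤ σ) (z : H s) : translate σ z = 0 := by
  refine Lp.ext ?_
  filter_upwards [coeFn_translate σ z, ae_restrict_mem measurableSet_Ioo,
    Lp.coeFn_zero ℝ 2 (volume.restrict (Ioo 0 s))] with r h hr h0
  rw [h, h0, z.ext_of_nonpos (by linarith [hr.2]), Pi.zero_apply]

/-- The integrals of `z(· - σ)` and `z` over `(0, r)` differ only by the integral over the strip `(r
- σ, r)`, since the extension vanishes to the left of `0`. -/
theorem resolvent_zero_translate_sub (β : ℝ) {σ : ℝ} (hσ : 0 ≤ σ) (z : H s) :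
    resolvent s β 0 (translate σ z - z) =ᵐ[volume.restrict (Ioo 0 s)]
      fun r => 1 / β * ∫ c in (0 : ℝ)..σ, z.ext (r - c) := by
  filter_upwards [coeFn_resolvent_zero β (translate σ z - z),
    ae_restrict_mem measurableSet_Ioo] with r h1 hr
  rw [h1]
  have hi : ∀ a b, IntervalIntegrable z.ext volume a b := fun a b =>
    z.integrable_ext.intervalIntegrable
  have e1 : ∫ t in (0 : ℝ)..r, (translate σ z - z : H s) t =
      ∫ t in (0 : ℝ)..r, (z.ext (t - σ) - z.ext t) := by
    refine H.ae_congr_interval ?_ (Ioo_subset_Icc_self hr)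
    filter_upwards [Lp.coeFn_sub (translate σ z) z, coeFn_translate σ z,
      ae_restrict_mem measurableSet_Ioo] with t h2 h3 ht
    rw [h2, Pi.sub_apply, h3, z.ext_of_mem ht]
  have e2 : ∫ t in (0 - σ : ℝ)..0, z.ext t = 0 := by
    refine intervalIntegral.integral_zero_ae (Eventually.of_forall fun t ht => z.ext_of_nonpos ?_)
    rw [uIoc_of_le (by linarith)] at ht
    exact ht.2
  have e3 := intervalIntegral.integral_add_adjacent_intervals (hi (0 - σ) 0) (hi 0 (r - σ))
  have e4 := intervalIntegral.integral_add_adjacent_intervals (hi 0 (r - σ)) (hi (r - σ) r)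
  rw [e1, intervalIntegral.integral_sub ((z.integrable_ext.comp_sub_right σ).intervalIntegrable)
    (hi _ _), intervalIntegral.integral_comp_sub_right, intervalIntegral.integral_comp_sub_left,
    sub_zero, ← e3, e2, ← e4]
  ring

/-- The integrated form of `d/dσ z(· - σ) = -∂ᵣ z(· - σ)` with zero inflow. Moving `A⁻¹` onto the
translate and using Fubini avoids any differentiation of `z`. -/
theorem inner_translate_sub_invAstar (β : ℝ) {σ : ℝ} (hσ : 0 ≤ σ) (z q : H s) :
    inner ℝ (translate σ z - z) (invAstar s β q) =
      1 / β * ∫ c in (0 : ℝ)..σ, inner ℝ (translate c z) q := by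
  rw [inner_invAstar, H.inner_eq]
  have e1 : ∫ r in Ioo 0 s, (resolvent s β 0 (translate σ z - z)) r * q r =
      ∫ r, (∫ c in (0 : ℝ)..σ, 1 / β * (q.ext r * z.ext (r - c))) := by
    have hout : ∀ r, r ∉ Ioo 0 s →
        (∫ c in (0 : ℝ)..σ, 1 / β * (q.ext r * z.ext (r - c))) = 0 := by
      intro r hr
      simp [H.ext, indicator_of_notMem hr]
    rw [← setIntegral_eq_integral_of_forall_compl_eq_zero hout]
    refine integral_congr_ae ?_
    filter_upwards [resolvent_zero_translate_sub β hσ z, ae_restrict_mem measurableSet_Ioo]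
      with r h1 hr
    rw [h1, intervalIntegral.integral_const_mul, intervalIntegral.integral_const_mul,
      q.ext_of_mem hr]
    ring
  have hz : Integrable (fun y => z.ext (-y)) := z.integrable_ext.comp_neg
  have hint : Integrable (Function.uncurry fun c r => 1 / β * (q.ext r * z.ext (r - c)))
      ((volume.restrict (uIoc 0 σ)).prod volume) := by
    have h := (q.integrable_ext.convolution_integrand (ContinuousLinearMap.mul ℝ ℝ) hz).const_mul
      (1 / β)
    have h2 := h.integrableOn (s := uIoc 0 σ ×ˢ univ)
    rw [IntegrableOn, ← Measure.prod_restrict, Measure.restrict_univ] at h2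
    refine h2.congr (Eventually.of_forall fun p => ?_)
    simp [Function.uncurry]
  rw [e1, ← intervalIntegral_integral_swap hint, ← intervalIntegral.integral_const_mul]
  refine intervalIntegral.integral_congr fun c _ => ?_
  rw [integral_const_mul, H.inner_eq]
  congr 1
  have hout : ∀ r, r ∉ Ioo 0 s → q.ext r * z.ext (r - c) = 0 := by
    intro r hr
    simp [H.ext, indicator_of_notMem hr]
  rw [← setIntegral_eq_integral_of_forall_compl_eq_zero hout]
  refine integral_congr_ae ?_
  filter_upwards [coeFn_translate c z, ae_restrict_mem measurableSet_Ioo] with r h1 hr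
  rw [h1, q.ext_of_mem hr, mul_comm]

/-- The semigroup generated by `A - μ`. -/
def semigroup (β μ t : ℝ) (z : H s) : H s := Real.exp (-μ * t) • translate (β * t) z

theorem continuous_semigroup (β μ : ℝ) (z : H s) : Continuous fun t => semigroup β μ t z := by
  have h : Continuous fun t => translate (β * t) z :=
    (continuous_translate z).comp (continuous_const.mul continuous_id)
  have h2 : Continuous fun t => Real.exp (-μ * t) := by fun_prop
  exact h2.smul h

theorem semigroup_zero (β μ : ℝ) (z : H s) : semigroup β μ 0 z = z := by
  simp [semigroup, translate_zero]

theorem semigroup_of_le (hβ : 0 < β) (μ : ℝ) {t : ℝ} (ht : s / β ≤ t) (z : H s) :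
    semigroup β μ t z = 0 := by
  rw [semigroup, translate_of_le, smul_zero]
  rwa [div_le_iff₀' hβ] at ht

theorem inner_translate_invAstar (hβ : 0 < β) {t : ℝ} (ht : 0 ≤ t) (z q : H s) :
    inner ℝ (translate (β * t) z) (invAstar s β q) =
      inner ℝ z (invAstar s β q) + ∫ c in (0 : ℝ)..t, inner ℝ (translate (β * c) z) q := by
  have h := inner_translate_sub_invAstar β (mul_nonneg hβ.le ht) z q
  rw [inner_sub_left] at h
  have h2 := intervalIntegral.integral_comp_mul_left (a := 0) (b := t)
    (fun c => (inner ℝ (translate c z) q : ℝ)) hβ.ne'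
  rw [mul_zero, smul_eq_mul, inv_eq_one_div] at h2
  linarith

/-- The semigroup solves the homogeneous state equation in the weak sense. -/
theorem inner_semigroup_invAstar (hβ : 0 < β) (μ : ℝ) {t : ℝ} (ht : 0 ≤ t) (z q : H s) :
    inner ℝ (semigroup β μ t z) (invAstar s β q) = inner ℝ z (invAstar s β q) +
      ∫ c in (0 : ℝ)..t, (inner ℝ (semigroup β μ c z) q
        - μ * inner ℝ (semigroup β μ c z) (invAstar s β q)) := by
  -- `F` agrees with `⟨translate (β t) z, invAstar q⟩` only for `t ≥ 0`, but it is differentiable on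
  -- all of `ℝ`, so the product rule with `e^{-μt}` applies also at the endpoint.
  set F : ℝ → ℝ := fun t => inner ℝ z (invAstar s β q) +
    ∫ c in (0 : ℝ)..t, inner ℝ (translate (β * c) z) q with hF
  have hc : Continuous fun c => (inner ℝ (translate (β * c) z) q : ℝ) :=
    ((continuous_translate z).comp (continuous_const.mul continuous_id)).inner continuous_const
  have hFd : ∀ r, HasDerivAt F (inner ℝ (translate (β * r) z) q) r := fun r =>
    (intervalIntegral.integral_hasDerivAt_right (hc.intervalIntegrable _ _)
      hc.stronglyMeasurable.stronglyMeasurableAtFilter hc.continuousAt).const_add _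
  have hE : ∀ r, HasDerivAt (fun r => Real.exp (-μ * r)) (Real.exp (-μ * r) * (-μ * 1)) r :=
    fun r => ((hasDerivAt_id r).const_mul (-μ)).exp
  have hFe : ∀ r, 0 ≤ r → F r = inner ℝ (translate (β * r) z) (invAstar s β q) := fun r hr =>
    (inner_translate_invAstar hβ hr z q).symm
  have hFc : Continuous F := continuous_iff_continuousAt.2 fun r => (hFd r).continuousAt
  have h := intervalIntegral.integral_eq_sub_of_hasDerivAt (a := 0) (b := t)
    (fun r _ => (hE r).mul (hFd r)) (by
      refine Continuous.intervalIntegrable ?_ _ _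
      fun_prop)
  have e : ∫ c in (0 : ℝ)..t, (inner ℝ (semigroup β μ c z) q
        - μ * inner ℝ (semigroup β μ c z) (invAstar s β q)) =
      ∫ c in (0 : ℝ)..t, (Real.exp (-μ * c) * (-μ * 1) * F c +
        Real.exp (-μ * c) * inner ℝ (translate (β * c) z) q) := by
    refine intervalIntegral.integral_congr fun c hc' => ?_
    rw [uIcc_of_le ht] at hc'
    simp only [semigroup, real_inner_smul_left]
    rw [hFe c hc'.1]
    ring
  rw [e, h]
  simp only [Pi.mul_apply, mul_zero, Real.exp_zero, one_mul]
  rw [semigroup, real_inner_smul_left, hFe t ht]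
  simp [hF]

end

namespace Problem

/-- The standing assumptions on the data of the control problem. -/
structure Standing (P : Problem) (CL : ℝ) : Prop where
  hs : 0 < P.s
  hβ : 0 < P.β
  hρ : 0 < P.ρ
  hlam : 0 < P.lam
  hΓ : IsCompact P.Γ
  hΓne : P.Γ.Nonempty
  hΛ : IsCompact P.Λ
  hΛne : P.Λ.Nonempty
  hL : UniformContinuousOn (fun w : H P.s × H P.s × ℝ => P.L w.1 w.2.1 w.2.2)
    (univ ×ˢ P.Sig ×ˢ P.Γ)
  hCL : 0 ≤ CL
  hL1 : ∀ x y : H P.s, ∀ α ∈ P.Sig, ∀ a ∈ P.Γ,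
    |P.L x α a - P.L y α a| ≤ CL * normB P.s P.β P.lam (x - y)
  hL2 : ∀ x : H P.s, ∀ α ∈ P.Sig, ∀ a ∈ P.Γ, |P.L x α a| ≤ CL

variable {P : Problem} {CL : ℝ}

/-! ### Bounds for the control sets -/

theorem Standing.abs_le_normΓ (S : P.Standing CL) {a : ℝ} (ha : a ∈ P.Γ) : |a| ≤ P.normΓ :=
  le_csSup (S.hΓ.image continuous_abs).bddAbove ⟨a, ha, rfl⟩

theorem Standing.normΓ_nonneg (S : P.Standing CL) : 0 ≤ P.normΓ := by
  obtain ⟨a, ha⟩ := S.hΓne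
  exact (abs_nonneg a).trans (S.abs_le_normΓ ha)

theorem Standing.exists_norm_le (S : P.Standing CL) : ∃ K, 0 ≤ K ∧ ∀ α ∈ P.Sig, ‖α‖ ≤ K := by
  obtain ⟨C, hC⟩ := S.hΛ.isBounded.exists_norm_le
  obtain ⟨l, hl⟩ := S.hΛne
  have hC0 : 0 ≤ C := (norm_nonneg l).trans (hC l hl)
  refine ⟨_, ?_, fun α hα => Lp.norm_le_of_ae_bound hC0 (Filter.Eventually.mono
    (show ∀ᵐ r ∂(volume.restrict (Ioo 0 P.s)), α r ∈ P.Λ from hα) fun r hr => hC _ hr)⟩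
  positivity

theorem Standing.sig_nonempty (S : P.Standing CL) : P.Sig.Nonempty := by
  obtain ⟨l, hl⟩ := S.hΛne
  refine ⟨constH P.s l, ?_⟩
  filter_upwards [coeFn_constH P.s l] with r hr
  rwa [hr]

theorem Standing.bddBelow_infTerm (S : P.Standing CL) (x : H P.s) (c : ℝ) (q : H P.s) :
    BddBelow ((fun w : H P.s × ℝ => c * w.2 + inner ℝ q w.1 + P.L x w.1 w.2) ''
      (P.Sig ×ˢ P.Γ)) := by
  obtain ⟨K, hK0, hK⟩ := S.exists_norm_le
  refine ⟨-(|c| * P.normΓ) - ‖q‖ * K - CL, ?_⟩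
  rintro _ ⟨⟨α, a⟩, ⟨hα, ha⟩, rfl⟩
  have h1 : |c * a| ≤ |c| * P.normΓ := by
    rw [abs_mul]
    exact mul_le_mul_of_nonneg_left (S.abs_le_normΓ ha) (abs_nonneg c)
  have h2 : |inner ℝ q α| ≤ ‖q‖ * K :=
    (abs_real_inner_le_norm q α).trans (mul_le_mul_of_nonneg_left (hK α hα) (norm_nonneg q))
  have h3 := S.hL2 x α hα a ha
  have := neg_abs_le (c * a)
  have := neg_abs_le (inner ℝ q α)
  have := neg_abs_le (P.L x α a)
  simp only
  linarith

theorem Standing.infTerm_le (S : P.Standing CL) (x : H P.s) (c : ℝ) (q : H P.s) {α : H P.s}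
    (hα : α ∈ P.Sig) {a : ℝ} (ha : a ∈ P.Γ) :
    P.infTerm x c q ≤ c * a + inner ℝ q α + P.L x α a :=
  csInf_le (S.bddBelow_infTerm x c q) ⟨(α, a), ⟨hα, ha⟩, rfl⟩

theorem Standing.le_infTerm (S : P.Standing CL) {x : H P.s} {c : ℝ} {q : H P.s} {m : ℝ}
    (h : ∀ α ∈ P.Sig, ∀ a ∈ P.Γ, m ≤ c * a + inner ℝ q α + P.L x α a) :
    m ≤ P.infTerm x c q := by
  refine le_csInf ((S.sig_nonempty.prod S.hΓne).image _) ?_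
  rintro _ ⟨⟨α, a⟩, ⟨hα, ha⟩, rfl⟩
  exact h α hα a ha

/-! ### Quadratic test functions -/

theorem hasGradientAt_quadratic {E F : Type*} [NormedAddCommGroup E] [InnerProductSpace ℝ E]
    [CompleteSpace E] [NormedAddCommGroup F] [InnerProductSpace ℝ F] [CompleteSpace F]
    (T : E →L[ℝ] F) (c : ℝ) (y x : E) :
    HasGradientAt (fun x => c / 2 * ‖T (x - y)‖ ^ 2)
      (c • ContinuousLinearMap.adjoint T (T (x - y))) x := by
  rw [hasGradientAt_iff_hasFDerivAt]
  have h : HasFDerivAt (fun x => T (x - y)) T x :=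
    T.hasFDerivAt.comp x ((hasFDerivAt_id x).sub_const y)
  refine (h.norm_sq.const_mul (c / 2)).congr_fderiv ?_
  ext v
  simp only [smul_apply, ContinuousLinearMap.comp_apply, innerSL_apply_apply,
    InnerProductSpace.toDual_apply_apply, real_inner_smul_left,
    ContinuousLinearMap.adjoint_inner_left, smul_eq_mul, nsmul_eq_mul]
  push_cast
  ring

/-- The gradient is `c B (x - y)`, and `A*` of it is a bounded affine function of `x` by
`adjoint_resolvent_eq`. Lower semicontinuity comes from convexity. -/
theorem test1_quadratic (hs : 0 < P.s) (hβ : 0 < P.β) (hlam : 0 < P.lam) {c : ℝ} (hc : 0 ≤ c)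
    (y : H P.s) :
    P.Test1 fun x => c / 2 * ‖resolvent P.s P.β P.lam (x - y)‖ ^ 2 := by
  set T := resolvent P.s P.β P.lam with hT
  have hg : ∀ x, gradient (fun x => c / 2 * ‖T (x - y)‖ ^ 2) x =
      c • ContinuousLinearMap.adjoint T (T (x - y)) := fun x =>
    (hasGradientAt_quadratic T c y x).gradient
  have hK : ∀ x, c • ContinuousLinearMap.adjoint T (T (x - y)) =
      invAstar P.s P.β (c • (T (x - y) + P.lam • ContinuousLinearMap.adjoint T (T (x - y)))) := by
    intro x
    rw [map_smul, ← adjoint_resolvent_eq hs.le hβ hlam]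
  refine ⟨?_, ?_, fun x => ?_, ?_⟩
  · have h : ContDiff ℝ 1 fun x => T (x - y) := T.contDiff.comp (contDiff_id.sub contDiff_const)
    exact contDiff_const.mul (h.norm_sq ℝ)
  · intro x X hX _ m hm
    have h1 : Tendsto (fun n => c / 2 * ‖T (x - y)‖ ^ 2 +
        c * (inner ℝ (X n) (ContinuousLinearMap.adjoint T (T (x - y))) -
          inner ℝ x (ContinuousLinearMap.adjoint T (T (x - y))))) atTop
        (𝓝 (c / 2 * ‖T (x - y)‖ ^ 2 + c * 0)) := by
      refine tendsto_const_nhds.add (Tendsto.const_mul c ?_)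
      have := (hX (ContinuousLinearMap.adjoint T (T (x - y)))).sub_const
        (inner ℝ x (ContinuousLinearMap.adjoint T (T (x - y))))
      rwa [sub_self] at this
    rw [mul_zero, add_zero] at h1
    filter_upwards [h1.eventually (lt_mem_nhds hm)] with n hn
    refine hn.trans_le ?_
    rw [← inner_sub_left, ContinuousLinearMap.adjoint_inner_right]
    -- In the expansion of the square the linear term has a weak limit and the remaining square is
    -- nonnegative.
    have e : T (X n - y) = T (x - y) + T (X n - x) := by rw [← map_add]; congr 1; abel
    rw [e, norm_add_sq_real, real_inner_comm]
    nlinarith [mul_nonneg hc (sq_nonneg ‖T (X n - x)‖)]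
  · rw [hg, hK]
    exact invAstar_mem_domAstar hs.le _ _
  · have : (fun x => Astar P.β (gradient (fun x => c / 2 * ‖T (x - y)‖ ^ 2) x)) = fun x =>
        c • (T (x - y) + P.lam • ContinuousLinearMap.adjoint T (T (x - y))) := by
      funext x
      rw [hg, hK, Astar_invAstar hβ.ne']
    rw [this]
    fun_prop

theorem test2_quadratic {δ : ℝ} (hδ : 0 ≤ δ) :
    P.Test2 (fun x => δ / 2 * ‖x‖ ^ 2) fun r => δ / 2 * r ^ 2 := by
  refine ⟨contDiff_const.mul (contDiff_id.norm_sq ℝ), ?_, fun x => rfl⟩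
  intro a ha b _ hab
  have : (0 : ℝ) ≤ a := ha
  simp only
  gcongr

theorem gradient_quadratic (δ : ℝ) (x : H P.s) :
    gradient (fun x : H P.s => δ / 2 * ‖x‖ ^ 2) x = δ • x := by
  have h := (hasGradientAt_quadratic (ContinuousLinearMap.id ℝ (H P.s)) δ 0 x).gradient
  simp only [sub_zero, ContinuousLinearMap.id_apply] at h
  rw [h]
  congr 1
  exact ext_inner_left ℝ fun v => by simp [ContinuousLinearMap.adjoint_inner_right]

theorem radialCoeff_quadratic (δ r : ℝ) : radialCoeff (fun r => δ / 2 * r ^ 2) r = δ := by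
  have hd : ∀ t : ℝ, deriv (fun r => δ / 2 * r ^ 2) t = δ * t := by
    intro t
    have := ((hasDerivAt_pow 2 t).const_mul (δ / 2)).deriv
    rw [this]; push_cast; ring
  rw [radialCoeff]
  split_ifs with h
  · refine Tendsto.limUnder_eq ?_
    refine tendsto_const_nhds.congr' ?_
    filter_upwards [self_mem_nhdsWithin] with t ht
    have ht' : t ≠ 0 := (ne_of_gt ht)
    rw [hd, mul_div_assoc, div_self ht', mul_one]
  · rw [hd, mul_div_assoc, div_self h, mul_one]

/-! ### Comparison -/

theorem BLipschitz.exists_nonneg {u : H P.s → ℝ} (hu : P.BLipschitz u) :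
    ∃ C, 0 ≤ C ∧ ∀ x y, |u x - u y| ≤ C * ‖resolvent P.s P.β P.lam (x - y)‖ := by
  obtain ⟨C, hC⟩ := hu
  refine ⟨|C|, abs_nonneg C, fun x y => (hC x y).trans ?_⟩
  rw [normB_eq]
  exact mul_le_mul_of_nonneg_right (le_abs_self C) (norm_nonneg _)

theorem BLipschitz.tendsto_of_weak (S : P.Standing CL) {u : H P.s → ℝ} (hu : P.BLipschitz u)
    {X : ℕ → H P.s} {x : H P.s} {M : ℝ} (hM : ∀ n, ‖X n‖ ≤ M)
    (h : ∀ z : H P.s, Tendsto (fun n => inner ℝ (X n) z) atTop (𝓝 (inner ℝ x z))) :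
    Tendsto (fun n => u (X n)) atTop (𝓝 (u x)) := by
  obtain ⟨C, hC0, hC⟩ := hu.exists_nonneg
  have h1 := tendsto_iff_norm_sub_tendsto_zero.1 (tendsto_resolvent_of_weak S.hs S.hβ S.hlam hM h)
  rw [tendsto_iff_norm_sub_tendsto_zero]
  refine squeeze_zero (fun _ => norm_nonneg _) (fun n => ?_) (by simpa using h1.const_mul C)
  rw [← map_sub]
  exact hC _ _

/-- The penalized doubling function. -/
def doubling (P : Problem) (u v : H P.s → ℝ) (c δ : ℝ) (x y : H P.s) : ℝ :=
  u x - v y - c / 2 * ‖resolvent P.s P.β P.lam (x - y)‖ ^ 2 - (δ / 2 * ‖x‖ ^ 2 + δ / 2 * ‖y‖ ^ 2)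

/-- The direct method: the `δ` terms bound a maximising sequence, a subsequence converges weakly,
and everything except these terms is weakly continuous. -/
theorem Standing.exists_max_doubling (S : P.Standing CL) {u v : H P.s → ℝ}
    (hu : P.Admissible u) (hv : P.Admissible v) {c δ : ℝ} (hc : 0 ≤ c) (hδ : 0 < δ) :
    ∃ x₀ y₀, ∀ x y, P.doubling u v c δ x y ≤ P.doubling u v c δ x₀ y₀ := by
  obtain ⟨-, ⟨Mu, hMu⟩, hu⟩ := hu
  obtain ⟨-, ⟨Mv, hMv⟩, hv⟩ := hv
  have hup : ∀ x y, P.doubling u v c δ x y ≤ Mu + Mv - (δ / 2 * ‖x‖ ^ 2 + δ / 2 * ‖y‖ ^ 2) := by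
    intro x y
    have h1 := (le_abs_self _).trans (hMu x)
    have h2 := (neg_le_abs _).trans (hMv y)
    have : 0 ≤ c / 2 * ‖resolvent P.s P.β P.lam (x - y)‖ ^ 2 := by positivity
    rw [doubling]; linarith
  set A : Set ℝ := range fun w : H P.s × H P.s => P.doubling u v c δ w.1 w.2 with hA
  have hAb : BddAbove A := by
    refine ⟨Mu + Mv, ?_⟩
    rintro _ ⟨⟨x, y⟩, rfl⟩
    refine (hup x y).trans ?_
    have : 0 ≤ δ / 2 * ‖x‖ ^ 2 + δ / 2 * ‖y‖ ^ 2 := by positivity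
    linarith
  have hAne : A.Nonempty := range_nonempty _
  set m := sSup A with hm
  have hle : ∀ x y, P.doubling u v c δ x y ≤ m := fun x y => le_csSup hAb ⟨(x, y), rfl⟩
  have hex : ∀ n : ℕ, ∃ w : H P.s × H P.s, m - 1 / ((n : ℝ) + 1) < P.doubling u v c δ w.1 w.2 := by
    intro n
    obtain ⟨_, ⟨w, rfl⟩, hw⟩ := exists_lt_of_lt_csSup hAne
      (show m - 1 / ((n : ℝ) + 1) < sSup A by
        have : (0 : ℝ) < 1 / ((n : ℝ) + 1) := by positivity
        linarith)
    exact ⟨w, hw⟩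
  choose w hw using hex
  set Q := 2 / δ * (Mu + Mv - m + 1) with hQ
  have hb : ∀ n, ‖(w n).1‖ ^ 2 + ‖(w n).2‖ ^ 2 ≤ Q := by
    intro n
    have h1 := (hw n).trans_le (hup _ _)
    have h2 : 1 / ((n : ℝ) + 1) ≤ 1 := by
      rw [div_le_one (by positivity)]; linarith [(Nat.cast_nonneg n : (0 : ℝ) ≤ n)]
    have h3 : δ / 2 * (‖(w n).1‖ ^ 2 + ‖(w n).2‖ ^ 2) ≤ Mu + Mv - m + 1 := by linarith
    rw [hQ, div_mul_eq_mul_div, le_div_iff₀ hδ]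
    linarith
  have hb1 : ∀ n, ‖(w n).1‖ ≤ √Q := fun n => Real.le_sqrt_of_sq_le
    (by linarith [hb n, sq_nonneg ‖(w n).2‖])
  have hb2 : ∀ n, ‖(w n).2‖ ≤ √Q := fun n => Real.le_sqrt_of_sq_le
    (by linarith [hb n, sq_nonneg ‖(w n).1‖])
  obtain ⟨x₀, k, hk, hx₀⟩ := exists_weak_limit hb1
  obtain ⟨y₀, l, hl, hy₀⟩ := exists_weak_limit (fun n => hb2 (k n))
  refine ⟨x₀, y₀, fun x y => (hle x y).trans ?_⟩
  set X : ℕ → H P.s := fun n => (w (k (l n))).1 with hX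
  set Y : ℕ → H P.s := fun n => (w (k (l n))).2 with hY
  have hXw : ∀ z : H P.s, Tendsto (fun n => inner ℝ (X n) z) atTop (𝓝 (inner ℝ x₀ z)) :=
    fun z => (hx₀ z).comp hl.tendsto_atTop
  have hYw : ∀ z : H P.s, Tendsto (fun n => inner ℝ (Y n) z) atTop (𝓝 (inner ℝ y₀ z)) := hy₀
  have hkl : Tendsto (fun n => k (l n)) atTop atTop := hk.tendsto_atTop.comp hl.tendsto_atTop
  have t1 := hu.tendsto_of_weak S (fun n => hb1 (k (l n))) hXw
  have t2 := hv.tendsto_of_weak S (fun n => hb2 (k (l n))) hYw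
  have t3 := (tendsto_resolvent_of_weak S.hs S.hβ S.hlam (fun n => hb1 (k (l n))) hXw).sub
    (tendsto_resolvent_of_weak S.hs S.hβ S.hlam (fun n => hb2 (k (l n))) hYw)
  have t4 : Tendsto (fun n => m - 1 / (((k (l n) : ℕ) : ℝ) + 1)) atTop (𝓝 (m - 0)) :=
    tendsto_const_nhds.sub (tendsto_one_div_add_atTop_nhds_zero_nat.comp hkl)
  rw [sub_zero] at t4
  -- `‖X n‖²` need not converge. It is replaced by the lower bound `2⟨X n, x₀⟩ - ‖x₀‖²`, which tends
  -- to `‖x₀‖²`; likewise for `Y n`.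
  have t5 := (((t1.sub t2).sub ((t3.norm.pow 2).const_mul (c / 2))).sub
    (((((hXw x₀).const_mul 2).sub_const (‖x₀‖ ^ 2)).const_mul (δ / 2)).add
      ((((hYw y₀).const_mul 2).sub_const (‖y₀‖ ^ 2)).const_mul (δ / 2))))
  have hlim := le_of_tendsto_of_tendsto' t4 t5 fun n => by
    refine (hw (k (l n))).le.trans ?_
    have hsq : ∀ a b : H P.s, 2 * inner ℝ a b - ‖b‖ ^ 2 ≤ ‖a‖ ^ 2 := by
      intro a b
      have := norm_sub_sq_real a b
      nlinarith [sq_nonneg ‖a - b‖]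
    have h1 := mul_le_mul_of_nonneg_left (hsq (X n) x₀) (by positivity : 0 ≤ δ / 2)
    have h2 := mul_le_mul_of_nonneg_left (hsq (Y n) y₀) (by positivity : 0 ≤ δ / 2)
    rw [doubling, map_sub]
    linarith
  refine hlim.trans (le_of_eq ?_)
  rw [doubling, map_sub, real_inner_self_eq_norm_sq, real_inner_self_eq_norm_sq]
  ring

/-- The inequality obtained from the equation at a maximum point of the doubling function. -/
theorem Standing.doubling_inequality (S : P.Standing CL) {u v : H P.s → ℝ}
    (hu : P.IsSubsolution u) (hv : P.IsSupersolution v) {K : ℝ}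
    (hK : ∀ α ∈ P.Sig, ‖α‖ ≤ K) {c δ : ℝ} (hc : 0 < c) (hδ : 0 < δ) {x₀ y₀ : H P.s}
    (hmax : ∀ x y, P.doubling u v c δ x y ≤ P.doubling u v c δ x₀ y₀) :
    P.ρ * (u x₀ - v y₀) ≤ |P.μ| * (c * ‖resolvent P.s P.β P.lam (x₀ - y₀)‖ ^ 2) +
      |P.μ| * (δ * (‖x₀‖ ^ 2 + ‖y₀‖ ^ 2)) + δ * (‖x₀‖ + ‖y₀‖) * K +
      CL * ‖resolvent P.s P.β P.lam (x₀ - y₀)‖ + δ * (P.β * P.normΓ ^ 2) := by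
  set T := resolvent P.s P.β P.lam with hT
  set z := x₀ - y₀ with hz
  set q := c • (T z + P.lam • ContinuousLinearMap.adjoint T (T z)) with hq
  set p := c • ContinuousLinearMap.adjoint T (T z) with hp
  have hpq : p = invAstar P.s P.β q := by
    rw [hp, hq, map_smul, ← adjoint_resolvent_eq S.hs.le S.hβ S.hlam]
  have hsub := hu.2 _ _ _ (test1_quadratic S.hs S.hβ S.hlam hc.le y₀) (test2_quadratic hδ.le) x₀
    (by
      refine Eventually.of_forall fun x => ?_
      have := hmax x y₀
      simp only [doubling] at this ⊢
      linarith)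
  have hsup := hv.2 _ _ _ (test1_quadratic S.hs S.hβ S.hlam hc.le x₀) (test2_quadratic hδ.le) y₀
    (by
      refine Eventually.of_forall fun y => ?_
      have := hmax x₀ y
      simp only [doubling] at this ⊢
      rw [map_sub, map_sub, norm_sub_rev, norm_sub_rev _ (resolvent P.s P.β P.lam x₀), ← map_sub,
        ← map_sub]
      linarith)
  have g1 : gradient (fun x => c / 2 * ‖T (x - y₀)‖ ^ 2) x₀ = p :=
    (hasGradientAt_quadratic T c y₀ x₀).gradient
  have g2 : gradient (fun x => c / 2 * ‖T (x - x₀)‖ ^ 2) y₀ = -p := by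
    rw [(hasGradientAt_quadratic T c x₀ y₀).gradient, hp, hz, ← neg_sub x₀ y₀]
    simp only [map_neg, smul_neg]
  have hp' : -p = invAstar P.s P.β (-q) := by rw [map_neg, hpq]
  have a1 : Astar P.β p = q := by rw [hpq, Astar_invAstar S.hβ.ne']
  have a2 : Astar P.β (-p) = -q := by rw [hp', Astar_invAstar S.hβ.ne']
  -- The gradients of the `B`-penalty in the two variables are opposite, so both Hamiltonians carry
  -- the same boundary coefficient.
  have d2 : -(P.β * delta0 (-p)) = P.β * delta0 p := by
    rw [hp', hpq, delta0_invAstar S.hs S.hβ.ne', delta0_invAstar S.hs S.hβ.ne', inner_neg_right,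
      neg_neg]
  rw [radialCoeff_quadratic, gradient_quadratic, g1, a1] at hsub
  rw [radialCoeff_quadratic, gradient_quadratic, g2, a2, d2] at hsup
  -- For fixed controls the two expressions under the infimum differ only through the `δ` gradients
  -- and through `L`, which is handled by (L1).
  have hinf : P.infTerm x₀ (P.β * delta0 p) (p + δ • x₀) -
      (δ * (‖x₀‖ + ‖y₀‖) * K + CL * ‖T z‖) ≤
      P.infTerm y₀ (P.β * delta0 p) (-(-p + δ • y₀)) := by
    refine S.le_infTerm fun α hα a ha => ?_
    have h1 := S.infTerm_le x₀ (P.β * delta0 p) (p + δ • x₀) hα ha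
    have h2 := (le_abs_self _).trans (S.hL1 x₀ y₀ α hα a ha)
    rw [normB_eq] at h2
    have h3 : inner ℝ (p + δ • x₀) α - inner ℝ (-(-p + δ • y₀)) α =
        δ * (inner ℝ x₀ α + inner ℝ y₀ α) := by
      simp only [inner_add_left, inner_neg_left, real_inner_smul_left]; ring
    have h4 : inner ℝ x₀ α ≤ ‖x₀‖ * K :=
      (real_inner_le_norm _ _).trans (mul_le_mul_of_nonneg_left (hK α hα) (norm_nonneg _))
    have h5 : inner ℝ y₀ α ≤ ‖y₀‖ * K :=
      (real_inner_le_norm _ _).trans (mul_le_mul_of_nonneg_left (hK α hα) (norm_nonneg _))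
    have h6 := mul_le_mul_of_nonneg_left (add_le_add h4 h5) hδ.le
    linarith
  -- The only term with `A*` in the difference of the two inequalities. It cannot be bounded by
  -- `|z|_B` and is discarded by its sign.
  have hqz : inner ℝ q z ≤ 0 := by
    have h := inner_resolvent_le S.hs.le S.hβ P.lam z
    rw [hq, real_inner_smul_left, inner_add_left, real_inner_smul_left,
      ContinuousLinearMap.adjoint_inner_left, real_inner_self_eq_norm_sq, real_inner_comm]
    exact mul_nonpos_of_nonneg_of_nonpos hc.le (by linarith)
  have hpz : inner ℝ p z = c * ‖T z‖ ^ 2 := by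
    rw [hp, real_inner_smul_left, ContinuousLinearMap.adjoint_inner_left,
      real_inner_self_eq_norm_sq]
  have hqz' : inner ℝ q z = inner ℝ q x₀ - inner ℝ q y₀ := inner_sub_right _ _ _
  have hpz' : inner ℝ p z = inner ℝ p x₀ - inner ℝ p y₀ := inner_sub_right _ _ _
  simp only [inner_add_left, inner_neg_left, real_inner_smul_left,
    real_inner_self_eq_norm_sq, inner_smul_right] at hsub hsup
  have hμ1 : -(P.μ * (c * ‖T z‖ ^ 2)) ≤ |P.μ| * (c * ‖T z‖ ^ 2) := by
    rw [← neg_mul]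
    exact mul_le_mul_of_nonneg_right (neg_le_abs _) (by positivity)
  have hμ2 : -(P.μ * (δ * (‖x₀‖ ^ 2 + ‖y₀‖ ^ 2))) ≤ |P.μ| * (δ * (‖x₀‖ ^ 2 + ‖y₀‖ ^ 2)) := by
    rw [← neg_mul]
    exact mul_le_mul_of_nonneg_right (neg_le_abs _) (by positivity)
  rw [← hpz, hpz'] at hμ1
  rw [hpz'] at hpz
  rw [← hpz]
  linarith

/-- Comparing the maximum with the diagonal points `(x₀, x₀)` and `(y₀, y₀)` and adding, the `δ`
terms cancel and leave `c |z|_B² ≤ (u(x₀) - u(y₀)) + (v(x₀) - v(y₀))`. -/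
theorem doubling_resolvent_le {u v : H P.s → ℝ} {Cu Cv c δ : ℝ} (hCu : 0 ≤ Cu) (hCv : 0 ≤ Cv)
    (hu : ∀ x y, |u x - u y| ≤ Cu * ‖resolvent P.s P.β P.lam (x - y)‖)
    (hv : ∀ x y, |v x - v y| ≤ Cv * ‖resolvent P.s P.β P.lam (x - y)‖) {x₀ y₀ : H P.s}
    (hmax : ∀ x y, P.doubling u v c δ x y ≤ P.doubling u v c δ x₀ y₀) :
    c * ‖resolvent P.s P.β P.lam (x₀ - y₀)‖ ≤ Cu + Cv := by
  have h1 := hmax x₀ x₀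
  have h2 := hmax y₀ y₀
  simp only [doubling, sub_self, map_zero, norm_zero] at h1 h2
  have h3 := (le_abs_self _).trans (hu x₀ y₀)
  have h4 := (le_abs_self _).trans (hv x₀ y₀)
  rcases (norm_nonneg (resolvent P.s P.β P.lam (x₀ - y₀))).eq_or_lt with h0 | h0
  · rw [← h0, mul_zero]
    exact add_nonneg hCu hCv
  · refine le_of_mul_le_mul_right ?_ h0
    linarith

/-- The penalization becomes negligible along a sequence of maximum points. -/
theorem tendsto_penalty {u v : H P.s → ℝ} {c Mu Mv : ℝ} (hc : 0 ≤ c) (hMu : ∀ x, |u x| ≤ Mu)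
    (hMv : ∀ x, |v x| ≤ Mv) {X Y : ℕ → H P.s}
    (hmax : ∀ n x y, P.doubling u v c ((1 / 2) ^ n) x y ≤
      P.doubling u v c ((1 / 2) ^ n) (X n) (Y n)) :
    Tendsto (fun n => (1 / 2 : ℝ) ^ n * (‖X n‖ ^ 2 + ‖Y n‖ ^ 2)) atTop (𝓝 0) := by
  set M : ℕ → ℝ := fun n => P.doubling u v c ((1 / 2) ^ n) (X n) (Y n) with hM
  -- Halving `δ` at the same point raises the doubling function by `(δ/4)(‖X‖² + ‖Y‖²)`. The penalty
  -- is thus controlled by an increment of the maxima, which form a bounded monotone sequence.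
  have hstep : ∀ n, (1 / 2 : ℝ) ^ n * (‖X n‖ ^ 2 + ‖Y n‖ ^ 2) ≤ 4 * (M (n + 1) - M n) := by
    intro n
    have h := hmax (n + 1) (X n) (Y n)
    have e : P.doubling u v c ((1 / 2) ^ (n + 1)) (X n) (Y n) =
        M n + (1 / 2 : ℝ) ^ n / 4 * (‖X n‖ ^ 2 + ‖Y n‖ ^ 2) := by
      simp only [hM, doubling, pow_succ]; ring
    rw [e] at h
    change _ ≤ M (n + 1) at h
    linarith
  have hnn : ∀ n, 0 ≤ (1 / 2 : ℝ) ^ n * (‖X n‖ ^ 2 + ‖Y n‖ ^ 2) := fun n => by positivity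
  have hmono : Monotone M := monotone_nat_of_le_succ fun n => by
    linarith [(hnn n).trans (hstep n)]
  have hbdd : BddAbove (range M) := by
    refine ⟨Mu + Mv, ?_⟩
    rintro _ ⟨n, rfl⟩
    have h1 := (le_abs_self _).trans (hMu (X n))
    have h2 := (neg_le_abs _).trans (hMv (Y n))
    have h3 : 0 ≤ c / 2 * ‖resolvent P.s P.β P.lam (X n - Y n)‖ ^ 2 := by positivity
    have h4 : 0 ≤ (1 / 2 : ℝ) ^ n / 2 * ‖X n‖ ^ 2 + (1 / 2 : ℝ) ^ n / 2 * ‖Y n‖ ^ 2 := by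
      positivity
    simp only [hM, doubling]
    linarith
  have hlim := tendsto_atTop_ciSup hmono hbdd
  have h := ((hlim.comp (tendsto_add_atTop_nat 1)).sub hlim).const_mul 4
  rw [sub_self, mul_zero] at h
  exact squeeze_zero hnn hstep h

theorem Standing.comparison (S : P.Standing CL) {u v : H P.s → ℝ} (hu : P.IsSubsolution u)
    (hv : P.IsSupersolution v) (x : H P.s) : u x ≤ v x := by
  obtain ⟨K, hK0, hK⟩ := S.exists_norm_le
  obtain ⟨Mu, hMu⟩ := hu.1.2.1
  obtain ⟨Mv, hMv⟩ := hv.1.2.1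
  obtain ⟨Cu, hCu0, hCu⟩ := hu.1.2.2.exists_nonneg
  obtain ⟨Cv, hCv0, hCv⟩ := hv.1.2.2.exists_nonneg
  set C := Cu + Cv with hC
  -- The limit `δ = 2⁻ⁿ → 0` at fixed `c`. It leaves the terms of order `1/c` coming from `c |z|_B²
  -- ≤ C²/c` and `|z|_B ≤ C/c`.
  have key : ∀ c : ℝ, 0 < c → P.ρ * (u x - v x) ≤ (|P.μ| * C ^ 2 + CL * C) * c⁻¹ := by
    intro c hc
    have hex : ∀ n : ℕ, ∃ w : H P.s × H P.s, ∀ x y, P.doubling u v c ((1 / 2) ^ n) x y ≤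
        P.doubling u v c ((1 / 2) ^ n) w.1 w.2 := by
      intro n
      obtain ⟨x₀, y₀, h⟩ := S.exists_max_doubling hu.1 hv.1 hc.le
        (show (0 : ℝ) < (1 / 2) ^ n by positivity)
      exact ⟨(x₀, y₀), h⟩
    choose w hw using hex
    have hD := tendsto_penalty hc.le hMu hMv hw
    have hδ : Tendsto (fun n : ℕ => (1 / 2 : ℝ) ^ n) atTop (𝓝 0) :=
      tendsto_pow_atTop_nhds_zero_of_lt_one (by norm_num) (by norm_num)
    have hlim := ((((hδ.mul_const (P.ρ * ‖x‖ ^ 2)).add (hD.const_mul |P.μ|)).add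
      ((hδ.add (hD.div_const 2)).mul_const K)).add (hδ.mul_const (P.β * P.normΓ ^ 2))).const_add
      ((|P.μ| * C ^ 2 + CL * C) * c⁻¹)
    simp only [zero_mul, mul_zero, add_zero, zero_div] at hlim
    refine ge_of_tendsto' hlim fun n => ?_
    set δ : ℝ := (1 / 2) ^ n with hδn
    have hδ0 : 0 < δ := by positivity
    have h1 := S.doubling_inequality hu hv hK hc hδ0 (hw n)
    have h2 := doubling_resolvent_le hCu0 hCv0 hCu hCv (hw n)
    set r := ‖resolvent P.s P.β P.lam ((w n).1 - (w n).2)‖ with hr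
    have hr0 : 0 ≤ r := norm_nonneg _
    have h3 : r ≤ C * c⁻¹ := by
      rw [← div_eq_mul_inv, le_div_iff₀ hc]; linarith
    have h4 : c * r ^ 2 ≤ C ^ 2 * c⁻¹ := by
      calc c * r ^ 2 = c * r * r := by ring
        _ ≤ C * (C * c⁻¹) := mul_le_mul h2 h3 hr0 (add_nonneg hCu0 hCv0)
        _ = C ^ 2 * c⁻¹ := by ring
    have h5 := mul_le_mul_of_nonneg_left h4 (abs_nonneg P.μ)
    have h6 := mul_le_mul_of_nonneg_left h3 S.hCL
    -- By `t ≤ (1 + t²)/2` the linear terms are absorbed in the vanishing quadratic penalty.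
    have h7 : δ * (‖(w n).1‖ + ‖(w n).2‖) * K ≤
        (δ + δ * (‖(w n).1‖ ^ 2 + ‖(w n).2‖ ^ 2) / 2) * K := by
      refine mul_le_mul_of_nonneg_right ?_ hK0
      nlinarith [mul_nonneg hδ0.le (sq_nonneg (‖(w n).1‖ - 1)),
        mul_nonneg hδ0.le (sq_nonneg (‖(w n).2‖ - 1))]
    have h8 := hw n x x
    simp only [doubling, sub_self, map_zero, norm_zero] at h8
    have h9 : u x - v x ≤ δ * ‖x‖ ^ 2 + (u (w n).1 - v (w n).2) := by
      have h10 : 0 ≤ c / 2 * ‖resolvent P.s P.β P.lam ((w n).1 - (w n).2)‖ ^ 2 := by positivity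
      have h11 : 0 ≤ δ / 2 * ‖(w n).1‖ ^ 2 + δ / 2 * ‖(w n).2‖ ^ 2 := by positivity
      linarith
    have h12 := mul_le_mul_of_nonneg_left h9 S.hρ.le
    linarith
  have hlim : Tendsto (fun c : ℝ => (|P.μ| * C ^ 2 + CL * C) * c⁻¹) atTop (𝓝 0) := by
    simpa using tendsto_inv_atTop_zero.const_mul (|P.μ| * C ^ 2 + CL * C)
  have h := ge_of_tendsto hlim ((eventually_gt_atTop 0).mono key)
  have : u x - v x ≤ 0 := by
    by_contra hneg
    exact absurd h (not_le.2 (mul_pos S.hρ (not_le.1 hneg)))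
  linarith

end Problem

theorem constH_eq_smul (s c : ℝ) : constH s c = c • constH s 1 := by
  refine Lp.ext ?_
  filter_upwards [coeFn_constH s c, coeFn_constH s 1, Lp.coeFn_smul c (constH s 1)]
    with r h1 h2 h3
  rw [h1, h3, Pi.smul_apply, h2, smul_eq_mul, mul_one]

/-! ### Time averages and monotonicity -/

theorem hasDerivAt_primitive {E : Type*} [NormedAddCommGroup E] [NormedSpace ℝ E]
    [CompleteSpace E] {f : ℝ → E} (hf : Continuous f) (t : ℝ) :
    HasDerivAt (fun t => ∫ τ in (0 : ℝ)..t, f τ) (f t) t :=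
  intervalIntegral.integral_hasDerivAt_right (hf.intervalIntegrable _ _)
    (hf.stronglyMeasurableAtFilter _ _) hf.continuousAt

/-- A trajectory need not be differentiable in `L²`, but its forward averages are. Energy estimates
are proved for the averages and passed to the limit `e → 0`. -/
theorem hasDerivAt_average {E : Type*} [NormedAddCommGroup E] [NormedSpace ℝ E]
    [CompleteSpace E] {f : ℝ → E} (hf : Continuous f) (e t : ℝ) :
    HasDerivAt (fun t => e⁻¹ • ∫ τ in t..t + e, f τ) (e⁻¹ • (f (t + e) - f t)) t := by
  have h : (fun t => e⁻¹ • ∫ τ in t..t + e, f τ) = fun t =>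
      e⁻¹ • ((∫ τ in (0 : ℝ)..t + e, f τ) - ∫ τ in (0 : ℝ)..t, f τ) := by
    funext t
    rw [intervalIntegral.integral_interval_sub_left] <;> exact hf.intervalIntegrable _ _
  rw [h]
  exact (((hasDerivAt_primitive hf (t + e)).comp_add_const t e).sub
    (hasDerivAt_primitive hf t)).const_smul e⁻¹

theorem tendsto_average {E : Type*} [NormedAddCommGroup E] [NormedSpace ℝ E]
    [CompleteSpace E] {f : ℝ → E} (hf : Continuous f) (t : ℝ) :
    Tendsto (fun e : ℝ => e⁻¹ • ∫ τ in t..t + e, f τ) (𝓝[>] 0) (𝓝 (f t)) := by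
  have h := (hasDerivAt_iff_tendsto_slope_zero.1 (hasDerivAt_primitive hf t)).mono_left
    (nhdsGT_le_nhdsNE 0)
  refine h.congr fun e => ?_
  rw [intervalIntegral.integral_interval_sub_left] <;> exact hf.intervalIntegrable _ _

theorem le_of_deriv_nonpos {f f' : ℝ → ℝ} {h : ℝ} (hh : 0 ≤ h) (hf : ∀ t, HasDerivAt f (f' t) t)
    (hf' : ∀ t, 0 ≤ t → t ≤ h → f' t ≤ 0) : f h ≤ f 0 := by
  have := antitoneOn_of_deriv_nonpos (convex_Icc 0 h)
    (fun t _ => (hf t).continuousAt.continuousWithinAt)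
    (fun t _ => (hf t).differentiableAt.differentiableWithinAt) (fun t ht => by
      rw [interior_Icc] at ht
      rw [(hf t).deriv]
      exact hf' t ht.1.le ht.2.le)
  exact this (left_mem_Icc.2 hh) (right_mem_Icc.2 hh) hh

theorem norm_average_sub_le {E : Type*} [NormedAddCommGroup E] [NormedSpace ℝ E]
    [CompleteSpace E] {f : ℝ → E} {t e η : ℝ} (he : 0 < e)
    (hf : IntervalIntegrable f volume t (t + e)) (y : E)
    (h : ∀ τ, t ≤ τ → τ ≤ t + e → ‖f τ - y‖ ≤ η) : ‖e⁻¹ • (∫ τ in t..t + e, f τ) - y‖ ≤ η := by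
  have h1 : e⁻¹ • (∫ τ in t..t + e, f τ) - y = e⁻¹ • ∫ τ in t..t + e, (f τ - y) := by
    rw [intervalIntegral.integral_sub hf intervalIntegrable_const,
      intervalIntegral.integral_const, add_sub_cancel_left, smul_sub, smul_smul,
      inv_mul_cancel₀ he.ne', one_smul]
  have h2 : ‖∫ τ in t..t + e, (f τ - y)‖ ≤ η * |t + e - t| :=
    intervalIntegral.norm_integral_le_of_norm_le_const fun τ hτ => by
      rw [uIoc_of_le (by linarith)] at hτ
      exact h τ hτ.1.le hτ.2
  rw [add_sub_cancel_left, abs_of_pos he] at h2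
  rw [h1, norm_smul, norm_inv, Real.norm_eq_abs, abs_of_pos he, inv_mul_le_iff₀ he, mul_comm]
  exact h2

namespace Problem

variable {P : Problem} {CL : ℝ}

/-! ### Trajectories -/

/-- A trajectory whose controls and states are extended to all times, with the weak state equation
tested against `(A*)⁻¹ q`. -/
structure IsGlobalTrajectory (P : Problem) (x : H P.s) (α : ℝ → H P.s) (a : ℝ → ℝ)
    (X : ℝ → H P.s) : Prop where
  measα : StronglyMeasurable α
  memα : ∀ t, α t ∈ P.Sig
  measa : Measurable a
  mema : ∀ t, a t ∈ P.Γ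
  cont : Continuous X
  init : X 0 = x
  weak : ∀ q : H P.s, ∀ t, 0 ≤ t → inner ℝ (X t) (invAstar P.s P.β q) =
    inner ℝ x (invAstar P.s P.β q) + ∫ τ in (0 : ℝ)..t, (inner ℝ (X τ) q
      - P.μ * inner ℝ (X τ) (invAstar P.s P.β q) + inner ℝ (α τ) (invAstar P.s P.β q)
      - inner ℝ (constH P.s 1) q * a τ)

/-- Freezing state and controls at their time-zero values for `t < 0` gives global continuity and
measurability, so two-sided derivatives of averages exist at `t = 0`. -/
theorem IsTrajectory.global (S : P.Standing CL) {x : H P.s} {α : ℝ → H P.s} {a : ℝ → ℝ}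
    {X : ℝ → H P.s} (hα : α ∈ P.distributedControls) (ha : a ∈ P.boundaryControls)
    (hX : P.IsTrajectory x α a X) :
    P.IsGlobalTrajectory x (fun t => α (max t 0)) (fun t => a (max t 0))
      (fun t => X (max t 0)) where
  measα := hα.1.comp_measurable (measurable_id.max measurable_const)
  memα t := hα.2 _ (le_max_right t 0)
  measa := ha.1.comp (measurable_id.max measurable_const)
  mema t := ha.2 _ (le_max_right t 0)
  cont := hX.1.comp_continuous (continuous_id.max continuous_const) fun t => le_max_right t 0
  init := by rw [max_self]; exact hX.2.1
  weak q t ht := by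
    have h := hX.2.2 _ (invAstar_mem_domAstar S.hs.le P.β q) t ht
    rw [Astar_invAstar S.hβ.ne', delta0_invAstar S.hs S.hβ.ne'] at h
    rw [max_eq_left ht, h]
    congr 1
    refine intervalIntegral.integral_congr fun τ hτ => ?_
    rw [uIcc_of_le ht] at hτ
    simp only [max_eq_left hτ.1]
    ring

namespace IsGlobalTrajectory

variable {x : H P.s} {α : ℝ → H P.s} {a : ℝ → ℝ} {X : ℝ → H P.s}

theorem intervalIntegrable_dist (h : P.IsGlobalTrajectory x α a X) (S : P.Standing CL) (b c : ℝ) :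
    IntervalIntegrable α volume b c := by
  obtain ⟨K, -, hK⟩ := S.exists_norm_le
  exact (intervalIntegrable_const (c := K)).mono_fun h.measα.aestronglyMeasurable
    (Eventually.of_forall fun t => (hK _ (h.memα t)).trans (le_abs_self K))

theorem intervalIntegrable_bdry (h : P.IsGlobalTrajectory x α a X) (S : P.Standing CL) (b c : ℝ) :
    IntervalIntegrable a volume b c :=
  (intervalIntegrable_const (c := P.normΓ)).mono_fun h.measa.aestronglyMeasurable
    (Eventually.of_forall fun t => (S.abs_le_normΓ (h.mema t)).trans (le_abs_self _))

theorem intervalIntegrable_inner (h : P.IsGlobalTrajectory x α a X) (S : P.Standing CL)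
    (p : H P.s) (b c : ℝ) : IntervalIntegrable (fun τ => inner ℝ (α τ) p) volume b c := by
  have hi := h.intervalIntegrable_dist S b c
  exact ⟨hi.1.inner_const p, hi.2.inner_const p⟩

theorem intervalIntegrable_weak (h : P.IsGlobalTrajectory x α a X) (S : P.Standing CL)
    (q : H P.s) (b c : ℝ) :
    IntervalIntegrable (fun τ => inner ℝ (X τ) q
      - P.μ * inner ℝ (X τ) (invAstar P.s P.β q) + inner ℝ (α τ) (invAstar P.s P.β q)
      - inner ℝ (constH P.s 1) q * a τ) volume b c := by
  have hc : ∀ p : H P.s, Continuous fun τ => (inner ℝ (X τ) p : ℝ) := fun p =>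
    h.cont.inner continuous_const
  exact ((((hc q).sub (continuous_const.mul (hc _))).intervalIntegrable b c).add
    (h.intervalIntegrable_inner S _ b c)).sub ((h.intervalIntegrable_bdry S b c).const_mul _)

theorem inner_intervalIntegral {f : ℝ → H P.s} {b c : ℝ} (hf : IntervalIntegrable f volume b c)
    (q : H P.s) : inner ℝ (∫ τ in b..c, f τ) q = ∫ τ in b..c, inner ℝ (f τ) q := by
  have := (innerSL ℝ q).intervalIntegral_comp_comm hf
  simp only [innerSL_apply_apply] at this
  rw [real_inner_comm, ← this]
  exact intervalIntegral.integral_congr fun τ _ => real_inner_comm _ _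

/-- The differential energy inequality for time averages of a trajectory. -/
theorem energy_average (h : P.IsGlobalTrajectory x α a X) (S : P.Standing CL) {e t : ℝ}
    (he : 0 < e) (ht : 0 ≤ t) :
    2 * inner ℝ (e⁻¹ • ∫ τ in t..t + e, X τ) (e⁻¹ • (X (t + e) - X t)) ≤
      P.β * P.normΓ ^ 2 - 2 * P.μ * ‖e⁻¹ • ∫ τ in t..t + e, X τ‖ ^ 2 +
      2 * inner ℝ (e⁻¹ • ∫ τ in t..t + e, α τ) (e⁻¹ • ∫ τ in t..t + e, X τ) := by
  set Y := e⁻¹ • ∫ τ in t..t + e, X τ with hY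
  set A := e⁻¹ • ∫ τ in t..t + e, α τ with hA
  set D := e⁻¹ • (X (t + e) - X t) with hD
  set b := e⁻¹ • ∫ τ in t..t + e, a τ with hb
  set f := D + P.μ • Y - A with hf
  have hXi : IntervalIntegrable X volume t (t + e) := h.cont.intervalIntegrable _ _
  have hαi := h.intervalIntegrable_dist S t (t + e)
  -- The average solves the equation strongly: it has boundary value `b`, the average of `a`, and `A
  -- Y = f` with `f = D + μ Y - A`, where the last `A` is the average of `α`. Dissipativity with
  -- boundary data then applies with `c = b` and `|b| ≤ ‖Γ‖`.
  have key : Y = constH P.s b + resolvent P.s P.β 0 f := by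
    refine ext_inner_right ℝ fun q => ?_
    have h1 := h.weak q t ht
    have h2 := h.weak q (t + e) (by linarith)
    have hc : ∀ p : H P.s, IntervalIntegrable (fun τ => (inner ℝ (X τ) p : ℝ)) volume t (t + e) :=
      fun p => (h.cont.inner continuous_const).intervalIntegrable _ _
    have h3 := intervalIntegral.integral_add_adjacent_intervals
      (h.intervalIntegrable_weak S q 0 t) (h.intervalIntegrable_weak S q t (t + e))
    have h4 : inner ℝ (X (t + e) - X t) (invAstar P.s P.β q) =
        inner ℝ (∫ τ in t..t + e, X τ) q
          - P.μ * inner ℝ (∫ τ in t..t + e, X τ) (invAstar P.s P.β q)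
          + inner ℝ (∫ τ in t..t + e, α τ) (invAstar P.s P.β q)
          - inner ℝ (constH P.s 1) q * ∫ τ in t..t + e, a τ := by
      rw [inner_intervalIntegral hXi, inner_intervalIntegral hXi, inner_intervalIntegral hαi,
        ← intervalIntegral.integral_const_mul, ← intervalIntegral.integral_const_mul,
        ← intervalIntegral.integral_sub (hc q) ((hc _).const_mul _),
        ← intervalIntegral.integral_add ((hc q).sub ((hc _).const_mul _))
          (h.intervalIntegrable_inner S _ _ _),
        ← intervalIntegral.integral_sub (((hc q).sub ((hc _).const_mul _)).add
          (h.intervalIntegrable_inner S _ _ _)) ((h.intervalIntegrable_bdry S _ _).const_mul _),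
        inner_sub_left]
      linarith
    rw [inner_add_left, constH_eq_smul, real_inner_smul_left, ← inner_invAstar, hf,
      inner_sub_left, inner_add_left, real_inner_smul_left, hD, real_inner_smul_left, h4, hA, hY,
      hb, real_inner_smul_left, real_inner_smul_left, real_inner_smul_left, smul_eq_mul]
    ring
  have h1 := inner_const_add_resolvent_le S.hs.le S.hβ f b
  rw [← key] at h1
  have hb2 : b ^ 2 ≤ P.normΓ ^ 2 := by
    refine sq_le_sq' ?_ ?_
    all_goals
      have := norm_average_sub_le he (h.intervalIntegrable_bdry S t (t + e)) 0 (η := P.normΓ)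
        fun τ _ _ => by rw [sub_zero]; exact S.abs_le_normΓ (h.mema τ)
      rw [sub_zero, Real.norm_eq_abs] at this
      have := abs_le.1 this
      linarith
  have h2 := mul_le_mul_of_nonneg_left hb2 S.hβ.le
  have h3 : inner ℝ f Y = inner ℝ Y D + P.μ * ‖Y‖ ^ 2 - inner ℝ A Y := by
    rw [hf, inner_sub_left, inner_add_left, real_inner_comm, real_inner_smul_left _ _ P.μ,
      real_inner_self_eq_norm_sq]
  linarith

theorem norm_sq_add_one_le (h : P.IsGlobalTrajectory x α a X) (S : P.Standing CL) {K : ℝ}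
    (hK : ∀ α ∈ P.Sig, ‖α‖ ≤ K) {t : ℝ} (ht : 0 ≤ t) :
    ‖X t‖ ^ 2 + 1 ≤
      Real.exp ((P.β * P.normΓ ^ 2 + 2 * |P.μ| + K ^ 2 + 1) * t) * (‖x‖ ^ 2 + 1) := by
  set C := P.β * P.normΓ ^ 2 + 2 * |P.μ| + K ^ 2 + 1 with hC
  set Y : ℝ → ℝ → H P.s := fun e t => e⁻¹ • ∫ τ in t..t + e, X τ with hY
  have hlim : ∀ t, Tendsto (fun e => ‖Y e t‖ ^ 2 + 1) (𝓝[>] 0) (𝓝 (‖X t‖ ^ 2 + 1)) := fun t =>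
    ((tendsto_average h.cont t).norm.pow 2).add_const 1
  have key : ∀ e, 0 < e →
      ‖Y e t‖ ^ 2 + 1 ≤ Real.exp (C * t) * (‖Y e 0‖ ^ 2 + 1) := by
    intro e he
    have hd : ∀ t, HasDerivAt (fun t => Real.exp (-C * t) * (‖Y e t‖ ^ 2 + 1))
        (Real.exp (-C * t) * (-C * 1) * (‖Y e t‖ ^ 2 + 1) +
          Real.exp (-C * t) * (2 * inner ℝ (Y e t) (e⁻¹ • (X (t + e) - X t)))) t := fun t =>
      (((hasDerivAt_id t).const_mul (-C)).exp).mul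
        (((hasDerivAt_average h.cont e t).norm_sq).add_const 1)
    have := le_of_deriv_nonpos ht hd fun τ hτ _ => by
      have h1 := h.energy_average S he hτ
      have h2 : ‖e⁻¹ • ∫ σ in τ..τ + e, α σ‖ ≤ K := by
        have := norm_average_sub_le he (h.intervalIntegrable_dist S τ (τ + e)) 0 (η := K)
          fun σ _ _ => by rw [sub_zero]; exact hK _ (h.memα σ)
        rwa [sub_zero] at this
      have h3 := (real_inner_le_norm (e⁻¹ • ∫ σ in τ..τ + e, α σ) (Y e τ)).trans
        (mul_le_mul_of_nonneg_right h2 (norm_nonneg _))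
      have h4 : -(P.μ * ‖Y e τ‖ ^ 2) ≤ |P.μ| * ‖Y e τ‖ ^ 2 := by
        rw [← neg_mul]
        exact mul_le_mul_of_nonneg_right (neg_le_abs _) (by positivity)
      have h5 : 2 * inner ℝ (Y e τ) (e⁻¹ • (X (τ + e) - X τ)) ≤ C * (‖Y e τ‖ ^ 2 + 1) := by
        have h6 : 0 ≤ P.β * P.normΓ ^ 2 * ‖Y e τ‖ ^ 2 :=
          mul_nonneg (mul_nonneg S.hβ.le (sq_nonneg _)) (sq_nonneg _)
        have h7 : 0 ≤ K ^ 2 * ‖Y e τ‖ ^ 2 := by positivity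
        have h8 := abs_nonneg P.μ
        rw [hC]
        change 2 * inner ℝ (Y e τ) (e⁻¹ • (X (τ + e) - X τ)) ≤
          P.β * P.normΓ ^ 2 - 2 * P.μ * ‖Y e τ‖ ^ 2 +
          2 * inner ℝ (e⁻¹ • ∫ σ in τ..τ + e, α σ) (Y e τ) at h1
        linarith [sq_nonneg (K - ‖Y e τ‖)]
      have h6 := mul_le_mul_of_nonneg_left h5 (Real.exp_pos (-C * τ)).le
      linarith
    simp only [mul_zero, Real.exp_zero, one_mul] at this
    rw [← mul_le_mul_iff_right₀ (Real.exp_pos (-C * t)), ← mul_assoc, ← Real.exp_add]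
    rwa [neg_mul, neg_add_cancel, Real.exp_zero, one_mul, ← neg_mul]
  have := le_of_tendsto_of_tendsto (hlim t) ((hlim 0).const_mul (Real.exp (C * t)))
    (Filter.Eventually.mono self_mem_nhdsWithin key)
  rwa [h.init] at this

end IsGlobalTrajectory

/-- Trajectories stay close to the initial state for short times, uniformly in the controls. -/
theorem Standing.exists_trajectory_near (S : P.Standing CL) (x : H P.s) {η : ℝ} (hη : 0 < η) :
    ∃ h₀ > 0, ∀ α a X, P.IsGlobalTrajectory x α a X → ∀ t, 0 ≤ t → t ≤ h₀ → ‖X t - x‖ ≤ η := by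
  obtain ⟨K, hK0, hK⟩ := S.exists_norm_le
  set C := P.β * P.normΓ ^ 2 + 2 * |P.μ| + K ^ 2 + 1 with hC
  have hC0 : 0 ≤ C := by
    have := mul_nonneg S.hβ.le (sq_nonneg P.normΓ)
    have := abs_nonneg P.μ
    positivity
  set M := √(Real.exp C * (‖x‖ ^ 2 + 1)) with hM
  have hM0 : 0 ≤ M := Real.sqrt_nonneg _
  -- The weak equation only controls `⟨X t - x, p⟩` for `p` in `D(A*)`. Such a `p` is taken so close
  -- to `x` that the error paired with `X t - x`, of norm at most `M + ‖x‖`, is at most `η²/4`.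
  obtain ⟨q, hq⟩ := exists_invAstar_near S.hs S.hβ.ne' x
    (show 0 < η ^ 2 / (4 * (M + ‖x‖ + 1)) by positivity)
  set p := invAstar P.s P.β q with hp
  set D := M * ‖q‖ + |P.μ| * (M * ‖p‖) + K * ‖p‖ + ‖constH P.s 1‖ * ‖q‖ * P.normΓ with hD
  have hD0 : 0 ≤ D := by
    have := S.normΓ_nonneg
    positivity
  have hlim : Tendsto (fun t => (Real.exp (C * t) - 1) * (‖x‖ ^ 2 + 1) + 2 * (D * t)) (𝓝 0)
      (𝓝 0) := by
    have : Continuous fun t => (Real.exp (C * t) - 1) * (‖x‖ ^ 2 + 1) + 2 * (D * t) := by fun_prop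
    simpa using this.tendsto 0
  obtain ⟨h₁, hh₁, hball⟩ := Metric.eventually_nhds_iff.1
    (hlim.eventually (gt_mem_nhds (show 0 < η ^ 2 / 2 by positivity)))
  refine ⟨min (h₁ / 2) 1, by positivity, fun α a X h t ht hth => ?_⟩
  have hbd : ∀ τ, 0 ≤ τ → τ ≤ 1 → ‖X τ‖ ≤ M := by
    intro τ hτ hτ1
    refine Real.le_sqrt_of_sq_le ?_
    have h1 := h.norm_sq_add_one_le S hK hτ
    have h2 : Real.exp (C * τ) ≤ Real.exp C := Real.exp_le_exp.2 (by nlinarith)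
    have h3 := mul_le_mul_of_nonneg_right h2 (by positivity : 0 ≤ ‖x‖ ^ 2 + 1)
    linarith
  have ht1 : t ≤ 1 := hth.trans (min_le_right _ _)
  have hsmall := hball (show dist t 0 < h₁ by
    rw [Real.dist_eq, sub_zero, abs_of_nonneg ht]
    linarith [hth.trans (min_le_left _ _)])
  have h1 := h.norm_sq_add_one_le S hK ht
  have h2 : |inner ℝ (X t) p - inner ℝ x p| ≤ D * t := by
    rw [hp, h.weak q t ht, add_sub_cancel_left, ← Real.norm_eq_abs]
    have := intervalIntegral.norm_integral_le_of_norm_le_const (C := D)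
      (f := fun τ => inner ℝ (X τ) q - P.μ * inner ℝ (X τ) (invAstar P.s P.β q)
        + inner ℝ (α τ) (invAstar P.s P.β q) - inner ℝ (constH P.s 1) q * a τ) (a := 0) (b := t)
      (fun τ hτ => by
        rw [uIoc_of_le ht] at hτ
        have hX := hbd τ hτ.1.le (hτ.2.trans ht1)
        rw [← hp, hD]
        refine (norm_sub_le _ _).trans (add_le_add ((norm_add_le _ _).trans (add_le_add
          ((norm_sub_le _ _).trans (add_le_add ?_ ?_)) ?_)) ?_)
        · exact (norm_inner_le_norm _ _).trans (by gcongr)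
        · rw [norm_mul, Real.norm_eq_abs]
          gcongr
          exact (norm_inner_le_norm _ _).trans (by gcongr)
        · exact (norm_inner_le_norm _ _).trans
            (mul_le_mul_of_nonneg_right (hK _ (h.memα τ)) (norm_nonneg _))
        · rw [norm_mul]
          exact mul_le_mul (norm_inner_le_norm _ _) (S.abs_le_normΓ (h.mema τ)) (norm_nonneg _)
            (by positivity))
    rwa [sub_zero, abs_of_nonneg ht] at this
  have h3 : ‖X t - x‖ ≤ M + ‖x‖ := (norm_sub_le _ _).trans (by linarith [hbd t ht ht1])
  have h4 : |inner ℝ (X t - x) (x - p)| ≤ η ^ 2 / 4 := by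
    refine (abs_real_inner_le_norm _ _).trans ?_
    calc ‖X t - x‖ * ‖x - p‖ ≤ (M + ‖x‖ + 1) * (η ^ 2 / (4 * (M + ‖x‖ + 1))) := by
          gcongr
          linarith
      _ = η ^ 2 / 4 := by field_simp
  -- Weak continuity together with the one-sided growth bound for `‖X t‖²` gives norm continuity.
  -- The growth and weak terms take `η²/2`, the approximation of `x` by `p` the other half.
  have h5 : ‖X t - x‖ ^ 2 = ‖X t‖ ^ 2 - ‖x‖ ^ 2 - 2 * (inner ℝ (X t) p - inner ℝ x p)
      - 2 * inner ℝ (X t - x) (x - p) := by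
    rw [norm_sub_sq_real, inner_sub_left, inner_sub_right, inner_sub_right,
      real_inner_self_eq_norm_sq]
    ring
  have h6 := neg_le_of_abs_le h2
  have h7 := neg_le_of_abs_le h4
  refine le_of_sq_le_sq ?_ hη.le
  rw [h5]
  linarith

/-- The energy inequality for short times, uniform in the controls. -/
theorem Standing.exists_energy (S : P.Standing CL) (x : H P.s) {η : ℝ} (hη : 0 < η) :
    ∃ h₀ > 0, ∀ α a X, P.IsGlobalTrajectory x α a X → ∀ h, 0 ≤ h → h ≤ h₀ →
      ‖X h‖ ^ 2 ≤ ‖x‖ ^ 2 + h * (P.β * P.normΓ ^ 2 - 2 * P.μ * ‖x‖ ^ 2) +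
        2 * (∫ τ in (0 : ℝ)..h, inner ℝ (α τ) x) + η * h := by
  obtain ⟨K, hK0, hK⟩ := S.exists_norm_le
  set C := 2 * K + 2 * |P.μ| * (2 * ‖x‖ + 1) with hC
  have hC0 : 0 ≤ C := by positivity
  set θ := min 1 (η / (C + 1)) with hθ
  have hθ0 : 0 < θ := by positivity
  have hθ1 : θ ≤ 1 := min_le_left _ _
  have hCθ : C * θ ≤ η := by
    have : θ ≤ η / (C + 1) := min_le_right _ _
    rw [le_div_iff₀ (by positivity)] at this
    nlinarith
  obtain ⟨h₀, hh₀, hnear⟩ := S.exists_trajectory_near x hθ0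
  -- Half of `h₀`, so that the windows `[t, t + e]` with `t ≤ h` and `e < h₀/2` stay inside `[0,
  -- h₀]`.
  refine ⟨h₀ / 2, by positivity, fun α a X hX h hh hhh => ?_⟩
  set E : ℝ → ℝ := fun t => ∫ τ in (0 : ℝ)..t, inner ℝ (α τ) x with hE
  have hEc : Continuous E := intervalIntegral.continuous_primitive
    (fun b c => hX.intervalIntegrable_inner S x b c) 0
  set m := P.β * P.normΓ ^ 2 - 2 * P.μ * ‖x‖ ^ 2 + η with hm
  -- `α` is only measurable, so its primitive `E` is averaged too: the derivative of the averaged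
  -- `E` is exactly the inner product of the averaged `α` with `x`. Up to errors `C θ ≤ η` from
  -- replacing the averaged state by `x`, the energy inequality makes `f e` nonincreasing.
  set f : ℝ → ℝ → ℝ := fun e t => ‖e⁻¹ • ∫ τ in t..t + e, X τ‖ ^ 2
    - 2 * (e⁻¹ • ∫ τ in t..t + e, E τ) - t * m with hf
  have hlim : ∀ t, Tendsto (fun e => f e t) (𝓝[>] 0) (𝓝 (‖X t‖ ^ 2 - 2 * E t - t * m)) := fun t =>
    (((tendsto_average hX.cont t).norm.pow 2).sub ((tendsto_average hEc t).const_mul 2)).sub_const _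
  have key : ∀ e, 0 < e → e < h₀ / 2 → f e h ≤ f e 0 := by
    intro e he heh
    have hd : ∀ t, HasDerivAt (f e) (2 * inner ℝ (e⁻¹ • ∫ τ in t..t + e, X τ)
        (e⁻¹ • (X (t + e) - X t)) - 2 * (e⁻¹ • (E (t + e) - E t)) - 1 * m) t := fun t =>
      (((hasDerivAt_average hX.cont e t).norm_sq).sub
        ((hasDerivAt_average hEc e t).const_mul 2)).sub ((hasDerivAt_id t).mul_const m)
    refine le_of_deriv_nonpos hh hd fun t ht hth => ?_
    have h1 := hX.energy_average S he ht
    set Y := e⁻¹ • ∫ τ in t..t + e, X τ with hY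
    set A := e⁻¹ • ∫ τ in t..t + e, α τ with hA
    have h2 : ‖A‖ ≤ K := by
      have := norm_average_sub_le he (hX.intervalIntegrable_dist S t (t + e)) 0 (η := K)
        fun σ _ _ => by rw [sub_zero]; exact hK _ (hX.memα σ)
      rwa [sub_zero] at this
    have h3 : ‖Y - x‖ ≤ θ := norm_average_sub_le he (hX.cont.intervalIntegrable _ _) x
      fun τ hτ hτ' => hnear α a X hX τ (ht.trans hτ) (by linarith)
    have h4 : e⁻¹ • (E (t + e) - E t) = inner ℝ A x := by
      rw [hA, real_inner_smul_left,
        IsGlobalTrajectory.inner_intervalIntegral (hX.intervalIntegrable_dist S t (t + e)), hE,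
        smul_eq_mul]
      dsimp only
      rw [intervalIntegral.integral_interval_sub_left] <;>
        exact hX.intervalIntegrable_inner S x _ _
    have h5 : inner ℝ A Y ≤ inner ℝ A x + K * θ := by
      have : inner ℝ A Y = inner ℝ A x + inner ℝ A (Y - x) := by rw [inner_sub_right]; ring
      rw [this]
      have := (real_inner_le_norm A (Y - x)).trans (mul_le_mul h2 h3 (norm_nonneg _) hK0)
      linarith
    have h6 : |‖Y‖ ^ 2 - ‖x‖ ^ 2| ≤ θ * (2 * ‖x‖ + 1) := by
      have e1 : ‖Y‖ ^ 2 - ‖x‖ ^ 2 = (‖Y‖ - ‖x‖) * (‖Y‖ + ‖x‖) := by ring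
      have e2 := (abs_norm_sub_norm_le Y x).trans h3
      have e3 : ‖Y‖ ≤ ‖x‖ + 1 := by linarith [(abs_le.1 e2).2]
      rw [e1, abs_mul, abs_of_nonneg (by positivity : 0 ≤ ‖Y‖ + ‖x‖)]
      exact mul_le_mul e2 (by linarith) (by positivity) hθ0.le
    have h7 : -(P.μ * (‖Y‖ ^ 2 - ‖x‖ ^ 2)) ≤ |P.μ| * (θ * (2 * ‖x‖ + 1)) := by
      refine (neg_le_abs _).trans ?_
      rw [abs_mul]
      exact mul_le_mul_of_nonneg_left h6 (abs_nonneg _)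
    rw [h4, hm]
    rw [hC] at hCθ
    linarith
  have hev : ∀ᶠ e in 𝓝[>] (0 : ℝ), f e h ≤ f e 0 := by
    filter_upwards [self_mem_nhdsWithin,
      nhdsWithin_le_nhds (gt_mem_nhds (show (0 : ℝ) < h₀ / 2 by positivity))] with e he heh
    exact key e he heh
  have := le_of_tendsto_of_tendsto (hlim h) (hlim 0) hev
  have hE0 : E 0 = 0 := by simp [hE]
  rw [hX.init, hE0] at this
  rw [hm] at this
  change _ ≤ _ + 2 * E h + η * h
  linarith

end Problem

theorem norm_sq_constH_one {s : ℝ} (hs : 0 ≤ s) : ‖constH s 1‖ ^ 2 = s := by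
  rw [← real_inner_self_eq_norm_sq, inner_constH_one hs,
    H.ae_congr_interval (coeFn_constH s 1) (right_mem_Icc.2 hs)]
  simp

theorem exists_norm_eq_one {s : ℝ} (hs : 0 < s) : ∃ e : H s, ‖e‖ = 1 := by
  have h : ‖constH s 1‖ ≠ 0 := fun h0 => by
    have := norm_sq_constH_one hs.le
    rw [h0] at this
    norm_num at this
    exact hs.ne this
  exact ⟨‖constH s 1‖⁻¹ • constH s 1, by rw [norm_smul, norm_inv, norm_norm, inv_mul_cancel₀ h]⟩

namespace Problem

variable {P : Problem} {CL : ℝ}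

/-! ### Short time expansions of test functions along trajectories -/

theorem Test2.eq_ray {g : H P.s → ℝ} {g₀ : ℝ → ℝ} (h : P.Test2 g g₀) {e : H P.s} (he : ‖e‖ = 1)
    {t : ℝ} (ht : 0 ≤ t) : g₀ t = g (t • e) := by
  rw [h.2.2, norm_smul, he, mul_one, Real.norm_eq_abs, abs_of_nonneg ht]

/-- `g₀` is prescribed only on `[0, ∞)`. Along a unit vector `e`, `t ↦ g(t e)` is a `C²` even
extension of it, which gives meaning to derivatives at `0`. -/
theorem Test2.contDiff_ray {g : H P.s → ℝ} {g₀ : ℝ → ℝ} (h : P.Test2 g g₀) (e : H P.s) :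
    ContDiff ℝ 2 fun t : ℝ => g (t • e) :=
  h.1.comp (contDiff_id.smul contDiff_const)

theorem Test2.deriv_ray {g : H P.s → ℝ} {g₀ : ℝ → ℝ} (h : P.Test2 g g₀) {e : H P.s}
    (he : ‖e‖ = 1) {t : ℝ} (ht : 0 < t) :
    HasDerivAt g₀ (deriv (fun t : ℝ => g (t • e)) t) t := by
  have h1 : HasDerivAt (fun t : ℝ => g (t • e)) (deriv (fun t : ℝ => g (t • e)) t) t :=
    ((h.contDiff_ray e).differentiable (by norm_num) t).hasDerivAt
  refine h1.congr_of_eventuallyEq ?_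
  filter_upwards [lt_mem_nhds ht] with r hr
  exact h.eq_ray he hr.le

theorem Test2.hasGradientAt_zero {g : H P.s → ℝ} {g₀ : ℝ → ℝ} (h : P.Test2 g g₀) :
    gradient g 0 = 0 := by
  have h1 : HasFDerivAt g (fderiv ℝ g 0) 0 := (h.1.differentiable (by norm_num) 0).hasFDerivAt
  have h2 : HasFDerivAt (fun y => g (-y)) ((fderiv ℝ g 0).comp (-ContinuousLinearMap.id ℝ _)) 0 := by
    have h1' : HasFDerivAt g (fderiv ℝ g 0) (-(0 : H P.s)) := by rwa [neg_zero]
    exact h1'.comp 0 (hasFDerivAt_id (0 : H P.s)).neg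
  have h3 : (fun y => g (-y)) = g := funext fun y => by rw [h.2.2, h.2.2, norm_neg]
  rw [h3] at h2
  have h4 := h1.unique h2
  have h5 : fderiv ℝ g 0 = 0 := by
    ext v
    have := congrArg (fun L => L v) h4
    simp only [ContinuousLinearMap.comp_apply, neg_apply,
      ContinuousLinearMap.id_apply, map_neg] at this
    change fderiv ℝ g 0 v = 0
    linarith
  rw [gradient, h5, map_zero]

theorem Test2.radialCoeff_zero {g : H P.s → ℝ} {g₀ : ℝ → ℝ} (h : P.Test2 g g₀) {e : H P.s}
    (he : ‖e‖ = 1) : Tendsto (fun t => deriv (fun t : ℝ => g (t • e)) t / t) (𝓝[>] 0)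
      (𝓝 (radialCoeff g₀ 0)) := by
  set ψ : ℝ → ℝ := fun t => g (t • e) with hψ
  have hψ2 := h.contDiff_ray e
  have hψ1 : ContDiff ℝ 1 (deriv ψ) := by
    have : ContDiff ℝ (1 + 1) ψ := by exact_mod_cast hψ2
    exact (contDiff_succ_iff_deriv.1 this).2.2
  have hψ0 : deriv ψ 0 = 0 := by
    have h1 : HasDerivAt ψ (deriv ψ 0) 0 := (hψ2.differentiable (by norm_num) 0).hasDerivAt
    have h2 : HasDerivAt (fun t => ψ (-t)) (-deriv ψ 0) 0 := by
      have h1' : HasDerivAt ψ (deriv ψ 0) (-0) := by rwa [neg_zero]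
      have h2' := h1'.scomp 0 (hasDerivAt_neg (0 : ℝ))
      rwa [neg_one_smul] at h2'
    have h3 : (fun t => ψ (-t)) = ψ := funext fun t => by
      simp only [hψ]; rw [h.2.2, h.2.2, neg_smul, norm_neg]
    rw [h3] at h2
    linarith [h1.unique h2]
  have hslope := (hasDerivAt_iff_tendsto_slope_zero.1
    (hψ1.differentiable (by norm_num) 0).hasDerivAt).mono_left (nhdsGT_le_nhdsNE 0)
  simp only [zero_add, hψ0, sub_zero, smul_eq_mul] at hslope
  have hlim : Tendsto (fun t => deriv ψ t / t) (𝓝[>] 0) (𝓝 (deriv (deriv ψ) 0)) :=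
    hslope.congr fun t => by rw [div_eq_inv_mul]
  have hlim2 : Tendsto (fun t => deriv g₀ t / t) (𝓝[>] 0) (𝓝 (deriv (deriv ψ) 0)) := by
    refine hlim.congr' ?_
    filter_upwards [self_mem_nhdsWithin] with t ht
    rw [(h.deriv_ray he ht).deriv]
  rw [radialCoeff, if_pos rfl, hlim2.limUnder_eq]
  exact hlim

/-- The energy inequality bounds `|X|²`, so `g` is regarded as a function of the squared norm. The
definition of `radialCoeff` at `0` is what makes this function differentiable there from the right.
-/
theorem Test2.hasDerivWithinAt_sqrt {g : H P.s → ℝ} {g₀ : ℝ → ℝ} (hs : 0 < P.s)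
    (h : P.Test2 g g₀) (x : H P.s) :
    HasDerivWithinAt (fun q => g₀ √q) (radialCoeff g₀ ‖x‖ / 2) (Ici 0) (‖x‖ ^ 2) := by
  obtain ⟨e, he⟩ := exists_norm_eq_one hs
  rcases eq_or_ne x 0 with rfl | hx
  · rw [norm_zero, zero_pow two_ne_zero, hasDerivWithinAt_iff_tendsto_slope, Ici_sdiff_left]
    set ψ : ℝ → ℝ := fun t => g (t • e) with hψ
    have hψ2 := h.contDiff_ray e
    have hL : Tendsto (fun t => (ψ t - ψ 0) / t ^ 2) (𝓝[>] 0) (𝓝 (radialCoeff g₀ 0 / 2)) := by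
      -- `√` is not differentiable at `0`; the quotient `(ψ(t) - ψ(0))/t²` is computed from
      -- `ψ'(t)/(2t)`.
      refine HasDerivAt.lhopital_zero_nhdsGT (f' := deriv ψ) (g' := fun t => 2 * t)
        (Eventually.of_forall fun t =>
          (hψ2.differentiable (by norm_num) t).hasDerivAt.sub_const _)
        (Eventually.of_forall fun t => by simpa using hasDerivAt_pow 2 t) ?_ ?_ ?_ ?_
      · filter_upwards [self_mem_nhdsWithin] with t ht
        have : (0 : ℝ) < t := ht
        positivity
      · have : Continuous fun t => ψ t - ψ 0 := hψ2.continuous.sub continuous_const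
        exact tendsto_nhdsWithin_of_tendsto_nhds (by simpa using this.tendsto 0)
      · have : Continuous fun t : ℝ => t ^ 2 := by fun_prop
        exact tendsto_nhdsWithin_of_tendsto_nhds (by simpa using this.tendsto 0)
      · refine ((h.radialCoeff_zero he).div_const 2).congr fun t => ?_
        rw [div_div, mul_comm t 2]
    have hsq : Tendsto Real.sqrt (𝓝[>] 0) (𝓝[>] 0) := by
      refine tendsto_nhdsWithin_iff.2 ⟨tendsto_nhdsWithin_of_tendsto_nhds ?_, ?_⟩
      · simpa using Real.continuous_sqrt.tendsto 0
      · filter_upwards [self_mem_nhdsWithin] with t ht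
        exact Real.sqrt_pos.2 ht
    refine (hL.comp hsq).congr' ?_
    filter_upwards [self_mem_nhdsWithin] with q hq
    have hq' : (0 : ℝ) < q := hq
    rw [Function.comp, Real.sq_sqrt hq'.le, slope_def_field, Real.sqrt_zero, sub_zero,
      h.eq_ray he (Real.sqrt_nonneg q), h.eq_ray he le_rfl]
  · have hx0 : 0 < ‖x‖ := norm_pos_iff.2 hx
    have h1 := (h.deriv_ray he hx0)
    have h2 := Real.hasDerivAt_sqrt (x := ‖x‖ ^ 2) (by positivity)
    have h3 : √(‖x‖ ^ 2) = ‖x‖ := Real.sqrt_sq hx0.le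
    rw [← h3] at h1
    have h4 := (h1.comp _ h2).hasDerivWithinAt (s := Ici 0)
    refine h4.congr_deriv ?_
    rw [radialCoeff, if_neg hx0.ne', h3, (h.deriv_ray he hx0).deriv]
    field_simp

theorem Test2.gradient_eq {g : H P.s → ℝ} {g₀ : ℝ → ℝ} (hs : 0 < P.s) (h : P.Test2 g g₀)
    (x : H P.s) : gradient g x = radialCoeff g₀ ‖x‖ • x := by
  rcases eq_or_ne x 0 with rfl | hx
  · rw [h.hasGradientAt_zero, smul_zero]
  · have hx0 : 0 < ‖x‖ ^ 2 := pow_pos (norm_pos_iff.2 hx) 2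
    have h1 := (h.hasDerivWithinAt_sqrt hs x).hasDerivAt (Ici_mem_nhds hx0)
    have h2 := h1.comp_hasFDerivAt x ((hasFDerivAt_id x).norm_sq)
    have h3 : (fun q => g₀ √q) ∘ (fun y : H P.s => ‖id y‖ ^ 2) = g := by
      funext y
      simp only [Function.comp, id]
      rw [Real.sqrt_sq (norm_nonneg _), h.2.2]
    rw [h3] at h2
    refine HasGradientAt.gradient (hasGradientAt_iff_hasFDerivAt.2 (h2.congr_fderiv ?_))
    ext v
    simp only [smul_apply, ContinuousLinearMap.comp_apply, innerSL_apply_apply, id,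
      InnerProductSpace.toDual_apply_apply, real_inner_smul_left, smul_eq_mul, nsmul_eq_mul,
      ContinuousLinearMap.id_apply]
    push_cast
    ring

theorem IsGlobalTrajectory.abs_integral_inner_le {x : H P.s} {α : ℝ → H P.s} {a : ℝ → ℝ}
    {X : ℝ → H P.s} (hX : P.IsGlobalTrajectory x α a X) {K : ℝ} (hK : ∀ α ∈ P.Sig, ‖α‖ ≤ K)
    (p : H P.s) {h : ℝ} (hh : 0 ≤ h) :
    |∫ τ in (0 : ℝ)..h, inner ℝ (α τ) p| ≤ K * ‖p‖ * h := by
  have := intervalIntegral.norm_integral_le_of_norm_le_const (a := 0) (b := h)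
    (f := fun τ => inner ℝ (α τ) p) (C := K * ‖p‖) fun τ _ => (norm_inner_le_norm _ _).trans
      (mul_le_mul_of_nonneg_right (hK _ (hX.memα τ)) (norm_nonneg _))
  rwa [sub_zero, abs_of_nonneg hh] at this

/-- Since `g₀` is nondecreasing, the upper bound `Q` for `‖X h‖²` may be inserted into `g₀ ∘ √`,
which is then linearised at `‖x‖²`. No lower bound for the energy is required. -/
theorem Standing.exists_test2_expansion (S : P.Standing CL) {g : H P.s → ℝ} {g₀ : ℝ → ℝ}
    (hg : P.Test2 g g₀) (x : H P.s) {η : ℝ} (hη : 0 < η) :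
    ∃ h₀ > 0, ∀ α a X, P.IsGlobalTrajectory x α a X → ∀ h, 0 ≤ h → h ≤ h₀ →
      g (X h) ≤ g x + h * (radialCoeff g₀ ‖x‖ * (P.β * P.normΓ ^ 2 / 2)
        - P.μ * inner ℝ (gradient g x) x) +
        (∫ τ in (0 : ℝ)..h, inner ℝ (α τ) (gradient g x)) + η * h := by
  obtain ⟨K, hK0, hK⟩ := S.exists_norm_le
  set c := radialCoeff g₀ ‖x‖ with hc
  set m := P.β * P.normΓ ^ 2 - 2 * P.μ * ‖x‖ ^ 2 with hm
  set C := |m| + 2 * (K * ‖x‖) + 1 with hC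
  have hC0 : 0 < C := by positivity
  set θ := min 1 (η / (|c| + 1)) with hθ
  have hθ0 : 0 < θ := by positivity
  have hcθ : |c| * θ ≤ η := by
    have : θ ≤ η / (|c| + 1) := min_le_right _ _
    rw [le_div_iff₀ (by positivity)] at this
    linarith
  have hκ : 0 < η / (2 * C) := by positivity
  obtain ⟨r, hr, hball⟩ := Metric.eventually_nhds_iff.1 (eventually_nhdsWithin_iff.1
    ((hasDerivWithinAt_iff_isLittleO.1 (hg.hasDerivWithinAt_sqrt S.hs x)).bound hκ))
  obtain ⟨h₁, hh₁, hen⟩ := S.exists_energy x hθ0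
  refine ⟨min h₁ (r / (2 * C)), by positivity, fun α a X hX h hh hhh => ?_⟩
  have h1 := hen α a X hX h hh (hhh.trans (min_le_left _ _))
  have h2 := hX.abs_integral_inner_le hK x hh
  set E := ∫ τ in (0 : ℝ)..h, inner ℝ (α τ) x with hE
  set Q := ‖x‖ ^ 2 + h * m + 2 * E + θ * h with hQ
  have hQ0 : 0 ≤ Q := (sq_nonneg _).trans h1
  have hQx : |Q - ‖x‖ ^ 2| ≤ C * h := by
    have e1 : Q - ‖x‖ ^ 2 = h * m + 2 * E + θ * h := by rw [hQ]; ring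
    have e2 : |h * m| = h * |m| := by rw [abs_mul, abs_of_nonneg hh]
    have e3 : |θ * h| ≤ 1 * h := by
      rw [abs_of_nonneg (by positivity)]
      exact mul_le_mul_of_nonneg_right (min_le_left _ _) hh
    have e4 : |2 * E| = 2 * |E| := by rw [abs_mul, abs_two]
    rw [e1]
    refine (abs_add_le _ _).trans ((add_le_add (abs_add_le _ _) le_rfl).trans ?_)
    rw [hC]
    linarith
  have hQr : dist Q (‖x‖ ^ 2) < r := by
    rw [Real.dist_eq]
    have : h ≤ r / (2 * C) := hhh.trans (min_le_right _ _)
    rw [le_div_iff₀ (by positivity)] at this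
    linarith
  have h3 := (le_abs_self _).trans (hball hQr hQ0)
  rw [Real.sqrt_sq (norm_nonneg _), smul_eq_mul, Real.norm_eq_abs, ← hg.2.2] at h3
  have h4 : η / (2 * C) * |Q - ‖x‖ ^ 2| ≤ η / 2 * h := by
    calc η / (2 * C) * |Q - ‖x‖ ^ 2| ≤ η / (2 * C) * (C * h) := by gcongr
      _ = η / 2 * h := by field_simp
  have h5 : g (X h) ≤ g₀ √Q := by
    rw [hg.2.2]
    exact hg.2.1 (norm_nonneg (X h)) (Real.sqrt_nonneg _) (Real.le_sqrt_of_sq_le h1)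
  have h6 : c * (θ * h) ≤ η * h := by
    rw [← mul_assoc]
    exact mul_le_mul_of_nonneg_right
      ((mul_le_mul_of_nonneg_right (le_abs_self c) hθ0.le).trans hcθ) hh
  have h7 : ∫ τ in (0 : ℝ)..h, inner ℝ (α τ) (gradient g x) = c * E := by
    rw [hE, ← intervalIntegral.integral_const_mul, hg.gradient_eq S.hs]
    exact intervalIntegral.integral_congr fun τ _ => inner_smul_right _ _ _
  rw [h7, hg.gradient_eq S.hs, real_inner_smul_left, real_inner_self_eq_norm_sq]
  have h8 : (Q - ‖x‖ ^ 2) * (c / 2) =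
      h * (c * (P.β * P.normΓ ^ 2 / 2) - P.μ * (c * ‖x‖ ^ 2)) + c * E + c * (θ * h) / 2 := by
    rw [hQ, hm]; ring
  linarith

/-- The mean value theorem reduces the increment of `φ` to `⟨X h - x, ∇φ(ξ)⟩` with `ξ` on the
segment. As `∇φ(ξ)` is in `D(A*)`, the weak equation applies to it, and continuity of `A* ∇φ` allows
`ξ` to be replaced by `x`. -/
theorem Standing.exists_test1_expansion (S : P.Standing CL) {φ : H P.s → ℝ}
    (hφ : P.Test1 φ) (x : H P.s) {η : ℝ} (hη : 0 < η) :
    ∃ h₀ > 0, ∀ α a X, P.IsGlobalTrajectory x α a X → ∀ h, 0 ≤ h → h ≤ h₀ →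
      φ (X h) ≤ φ x + h * (inner ℝ (Astar P.β (gradient φ x)) x
        - P.μ * inner ℝ (gradient φ x) x) +
        (∫ τ in (0 : ℝ)..h, (inner ℝ (α τ) (gradient φ x)
          + P.β * delta0 (gradient φ x) * a τ)) + η * h := by
  obtain ⟨K, hK0, hK⟩ := S.exists_norm_le
  have hN := S.normΓ_nonneg
  set Q : H P.s → H P.s := fun y => Astar P.β (gradient φ y) with hQ
  have hQc : Continuous Q := hφ.2.2.2
  have hpQ : ∀ y, gradient φ y = invAstar P.s P.β (Q y) := fun y =>
    (invAstar_Astar S.hs S.hβ.ne' (hφ.2.2.1 y)).symm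
  set T := invAstar P.s P.β with hT
  -- `C` collects the coefficients of `θ` in the errors `b1`, `b2`, `b4`, `b5`, `b6` below.
  set C := ‖Q x‖ + (‖x‖ + 1) + |P.μ| * (‖T (Q x)‖ + (‖x‖ + 1) * ‖T‖) + K * ‖T‖
    + ‖constH P.s 1‖ * P.normΓ + 1 with hC
  have hC0 : 0 < C := by positivity
  set θ := min 1 (η / C) with hθ
  have hθ0 : 0 < θ := by positivity
  have hCθ : C * θ ≤ η := by
    have : θ ≤ η / C := min_le_right _ _
    rw [le_div_iff₀ hC0] at this
    linarith
  obtain ⟨r, hr, hball⟩ := Metric.continuous_iff.1 hQc x θ hθ0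
  obtain ⟨h₀, hh₀, hnear⟩ := S.exists_trajectory_near x (show 0 < min θ (r / 2) by positivity)
  refine ⟨h₀, hh₀, fun α a X hX h hh hhh => ?_⟩
  have hXx : ∀ τ, 0 ≤ τ → τ ≤ h → ‖X τ - x‖ ≤ θ := fun τ h1 h2 =>
    (hnear α a X hX τ h1 (h2.trans hhh)).trans (min_le_left _ _)
  obtain ⟨ξ, hξ, hmv⟩ := domain_mvt (f := φ) (f' := fun y => fderiv ℝ φ y)
    (s := univ) (x := x) (y := X h)
    (fun y _ => (hφ.1.differentiable (by norm_num) y).hasFDerivAt.hasFDerivWithinAt)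
    convex_univ (mem_univ _) (mem_univ _)
  have hξx : dist ξ x < r := by
    have h1 : ‖X h - x‖ ≤ r / 2 := (hnear α a X hX h hh hhh).trans (min_le_right _ _)
    have h2 := (convex_ball x r).segment_subset (Metric.mem_ball_self hr)
      (Metric.mem_ball.2 (show dist (X h) x < r by rw [dist_eq_norm]; linarith)) hξ
    exact Metric.mem_ball.1 h2
  have hq : ‖Q ξ - Q x‖ ≤ θ := by
    have := hball ξ hξx
    rw [dist_eq_norm] at this
    exact this.le
  set d := Q ξ - Q x with hd
  have hQξ : Q ξ = Q x + d := by rw [hd]; abel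
  have e1 : fderiv ℝ φ ξ (X h - x) = inner ℝ (X h) (T (Q ξ)) - inner ℝ x (T (Q ξ)) := by
    rw [← inner_sub_left, ← hpQ, real_inner_comm, gradient, InnerProductSpace.toDual_symm_apply]
  rw [e1, hX.weak _ h hh, add_sub_cancel_left] at hmv
  have hT0 : ‖T d‖ ≤ ‖T‖ * θ := (T.le_opNorm d).trans
    (mul_le_mul_of_nonneg_left hq (norm_nonneg _))
  have hbound : ∀ τ ∈ Icc 0 h, inner ℝ (X τ) (Q ξ) - P.μ * inner ℝ (X τ) (T (Q ξ))
      + inner ℝ (α τ) (T (Q ξ)) - inner ℝ (constH P.s 1) (Q ξ) * a τ ≤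
      (inner ℝ (α τ) (T (Q x)) + -inner ℝ (constH P.s 1) (Q x) * a τ) +
        (inner ℝ (Q x) x - P.μ * inner ℝ (T (Q x)) x + η) := by
    intro τ hτ
    have n1 := hXx τ hτ.1 hτ.2
    have n2 : ‖X τ‖ ≤ ‖x‖ + 1 := by
      have := norm_le_norm_add_norm_sub' (X τ) x
      have := n1.trans (min_le_left _ _)
      linarith
    have f1 : inner ℝ (X τ) (Q ξ) = inner ℝ (Q x) x + inner ℝ (X τ - x) (Q x)
        + inner ℝ (X τ) d := by
      rw [hQξ, inner_add_right, inner_sub_left, real_inner_comm x]; ring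
    have f2 : inner ℝ (X τ) (T (Q ξ)) = inner ℝ (T (Q x)) x + (inner ℝ (X τ - x) (T (Q x))
        + inner ℝ (X τ) (T d)) := by
      rw [hQξ, map_add, inner_add_right, inner_sub_left, real_inner_comm x]; ring
    have f3 : inner ℝ (α τ) (T (Q ξ)) = inner ℝ (α τ) (T (Q x)) + inner ℝ (α τ) (T d) := by
      rw [hQξ, map_add, inner_add_right]
    have f4 : inner ℝ (constH P.s 1) (Q ξ) * a τ = inner ℝ (constH P.s 1) (Q x) * a τ
        + inner ℝ (constH P.s 1) d * a τ := by
      rw [hQξ, inner_add_right]; ring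
    have b1 : inner ℝ (X τ - x) (Q x) ≤ θ * ‖Q x‖ :=
      (real_inner_le_norm _ _).trans (mul_le_mul_of_nonneg_right n1 (norm_nonneg _))
    have b2 : inner ℝ (X τ) d ≤ (‖x‖ + 1) * θ :=
      (real_inner_le_norm _ _).trans (mul_le_mul n2 hq (norm_nonneg _) (by positivity))
    have b3 : |inner ℝ (X τ - x) (T (Q x)) + inner ℝ (X τ) (T d)| ≤
        θ * ‖T (Q x)‖ + (‖x‖ + 1) * (‖T‖ * θ) :=
      (abs_add_le _ _).trans (add_le_add
        ((abs_real_inner_le_norm _ _).trans (mul_le_mul_of_nonneg_right n1 (norm_nonneg _)))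
        ((abs_real_inner_le_norm _ _).trans
          (mul_le_mul n2 hT0 (norm_nonneg _) (by positivity))))
    have b4 : -(P.μ * (inner ℝ (X τ - x) (T (Q x)) + inner ℝ (X τ) (T d))) ≤
        |P.μ| * (θ * ‖T (Q x)‖ + (‖x‖ + 1) * (‖T‖ * θ)) := by
      refine (neg_le_abs _).trans ?_
      rw [abs_mul]
      exact mul_le_mul_of_nonneg_left b3 (abs_nonneg _)
    have b5 : inner ℝ (α τ) (T d) ≤ K * (‖T‖ * θ) :=
      (real_inner_le_norm _ _).trans (mul_le_mul (hK _ (hX.memα τ)) hT0 (norm_nonneg _) hK0)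
    have b6 : -(inner ℝ (constH P.s 1) d * a τ) ≤ ‖constH P.s 1‖ * θ * P.normΓ := by
      refine (neg_le_abs _).trans ?_
      rw [abs_mul]
      exact mul_le_mul ((abs_real_inner_le_norm _ _).trans
        (mul_le_mul_of_nonneg_left hq (norm_nonneg _))) (S.abs_le_normΓ (hX.mema τ))
        (abs_nonneg _) (by positivity)
    rw [f1, f2, f3, f4]
    rw [hC] at hCθ
    linarith
  have hβδ : P.β * delta0 (gradient φ x) = -inner ℝ (constH P.s 1) (Q x) :=
    delta0_of_mem_domAstar S.hs S.hβ.ne' (hφ.2.2.1 x)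
  have hi : IntervalIntegrable (fun τ => inner ℝ (α τ) (T (Q x))
      + -inner ℝ (constH P.s 1) (Q x) * a τ) volume 0 h :=
    (hX.intervalIntegrable_inner S _ _ _).add ((hX.intervalIntegrable_bdry S _ _).const_mul _)
  have hmono := intervalIntegral.integral_mono_on hh (hX.intervalIntegrable_weak S (Q ξ) 0 h)
    (hi.add intervalIntegrable_const) hbound
  rw [intervalIntegral.integral_add hi intervalIntegrable_const, intervalIntegral.integral_const,
    sub_zero, smul_eq_mul] at hmono
  rw [hβδ, hpQ x, show Astar P.β (T (Q x)) = Q x from Astar_invAstar S.hβ.ne' _]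
  linarith

end Problem

/-- `R` regularises: with `S(t)` the semigroup, `w(t) = R S(t) z` is differentiable with `w' = S(t)
z + (lam - μ) w`, and `⟨R f, f⟩ ≤ -lam ‖R f‖²` makes `e^{2μt} ‖w‖²` nonincreasing. Since `S(t) = 0`
for `t ≥ s/β`, the bound is uniform in time even for `μ < 0`. -/
theorem norm_resolvent_semigroup_le {s β : ℝ} (hs : 0 < s) (hβ : 0 < β) {lam : ℝ} (hlam : 0 < lam)
    (μ : ℝ) {t : ℝ} (ht : 0 ≤ t) (z : H s) :
    ‖resolvent s β lam (semigroup β μ t z)‖ ≤ Real.exp (|μ| * (s / β)) * ‖resolvent s β lam z‖ := by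
  rcases le_total (s / β) t with hst | hst
  · rw [semigroup_of_le hβ μ hst, map_zero, norm_zero]
    positivity
  set R := resolvent s β lam with hR
  set F : ℝ → H s := fun t => semigroup β μ t z + (lam - μ) • R (semigroup β μ t z) with hF
  have hSc := continuous_semigroup β μ z
  have hFc : Continuous F := by
    have h : Continuous fun t => R (semigroup β μ t z) := R.continuous.comp hSc
    exact hSc.add (h.const_smul (lam - μ))
  -- Defined as a primitive to be differentiable everywhere; the identity with `R S(t) z`, valid for
  -- `t ≥ 0`, is checked weakly.
  set W : ℝ → H s := fun t => R z + ∫ τ in (0 : ℝ)..t, F τ with hW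
  have hWd : ∀ t, HasDerivAt W (F t) t := fun t => (hasDerivAt_primitive hFc t).const_add _
  have hWe : ∀ t, 0 ≤ t → W t = R (semigroup β μ t z) := by
    intro t ht
    refine ext_inner_right ℝ fun q => ?_
    set p := ContinuousLinearMap.adjoint R q with hp
    have hpK : p = invAstar s β (q + lam • p) := adjoint_resolvent_eq hs.le hβ hlam q
    have h := inner_semigroup_invAstar hβ μ ht z (q + lam • p)
    rw [← hpK] at h
    rw [← ContinuousLinearMap.adjoint_inner_right, ← hp, h, hW]
    dsimp only
    rw [inner_add_left, ← ContinuousLinearMap.adjoint_inner_right, ← hp]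
    congr 1
    have hi := (innerSL ℝ q).intervalIntegral_comp_comm (hFc.intervalIntegrable (μ := volume) 0 t)
    simp only [innerSL_apply_apply] at hi
    rw [real_inner_comm, ← hi]
    refine intervalIntegral.integral_congr fun τ _ => ?_
    simp only [hF, inner_add_right, inner_smul_right]
    rw [real_inner_comm q (semigroup β μ τ z), hp, ContinuousLinearMap.adjoint_inner_right,
      real_inner_comm q (R (semigroup β μ τ z))]
    ring
  have hd : ∀ t, HasDerivAt (fun t => Real.exp (2 * μ * t) * ‖W t‖ ^ 2)
      (Real.exp (2 * μ * t) * (2 * μ * 1) * ‖W t‖ ^ 2 +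
        Real.exp (2 * μ * t) * (2 * inner ℝ (W t) (F t))) t := fun t =>
    (((hasDerivAt_id t).const_mul (2 * μ)).exp).mul (hWd t).norm_sq
  have hle := le_of_deriv_nonpos ht hd fun τ hτ _ => by
    have h1 := inner_resolvent_le hs.le hβ lam (semigroup β μ τ z)
    have h2 : inner ℝ (W τ) (F τ) = inner ℝ (semigroup β μ τ z) (R (semigroup β μ τ z)) +
        (lam - μ) * ‖W τ‖ ^ 2 := by
      rw [hWe τ hτ]
      simp only [hF, inner_add_right, inner_smul_right]
      rw [real_inner_self_eq_norm_sq, real_inner_comm]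
    rw [← hR, ← hWe τ hτ] at h1
    rw [← hWe τ hτ] at h2
    have h3 : inner ℝ (W τ) (F τ) ≤ -μ * ‖W τ‖ ^ 2 := by linarith
    have h4 := mul_le_mul_of_nonneg_left h3 (Real.exp_pos (2 * μ * τ)).le
    linarith
  rw [hWe t ht, hWe 0 le_rfl, semigroup_zero, mul_zero, Real.exp_zero, one_mul] at hle
  have h5 : Real.exp (μ * t) * ‖R (semigroup β μ t z)‖ ≤ ‖R z‖ := by
    refine le_of_sq_le_sq ?_ (norm_nonneg _)
    rw [mul_pow, ← Real.exp_nat_mul]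
    refine le_trans (le_of_eq ?_) hle
    congr 2
    push_cast; ring
  calc ‖R (semigroup β μ t z)‖
      = Real.exp (-(μ * t)) * (Real.exp (μ * t) * ‖R (semigroup β μ t z)‖) := by
        rw [← mul_assoc, ← Real.exp_add, neg_add_cancel, Real.exp_zero, one_mul]
    _ ≤ Real.exp (|μ| * (s / β)) * ‖R z‖ := by
        refine mul_le_mul (Real.exp_le_exp.2 ?_) h5 (by positivity) (Real.exp_pos _).le
        calc -(μ * t) ≤ |μ * t| := neg_le_abs _
          _ = |μ| * t := by rw [abs_mul, abs_of_nonneg ht]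
          _ ≤ |μ| * (s / β) := mul_le_mul_of_nonneg_left hst (abs_nonneg _)

theorem integral_Ioi_eq_integral_Ioi_zero_comp_add (f : ℝ → ℝ) (h : ℝ) :
    ∫ t in Ioi h, f t = ∫ t in Ioi (0 : ℝ), f (t + h) := by
  have := (measurePreserving_add_right volume h).setIntegral_preimage_emb
    (measurableEmbedding_addRight h) f (Ioi h)
  rw [← this]
  congr 2
  ext t
  simp

namespace Problem

variable {P : Problem} {CL : ℝ}

/-! ### Construction of trajectories -/

/-- An equilibrium solves `y = w + μ A⁻¹ y`, where `w` is the boundary value `a` minus `A⁻¹ α`. The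
Volterra formula solves this for every real `μ`. -/
theorem exists_stationary (P : Problem) (α : H P.s) (a : ℝ) :
    ∃ y : H P.s, ∀ q, inner ℝ y q - P.μ * inner ℝ y (invAstar P.s P.β q)
      + inner ℝ α (invAstar P.s P.β q) - inner ℝ (constH P.s 1) q * a = 0 := by
  set w := a • constH P.s 1 - resolvent P.s P.β 0 α with hw
  refine ⟨w + P.μ • resolvent P.s P.β P.μ w, fun q => ?_⟩
  have h := resolvent_eq_resolvent_zero P.β P.μ w
  rw [inner_invAstar, inner_invAstar, ← h, inner_add_left, real_inner_smul_left, hw,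
    inner_sub_left, real_inner_smul_left]
  ring

/-- Equilibrium plus semigroup. Constant controls suffice: they show that the infimum defining
`value` is over a nonempty set, and they are the only controls used for the subsolution property. -/
theorem Standing.exists_trajectory_const (S : P.Standing CL) (x α : H P.s) (a : ℝ) :
    ∃ X, P.IsTrajectory x (fun _ => α) (fun _ => a) X := by
  obtain ⟨y, hy⟩ := P.exists_stationary α a
  refine ⟨fun t => y + semigroup P.β P.μ t (x - y),
    (continuous_const.add (continuous_semigroup _ _ _)).continuousOn, ?_, fun p hp t ht => ?_⟩
  · change y + semigroup P.β P.μ 0 (x - y) = x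
    rw [semigroup_zero]; abel
  · obtain ⟨q, rfl⟩ : ∃ q, invAstar P.s P.β q = p := ⟨_, invAstar_Astar S.hs S.hβ.ne' hp⟩
    rw [Astar_invAstar S.hβ.ne', delta0_invAstar S.hs S.hβ.ne', inner_add_left,
      inner_semigroup_invAstar S.hβ P.μ ht, inner_sub_left]
    have : ∀ τ, inner ℝ (y + semigroup P.β P.μ τ (x - y)) q
        - P.μ * inner ℝ (y + semigroup P.β P.μ τ (x - y)) (invAstar P.s P.β q)
        + inner ℝ α (invAstar P.s P.β q) + -inner ℝ (constH P.s 1) q * a =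
        inner ℝ (semigroup P.β P.μ τ (x - y)) q
        - P.μ * inner ℝ (semigroup P.β P.μ τ (x - y)) (invAstar P.s P.β q) := by
      intro τ
      have := hy q
      rw [inner_add_left, inner_add_left]
      linarith
    simp_rw [this]
    ring

theorem IsTrajectory.intervalIntegrable (S : P.Standing CL) {x : H P.s} {α : ℝ → H P.s}
    {a : ℝ → ℝ} {X : ℝ → H P.s} (hα : α ∈ P.distributedControls) (ha : a ∈ P.boundaryControls)
    (hX : P.IsTrajectory x α a X) {p : H P.s} (hp : p ∈ domAstar P.s) {b c : ℝ} (hb : 0 ≤ b)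
    (hc : 0 ≤ c) :
    IntervalIntegrable (fun τ => inner ℝ (X τ) (Astar P.β p) - P.μ * inner ℝ (X τ) p
      + inner ℝ (α τ) p + P.β * delta0 p * a τ) volume b c := by
  have h := (hX.global S hα ha).intervalIntegrable_weak S (Astar P.β p) b c
  refine h.congr_uIoo fun τ hτ => ?_
  have hτ0 : 0 ≤ τ := (le_min hb hc).trans hτ.1.le
  simp only [max_eq_left hτ0, invAstar_Astar S.hs S.hβ.ne' hp,
    delta0_of_mem_domAstar S.hs S.hβ.ne' hp]
  ring

/-- Changing the initial state. -/
theorem IsTrajectory.add_semigroup (S : P.Standing CL) {x : H P.s} {α : ℝ → H P.s}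
    {a : ℝ → ℝ} {X : ℝ → H P.s} (hα : α ∈ P.distributedControls) (ha : a ∈ P.boundaryControls)
    (hX : P.IsTrajectory x α a X) (y : H P.s) :
    P.IsTrajectory y α a fun t => X t + semigroup P.β P.μ t (y - x) := by
  refine ⟨hX.1.add (continuous_semigroup _ _ _).continuousOn, ?_, fun p hp t ht => ?_⟩
  · change X 0 + semigroup P.β P.μ 0 (y - x) = y
    rw [semigroup_zero, hX.2.1]; abel
  · have h1 := inner_semigroup_invAstar S.hβ P.μ ht (y - x) (Astar P.β p)
    rw [invAstar_Astar S.hs S.hβ.ne' hp] at h1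
    rw [inner_add_left, hX.2.2 p hp t ht, h1, inner_sub_left]
    have hc : ∀ z : H P.s, Continuous fun τ => (inner ℝ (semigroup P.β P.μ τ (y - x)) z : ℝ) :=
      fun z => (continuous_semigroup _ _ _).inner continuous_const
    have hi : IntervalIntegrable (fun τ => inner ℝ (semigroup P.β P.μ τ (y - x)) (Astar P.β p) -
        P.μ * inner ℝ (semigroup P.β P.μ τ (y - x)) p) volume 0 t :=
      ((hc (Astar P.β p)).sub (continuous_const.mul (hc p))).intervalIntegrable _ _
    have h2 := intervalIntegral.integral_add (hX.intervalIntegrable S hα ha hp le_rfl ht) hi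
    have h3 : ∫ τ in (0 : ℝ)..t, (inner ℝ (X τ + semigroup P.β P.μ τ (y - x)) (Astar P.β p)
        - P.μ * inner ℝ (X τ + semigroup P.β P.μ τ (y - x)) p + inner ℝ (α τ) p
        + P.β * delta0 p * a τ) = ∫ τ in (0 : ℝ)..t, ((inner ℝ (X τ) (Astar P.β p)
        - P.μ * inner ℝ (X τ) p + inner ℝ (α τ) p + P.β * delta0 p * a τ) +
        (inner ℝ (semigroup P.β P.μ τ (y - x)) (Astar P.β p)
          - P.μ * inner ℝ (semigroup P.β P.μ τ (y - x)) p)) := by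
      refine intervalIntegral.integral_congr fun τ _ => ?_
      simp only [inner_add_left]
      ring
    rw [h3, h2]
    ring

theorem distributedControls_shift {α : ℝ → H P.s} (hα : α ∈ P.distributedControls) {h : ℝ}
    (hh : 0 ≤ h) : (fun t => α (t + h)) ∈ P.distributedControls :=
  ⟨hα.1.comp_measurable (measurable_id.add_const h), fun t ht => hα.2 _ (by linarith)⟩

theorem boundaryControls_shift {a : ℝ → ℝ} (ha : a ∈ P.boundaryControls) {h : ℝ}
    (hh : 0 ≤ h) : (fun t => a (t + h)) ∈ P.boundaryControls :=
  ⟨ha.1.comp (measurable_id.add_const h), fun t ht => ha.2 _ (by linarith)⟩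

theorem IsTrajectory.shift (S : P.Standing CL) {x : H P.s} {α : ℝ → H P.s}
    {a : ℝ → ℝ} {X : ℝ → H P.s} (hα : α ∈ P.distributedControls) (ha : a ∈ P.boundaryControls)
    (hX : P.IsTrajectory x α a X) {h : ℝ} (hh : 0 ≤ h) :
    P.IsTrajectory (X h) (fun t => α (t + h)) (fun t => a (t + h)) fun t => X (t + h) := by
  refine ⟨hX.1.comp (by fun_prop) fun t (ht : 0 ≤ t) => ?_, by simp, fun p hp t ht => ?_⟩
  · exact add_nonneg ht hh
  · have h1 := hX.2.2 p hp (t + h) (by linarith)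
    have h2 := hX.2.2 p hp h hh
    have h3 := intervalIntegral.integral_add_adjacent_intervals
      (hX.intervalIntegrable S hα ha hp le_rfl hh)
      (hX.intervalIntegrable S hα ha hp hh (show 0 ≤ t + h by linarith))
    have h4 := intervalIntegral.integral_comp_add_right (a := 0) (b := t)
      (fun τ => inner ℝ (X τ) (Astar P.β p) - P.μ * inner ℝ (X τ) p
        + inner ℝ (α τ) p + P.β * delta0 p * a τ) h
    rw [zero_add] at h4
    rw [h4]
    linarith

theorem IsTrajectory.concat (S : P.Standing CL) {x : H P.s} {α α' : ℝ → H P.s}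
    {a a' : ℝ → ℝ} {X Y : ℝ → H P.s} (hα : α ∈ P.distributedControls)
    (ha : a ∈ P.boundaryControls) (hα' : α' ∈ P.distributedControls)
    (ha' : a' ∈ P.boundaryControls) (hX : P.IsTrajectory x α a X) {h : ℝ} (hh : 0 ≤ h)
    (hY : P.IsTrajectory (X h) α' a' Y) :
    P.IsTrajectory x (fun t => if t < h then α t else α' (t - h))
      (fun t => if t < h then a t else a' (t - h)) fun t => if t < h then X t else Y (t - h) := by
  refine ⟨?_, ?_, fun p hp t ht => ?_⟩
  -- Replacing `<` by `≤` changes nothing because `Y 0 = X h`, and makes the gluing set closed.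
  · have h1 : ContinuousOn (fun t => if t ≤ h then X t else Y (t - h)) (Ici 0) := by
      refine ContinuousOn.if (fun t ht => ?_) (hX.1.mono inter_subset_left)
        (hY.1.comp (by fun_prop) fun t ht => ?_)
      · have e : t = h := by
          have := ht.2
          rw [show {a : ℝ | a ≤ h} = Iic h from rfl, frontier_Iic] at this
          exact this
        rw [e, sub_self, hY.2.1]
      · have h2 := ht.2
        simp only [not_le] at h2
        rw [show {a : ℝ | h < a} = Ioi h from rfl, closure_Ioi] at h2
        exact sub_nonneg.2 (mem_Ici.1 h2)
    refine h1.congr fun t _ => ?_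
    rcases lt_trichotomy t h with h2 | h2 | h2
    · simp [h2, h2.le]
    · simp [h2, hY.2.1]
    · simp [h2.not_gt, h2.not_ge]
  · rcases hh.eq_or_lt with h0 | h0
    · subst h0
      simp [hY.2.1, hX.2.1]
    · simp [h0, hX.2.1]
  · set wZ : ℝ → ℝ := fun τ => inner ℝ (if τ < h then X τ else Y (τ - h)) (Astar P.β p)
      - P.μ * inner ℝ (if τ < h then X τ else Y (τ - h)) p
      + inner ℝ (if τ < h then α τ else α' (τ - h)) p
      + P.β * delta0 p * (if τ < h then a τ else a' (τ - h)) with hwZ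
    set wX : ℝ → ℝ := fun τ => inner ℝ (X τ) (Astar P.β p) - P.μ * inner ℝ (X τ) p
      + inner ℝ (α τ) p + P.β * delta0 p * a τ with hwX
    set wY : ℝ → ℝ := fun τ => inner ℝ (Y τ) (Astar P.β p) - P.μ * inner ℝ (Y τ) p
      + inner ℝ (α' τ) p + P.β * delta0 p * a' τ with hwY
    have hXZ : ∀ τ, τ < h → wX τ = wZ τ := fun τ hτ => by simp only [hwX, hwZ, if_pos hτ]
    have hYZ : ∀ τ, h ≤ τ → wY (τ - h) = wZ τ := fun τ hτ => by
      simp only [hwY, hwZ, if_neg hτ.not_gt]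
    have hXi : ∀ c, 0 ≤ c → IntervalIntegrable wX volume 0 c := fun c hc =>
      hX.intervalIntegrable S hα ha hp le_rfl hc
    by_cases hth : t < h
    · simp only [if_pos hth]
      rw [hX.2.2 p hp t ht]
      congr 1
      refine intervalIntegral.integral_congr fun τ hτ => hXZ τ ?_
      rw [uIcc_of_le ht] at hτ
      exact hτ.2.trans_lt hth
    · simp only [if_neg hth]
      have hth' := not_lt.1 hth
      have e0 : EqOn wX wZ (uIoo 0 h) := fun τ hτ => by
        rw [uIoo_of_le hh] at hτ
        exact hXZ τ hτ.2
      have e1 : EqOn (fun τ => wY (τ - h)) wZ (uIoo h t) := fun τ hτ => by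
        rw [uIoo_of_le hth'] at hτ
        exact hYZ τ hτ.1.le
      have i1 : IntervalIntegrable wZ volume 0 h := (hXi h hh).congr_uIoo e0
      have i2 : IntervalIntegrable (fun τ => wY (τ - h)) volume h t := by
        have := (hY.intervalIntegrable S hα' ha' hp le_rfl (sub_nonneg.2 hth')).comp_sub_right h
        rwa [zero_add, sub_add_cancel] at this
      have h3 := intervalIntegral.integral_add_adjacent_intervals i1 (i2.congr_uIoo e1)
      have h4 : ∫ τ in h..t, wY (τ - h) = ∫ τ in (0 : ℝ)..t - h, wY τ := by
        rw [intervalIntegral.integral_comp_sub_right, sub_self]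
      rw [← intervalIntegral.integral_congr_uIoo e0, ← intervalIntegral.integral_congr_uIoo e1,
        h4] at h3
      rw [← h3, hY.2.2 p hp _ (sub_nonneg.2 hth'), hX.2.2 p hp h hh]
      ring

/-! ### The cost -/

/-- `L` is continuous only on the admissible set, so measurability is obtained through the subtype
in which state and controls take their values. -/
theorem IsGlobalTrajectory.measurable_running (S : P.Standing CL) {x : H P.s} {α : ℝ → H P.s}
    {a : ℝ → ℝ} {X : ℝ → H P.s} (hX : P.IsGlobalTrajectory x α a X) (y : ℝ → H P.s)
    (hy : Continuous y) : Measurable fun t => P.L (y t) (α t) (a t) := by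
  let _ : MeasurableSpace (H P.s) := borel _
  have _ : BorelSpace (H P.s) := ⟨rfl⟩
  have hm : Measurable fun t => (y t, α t, a t) :=
    hy.measurable.prodMk (hX.measα.measurable.prodMk hX.measa)
  have hsub : Measurable fun t => (⟨(y t, α t, a t), mem_univ _, hX.memα t, hX.mema t⟩ :
    (univ ×ˢ P.Sig ×ˢ P.Γ : Set (H P.s × H P.s × ℝ))) := hm.subtype_mk
  exact (continuousOn_iff_continuous_domRestrict.1 S.hL.continuousOn).measurable.comp hsub

theorem Standing.integrableOn_cost (S : P.Standing CL) {x : H P.s} {α : ℝ → H P.s}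
    {a : ℝ → ℝ} {X : ℝ → H P.s} (hα : α ∈ P.distributedControls) (ha : a ∈ P.boundaryControls)
    (hX : P.IsTrajectory x α a X) :
    IntegrableOn (fun t => Real.exp (-P.ρ * t) * P.L (X t) (α t) (a t)) (Ioi 0) := by
  have hG := hX.global S hα ha
  have hm := hG.measurable_running S _ hG.cont
  have hexp : Measurable fun t => Real.exp (-P.ρ * t) := by fun_prop
  have hb := (exp_neg_integrableOn_Ioi 0 S.hρ).mul_const CL
  refine hb.mono' ?_ ?_
  · refine AEStronglyMeasurable.congr (hexp.mul hm).aestronglyMeasurable ?_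
    refine (ae_restrict_iff' measurableSet_Ioi).2 (Eventually.of_forall fun t ht => ?_)
    have : max t 0 = t := max_eq_left (le_of_lt ht)
    simp only [Pi.mul_apply, this]
  · refine (ae_restrict_iff' measurableSet_Ioi).2 (Eventually.of_forall fun t ht => ?_)
    have ht' : 0 ≤ t := le_of_lt ht
    rw [norm_mul, Real.norm_eq_abs, abs_of_pos (Real.exp_pos _)]
    exact mul_le_mul_of_nonneg_left (S.hL2 _ _ (hα.2 t ht') _ (ha.2 t ht')) (Real.exp_pos _).le

theorem integral_exp_neg_mul_const {ρ : ℝ} (hρ : 0 < ρ) (c : ℝ) :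
    ∫ t in Ioi (0 : ℝ), Real.exp (-ρ * t) * c = c / ρ := by
  rw [integral_mul_const, integral_exp_mul_Ioi (by linarith)]
  simp only [mul_zero, Real.exp_zero]
  field_simp

theorem Standing.cost_sub_le (S : P.Standing CL) {x y : H P.s} {α : ℝ → H P.s}
    {a : ℝ → ℝ} {X Y : ℝ → H P.s} (hα : α ∈ P.distributedControls) (ha : a ∈ P.boundaryControls)
    (hX : P.IsTrajectory x α a X) (hY : P.IsTrajectory y α a Y) {c : ℝ}
    (hc : ∀ t, 0 ≤ t → P.L (Y t) (α t) (a t) ≤ P.L (X t) (α t) (a t) + c) :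
    P.cost Y α a ≤ P.cost X α a + c / P.ρ := by
  have h1 := S.integrableOn_cost hα ha hX
  have h2 := S.integrableOn_cost hα ha hY
  have h3 := (exp_neg_integrableOn_Ioi 0 S.hρ).mul_const c
  rw [← integral_exp_neg_mul_const S.hρ, cost, cost, ← integral_add h1 h3]
  refine setIntegral_mono_on h2 (h1.add h3) measurableSet_Ioi fun t ht => ?_
  rw [← mul_add]
  exact mul_le_mul_of_nonneg_left (hc t (le_of_lt ht)) (Real.exp_pos _).le

theorem Standing.abs_cost_le (S : P.Standing CL) {x : H P.s} {α : ℝ → H P.s}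
    {a : ℝ → ℝ} {X : ℝ → H P.s} (hα : α ∈ P.distributedControls) (ha : a ∈ P.boundaryControls)
    (hX : P.IsTrajectory x α a X) : |P.cost X α a| ≤ CL / P.ρ := by
  rw [← integral_exp_neg_mul_const S.hρ, cost, ← Real.norm_eq_abs]
  refine (norm_integral_le_integral_norm _).trans ?_
  refine setIntegral_mono_on (S.integrableOn_cost hα ha hX).norm
    ((exp_neg_integrableOn_Ioi 0 S.hρ).mul_const CL) measurableSet_Ioi fun t ht => ?_
  have ht' : 0 ≤ t := le_of_lt ht
  rw [norm_mul, Real.norm_eq_abs, abs_of_pos (Real.exp_pos _)]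
  exact mul_le_mul_of_nonneg_left (S.hL2 _ _ (hα.2 t ht') _ (ha.2 t ht')) (Real.exp_pos _).le

theorem Standing.cost_eq_add (S : P.Standing CL) {x : H P.s} {α : ℝ → H P.s}
    {a : ℝ → ℝ} {X : ℝ → H P.s} (hα : α ∈ P.distributedControls) (ha : a ∈ P.boundaryControls)
    (hX : P.IsTrajectory x α a X) {h : ℝ} (hh : 0 ≤ h) :
    P.cost X α a = (∫ t in (0 : ℝ)..h, Real.exp (-P.ρ * t) * P.L (X t) (α t) (a t)) +
      Real.exp (-P.ρ * h) *
        P.cost (fun t => X (t + h)) (fun t => α (t + h)) (fun t => a (t + h)) := by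
  have hi := S.integrableOn_cost hα ha hX
  rw [cost, ← intervalIntegral.integral_interval_add_Ioi hi (hi.mono_set (Ioi_subset_Ioi hh)),
    integral_Ioi_eq_integral_Ioi_zero_comp_add, cost, ← integral_const_mul]
  congr 2
  funext t
  rw [← mul_assoc, ← Real.exp_add]
  congr 2
  ring

/-! ### The value function -/

theorem Standing.value_le (S : P.Standing CL) {x : H P.s} {α : ℝ → H P.s}
    {a : ℝ → ℝ} {X : ℝ → H P.s} (hα : α ∈ P.distributedControls) (ha : a ∈ P.boundaryControls)
    (hX : P.IsTrajectory x α a X) : P.value x ≤ P.cost X α a := by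
  refine csInf_le ⟨-(CL / P.ρ), ?_⟩ ⟨α, hα, a, ha, X, hX, rfl⟩
  rintro _ ⟨α, hα, a, ha, X, hX, rfl⟩
  exact neg_le_of_abs_le (S.abs_cost_le hα ha hX)

theorem const_mem_controls {α : H P.s} (hα : α ∈ P.Sig) {a : ℝ}
    (ha : a ∈ P.Γ) : (fun _ => α) ∈ P.distributedControls ∧ (fun _ => a) ∈ P.boundaryControls :=
  ⟨⟨stronglyMeasurable_const, fun _ _ => hα⟩, measurable_const, fun _ _ => ha⟩

theorem Standing.costs_nonempty (S : P.Standing CL) (x : H P.s) :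
    {c | ∃ α ∈ P.distributedControls, ∃ a ∈ P.boundaryControls, ∃ X : ℝ → H P.s,
      P.IsTrajectory x α a X ∧ c = P.cost X α a}.Nonempty := by
  obtain ⟨α, hα⟩ := S.sig_nonempty
  obtain ⟨a, ha⟩ := S.hΓne
  obtain ⟨X, hX⟩ := S.exists_trajectory_const x α a
  have h := const_mem_controls hα ha
  exact ⟨_, _, h.1, _, h.2, X, hX, rfl⟩

theorem Standing.le_value (S : P.Standing CL) {x : H P.s} {m : ℝ}
    (h : ∀ α ∈ P.distributedControls, ∀ a ∈ P.boundaryControls, ∀ X, P.IsTrajectory x α a X →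
      m ≤ P.cost X α a) : m ≤ P.value x := by
  refine le_csInf (S.costs_nonempty x) ?_
  rintro _ ⟨α, hα, a, ha, X, hX, rfl⟩
  exact h α hα a ha X hX

theorem Standing.exists_cost_lt (S : P.Standing CL) (x : H P.s) {η : ℝ} (hη : 0 < η) :
    ∃ α ∈ P.distributedControls, ∃ a ∈ P.boundaryControls, ∃ X, P.IsTrajectory x α a X ∧
      P.cost X α a < P.value x + η := by
  obtain ⟨_, ⟨α, hα, a, ha, X, hX, rfl⟩, h⟩ := exists_lt_of_csInf_lt (S.costs_nonempty x)
    (lt_add_of_pos_right (P.value x) hη)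
  exact ⟨α, hα, a, ha, X, hX, h⟩

theorem Standing.abs_value_le (S : P.Standing CL) (x : H P.s) : |P.value x| ≤ CL / P.ρ := by
  rw [abs_le]
  constructor
  · exact S.le_value fun α hα a ha X hX => neg_le_of_abs_le (S.abs_cost_le hα ha hX)
  · obtain ⟨_, α, hα, a, ha, X, hX, rfl⟩ := S.costs_nonempty x
    exact (S.value_le hα ha hX).trans (le_of_abs_le (S.abs_cost_le hα ha hX))

/-- The same controls are used from both initial states; the difference of the trajectories is the
semigroup applied to `y - x`, and (L1) with the `B`-norm bound integrates against `e^{-ρt}`. -/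
theorem Standing.value_bLipschitz (S : P.Standing CL) : P.BLipschitz P.value := by
  set M := Real.exp (|P.μ| * (P.s / P.β)) with hM
  have key : ∀ x y, P.value y - P.value x ≤
      CL * M / P.ρ * ‖resolvent P.s P.β P.lam (y - x)‖ := by
    intro x y
    suffices h : P.value y - CL * M / P.ρ * ‖resolvent P.s P.β P.lam (y - x)‖ ≤ P.value x by
      linarith
    refine S.le_value fun α hα a ha X hX => ?_
    have hY := hX.add_semigroup S hα ha y
    have h1 := S.cost_sub_le (c := CL * (M * ‖resolvent P.s P.β P.lam (y - x)‖)) hα ha hX hY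
      fun t ht => by
        have h2 := (le_abs_self _).trans (S.hL1 (X t + semigroup P.β P.μ t (y - x)) (X t)
          (α t) (hα.2 t ht) (a t) (ha.2 t ht))
        rw [add_sub_cancel_left, normB_eq] at h2
        have h3 := mul_le_mul_of_nonneg_left
          (norm_resolvent_semigroup_le S.hs S.hβ S.hlam P.μ ht (y - x)) S.hCL
        linarith
    have h4 := S.value_le hα ha hY
    have h5 : CL * (M * ‖resolvent P.s P.β P.lam (y - x)‖) / P.ρ =
      CL * M / P.ρ * ‖resolvent P.s P.β P.lam (y - x)‖ := by ring
    linarith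
  refine ⟨CL * M / P.ρ, fun x y => ?_⟩
  rw [normB_eq, abs_le]
  have h1 := key y x
  have h2 := key x y
  rw [← neg_sub x y, map_neg, norm_neg] at h2
  constructor <;> linarith

theorem BLipschitz.continuous {u : H P.s → ℝ} (hu : P.BLipschitz u) : Continuous u := by
  obtain ⟨C, hC0, hC⟩ := hu.exists_nonneg
  refine continuous_iff_continuousAt.2 fun x => ?_
  rw [ContinuousAt, tendsto_iff_norm_sub_tendsto_zero]
  have h : Continuous fun y => C * ‖resolvent P.s P.β P.lam (y - x)‖ := by fun_prop
  refine squeeze_zero (fun _ => norm_nonneg _) (fun y => hC y x) ?_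
  simpa using h.tendsto x

theorem Standing.value_admissible (S : P.Standing CL) : P.Admissible P.value :=
  ⟨S.value_bLipschitz.continuous, ⟨_, S.abs_value_le⟩, S.value_bLipschitz⟩

/-- Dynamic programming, lower bound for the cost. -/
theorem Standing.dynamic_programming_le_cost (S : P.Standing CL) {x : H P.s} {α : ℝ → H P.s}
    {a : ℝ → ℝ} {X : ℝ → H P.s} (hα : α ∈ P.distributedControls) (ha : a ∈ P.boundaryControls)
    (hX : P.IsTrajectory x α a X) {h : ℝ} (hh : 0 ≤ h) :
    (∫ t in (0 : ℝ)..h, Real.exp (-P.ρ * t) * P.L (X t) (α t) (a t)) +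
      Real.exp (-P.ρ * h) * P.value (X h) ≤ P.cost X α a := by
  rw [S.cost_eq_add hα ha hX hh]
  gcongr
  exact S.value_le (distributedControls_shift hα hh) (boundaryControls_shift ha hh)
    (hX.shift S hα ha hh)

/-- Dynamic programming, upper bound for the value. -/
theorem Standing.value_le_dynamic_programming (S : P.Standing CL) {x : H P.s} {α : ℝ → H P.s}
    {a : ℝ → ℝ} {X : ℝ → H P.s} (hα : α ∈ P.distributedControls) (ha : a ∈ P.boundaryControls)
    (hX : P.IsTrajectory x α a X) {h : ℝ} (hh : 0 ≤ h) :
    P.value x ≤ (∫ t in (0 : ℝ)..h, Real.exp (-P.ρ * t) * P.L (X t) (α t) (a t)) +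
      Real.exp (-P.ρ * h) * P.value (X h) := by
  set I := ∫ t in (0 : ℝ)..h, Real.exp (-P.ρ * t) * P.L (X t) (α t) (a t) with hI
  -- Stated as a lower bound for the value at `X h`, so that each continuation from there is
  -- concatenated separately and no near-optimal continuation has to be chosen.
  have key : Real.exp (P.ρ * h) * (P.value x - I) ≤ P.value (X h) := by
    refine S.le_value fun α' hα' a' ha' Y hY => ?_
    have hZ := hX.concat S hα ha hα' ha' hh hY
    have hαZ : (fun t => if t < h then α t else α' (t - h)) ∈ P.distributedControls := by
      refine ⟨hα.1.ite measurableSet_Iio (hα'.1.comp_measurable (measurable_id.sub_const h)),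
        fun t ht => ?_⟩
      by_cases hth : t < h
      · simpa only [if_pos hth] using hα.2 t ht
      · simpa only [if_neg hth] using hα'.2 _ (sub_nonneg.2 (not_lt.1 hth))
    have haZ : (fun t => if t < h then a t else a' (t - h)) ∈ P.boundaryControls := by
      refine ⟨ha.1.ite measurableSet_Iio (ha'.1.comp (measurable_id.sub_const h)),
        fun t ht => ?_⟩
      by_cases hth : t < h
      · simpa only [if_pos hth] using ha.2 t ht
      · simpa only [if_neg hth] using ha'.2 _ (sub_nonneg.2 (not_lt.1 hth))
    have h1 := S.value_le hαZ haZ hZ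
    rw [S.cost_eq_add hαZ haZ hZ hh] at h1
    have e1 : ∫ t in (0 : ℝ)..h, Real.exp (-P.ρ * t) * P.L (if t < h then X t else Y (t - h))
        (if t < h then α t else α' (t - h)) (if t < h then a t else a' (t - h)) = I := by
      refine intervalIntegral.integral_congr_uIoo fun t ht => ?_
      rw [uIoo_of_le hh] at ht
      simp only [if_pos ht.2]
    have e2 : P.cost (fun t => if t + h < h then X (t + h) else Y (t + h - h))
        (fun t => if t + h < h then α (t + h) else α' (t + h - h))
        (fun t => if t + h < h then a (t + h) else a' (t + h - h)) = P.cost Y α' a' := by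
      rw [cost, cost]
      refine setIntegral_congr_fun measurableSet_Ioi fun t ht => ?_
      have ht' : ¬(t + h < h) := by
        have : (0 : ℝ) < t := ht
        linarith
      simp only [if_neg ht', add_sub_cancel_right]
    rw [e1, e2] at h1
    calc Real.exp (P.ρ * h) * (P.value x - I)
        ≤ Real.exp (P.ρ * h) * (Real.exp (-P.ρ * h) * P.cost Y α' a') := by
          gcongr; linarith
      _ = P.cost Y α' a' := by
          rw [← mul_assoc, ← Real.exp_add, neg_mul, add_neg_cancel, Real.exp_zero, one_mul]
  have h2 := mul_le_mul_of_nonneg_left key (Real.exp_pos (-P.ρ * h)).le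
  rw [← mul_assoc, ← Real.exp_add, neg_mul, neg_add_cancel, Real.exp_zero, one_mul] at h2
  rw [neg_mul]
  linarith

end Problem

namespace Problem

variable {P : Problem} {CL : ℝ}

/-! ### The value function is a viscosity solution -/

theorem Standing.exists_running_expansion (S : P.Standing CL) (x : H P.s) {η : ℝ} (hη : 0 < η) :
    ∃ h₀ > 0, ∀ α a X, P.IsGlobalTrajectory x α a X → ∀ h, 0 ≤ h → h ≤ h₀ →
      |(∫ t in (0 : ℝ)..h, Real.exp (-P.ρ * t) * P.L (X t) (α t) (a t)) -
        ∫ t in (0 : ℝ)..h, P.L x (α t) (a t)| ≤ η * h := by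
  set R := resolvent P.s P.β P.lam with hR
  set C := CL * ‖R‖ + CL * P.ρ + 1 with hC
  have hCL := S.hCL
  have hρ := S.hρ
  have hC0 : 0 < C := by positivity
  obtain ⟨h₁, hh₁, hnear⟩ := S.exists_trajectory_near x (show 0 < η / C by positivity)
  refine ⟨min h₁ (η / C), by positivity, fun α a X hX h hh hhh => ?_⟩
  have hm1 := hX.measurable_running S X hX.cont
  have hm2 := hX.measurable_running S (fun _ => x) continuous_const
  have hexp : Measurable fun t => Real.exp (-P.ρ * t) := by fun_prop
  have i2 : IntervalIntegrable (fun t => P.L x (α t) (a t)) volume 0 h :=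
    (intervalIntegrable_const (c := CL)).mono_fun hm2.aestronglyMeasurable
      (Eventually.of_forall fun t => (S.hL2 _ _ (hX.memα t) _ (hX.mema t)).trans (le_abs_self _))
  have i1' : IntervalIntegrable (fun t => P.L (X t) (α t) (a t)) volume 0 h :=
    (intervalIntegrable_const (c := CL)).mono_fun hm1.aestronglyMeasurable
      (Eventually.of_forall fun t => (S.hL2 _ _ (hX.memα t) _ (hX.mema t)).trans (le_abs_self _))
  have i1 : IntervalIntegrable (fun t => Real.exp (-P.ρ * t) * P.L (X t) (α t) (a t)) volume 0 h :=
    i1'.continuousOn_mul (by fun_prop)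
  rw [← intervalIntegral.integral_sub i1 i2, ← Real.norm_eq_abs]
  have := intervalIntegral.norm_integral_le_of_norm_le_const (a := 0) (b := h) (C := η)
    (f := fun t => Real.exp (-P.ρ * t) * P.L (X t) (α t) (a t) - P.L x (α t) (a t)) fun t ht => by
      rw [uIoc_of_le hh] at ht
      have b1 : |P.L (X t) (α t) (a t) - P.L x (α t) (a t)| ≤ CL * (‖R‖ * (η / C)) := by
        refine (S.hL1 _ _ _ (hX.memα t) _ (hX.mema t)).trans ?_
        rw [normB_eq]
        gcongr
        refine (R.le_opNorm _).trans ?_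
        gcongr
        exact hnear α a X hX t ht.1.le (ht.2.trans (hhh.trans (min_le_left _ _)))
      have b2 : |Real.exp (-P.ρ * t) - 1| ≤ P.ρ * (η / C) := by
        have e1 : Real.exp (-P.ρ * t) ≤ 1 := Real.exp_le_one_iff.2 (by nlinarith [ht.1])
        have e2 := Real.add_one_le_exp (-P.ρ * t)
        have e3 : P.ρ * t ≤ P.ρ * (η / C) :=
          mul_le_mul_of_nonneg_left (ht.2.trans (hhh.trans (min_le_right _ _))) hρ.le
        rw [abs_le]
        constructor
        · linarith
        · have : 0 ≤ P.ρ * (η / C) := by positivity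
          linarith
      have b3 := S.hL2 (X t) _ (hX.memα t) _ (hX.mema t)
      have e : Real.exp (-P.ρ * t) * P.L (X t) (α t) (a t) - P.L x (α t) (a t) =
          (Real.exp (-P.ρ * t) - 1) * P.L (X t) (α t) (a t) +
          (P.L (X t) (α t) (a t) - P.L x (α t) (a t)) := by ring
      rw [e]
      refine (norm_add_le _ _).trans ?_
      rw [norm_mul]
      have b4 := mul_le_mul b2 b3 (abs_nonneg _) (by positivity)
      calc _ ≤ P.ρ * (η / C) * CL + CL * (‖R‖ * (η / C)) := add_le_add b4 b1
        _ = (C - 1) * (η / C) := by rw [hC]; ring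
        _ ≤ C * (η / C) := by gcongr; linarith
        _ = η := by field_simp
  rwa [sub_zero, abs_of_nonneg hh] at this

theorem Standing.exists_discount_expansion (S : P.Standing CL) (x : H P.s) {η : ℝ} (hη : 0 < η) :
    ∃ h₀ > 0, ∀ α a X, P.IsGlobalTrajectory x α a X → ∀ h, 0 ≤ h → h ≤ h₀ →
      |(1 - Real.exp (-P.ρ * h)) * P.value (X h) - P.ρ * h * P.value x| ≤ η * h := by
  have hρ := S.hρ
  set M := CL / P.ρ with hM
  have hM0 : 0 ≤ M := div_nonneg S.hCL hρ.le
  have hc := S.value_bLipschitz.continuous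
  obtain ⟨r, hr, hball⟩ := Metric.continuous_iff.1 hc x (η / (2 * P.ρ)) (by positivity)
  obtain ⟨h₁, hh₁, hnear⟩ := S.exists_trajectory_near x (show 0 < r / 2 by positivity)
  set h₂ := min (1 / P.ρ) (η / (2 * (P.ρ ^ 2 * M + 1))) with hh₂
  refine ⟨min h₁ h₂, by positivity, fun α a X hX h hh hhh => ?_⟩
  have b1 : |P.value (X h) - P.value x| ≤ η / (2 * P.ρ) := by
    have := hball (X h) (by
      rw [dist_eq_norm]
      linarith [hnear α a X hX h hh (hhh.trans (min_le_left _ _))])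
    exact this.le
  have hh2 : h ≤ h₂ := hhh.trans (min_le_right _ _)
  have hρh : P.ρ * h ≤ 1 := by
    have := hh2.trans (min_le_left _ _)
    rw [le_div_iff₀ hρ] at this
    linarith
  have hMh : (P.ρ ^ 2 * M + 1) * h ≤ η / 2 := by
    have := hh2.trans (min_le_right _ _)
    rw [le_div_iff₀ (by positivity)] at this
    linarith
  have e0 := Real.abs_exp_sub_one_sub_id_le (x := -P.ρ * h) (by
    rw [neg_mul, abs_neg, abs_of_nonneg (by positivity)]; exact hρh)
  have e1 := Real.add_one_le_exp (-P.ρ * h)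
  have e2 : Real.exp (-P.ρ * h) ≤ 1 := Real.exp_le_one_iff.2 (by nlinarith)
  have b2 : |1 - Real.exp (-P.ρ * h)| ≤ P.ρ * h := by
    rw [abs_of_nonneg (by linarith)]; linarith
  have b3 : |1 - Real.exp (-P.ρ * h) - P.ρ * h| ≤ (P.ρ * h) ^ 2 := by
    rw [← abs_neg]
    calc |-(1 - Real.exp (-P.ρ * h) - P.ρ * h)| = |Real.exp (-P.ρ * h) - 1 - -P.ρ * h| := by
          congr 1; ring
      _ ≤ (-P.ρ * h) ^ 2 := e0
      _ = (P.ρ * h) ^ 2 := by ring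
  -- The first product is `O(h)` times a small increment of the value function; the second is
  -- `O(h²)` times a bounded quantity.
  have e : (1 - Real.exp (-P.ρ * h)) * P.value (X h) - P.ρ * h * P.value x =
      (1 - Real.exp (-P.ρ * h)) * (P.value (X h) - P.value x) +
      (1 - Real.exp (-P.ρ * h) - P.ρ * h) * P.value x := by ring
  rw [e]
  refine (abs_add_le _ _).trans ?_
  rw [abs_mul, abs_mul]
  have b4 := mul_le_mul b2 b1 (abs_nonneg _) (by positivity)
  have b5 := mul_le_mul b3 (S.abs_value_le x) (abs_nonneg _) (by positivity)
  have b6 : P.ρ * h * (η / (2 * P.ρ)) = η / 2 * h := by field_simp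
  have b7 : (P.ρ * h) ^ 2 * M ≤ η / 2 * h := by
    calc (P.ρ * h) ^ 2 * M = P.ρ ^ 2 * M * h * h := by ring
      _ ≤ η / 2 * h := by
        refine mul_le_mul_of_nonneg_right ?_ hh
        linarith
  linarith

/-- Expansion of `φ + g` along trajectories, uniform in the controls. -/
theorem Standing.exists_test_expansion (S : P.Standing CL) {φ g : H P.s → ℝ} {g₀ : ℝ → ℝ}
    (hφ : P.Test1 φ) (hg : P.Test2 g g₀) (x : H P.s) {η : ℝ} (hη : 0 < η) :
    ∃ h₀ > 0, ∀ α a X, P.IsGlobalTrajectory x α a X → ∀ h, 0 ≤ h → h ≤ h₀ →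
      φ (X h) + g (X h) ≤ φ x + g x + h * (inner ℝ (Astar P.β (gradient φ x)) x
        + inner ℝ (gradient φ x + gradient g x) (-P.μ • x)
        + radialCoeff g₀ ‖x‖ * (P.β * P.normΓ ^ 2 / 2)) +
        (∫ τ in (0 : ℝ)..h, (P.β * delta0 (gradient φ x) * a τ
          + inner ℝ (gradient φ x + gradient g x) (α τ))) + η * h := by
  obtain ⟨h₁, hh₁, H₁⟩ := S.exists_test1_expansion hφ x (half_pos hη)
  obtain ⟨h₂, hh₂, H₂⟩ := S.exists_test2_expansion hg x (half_pos hη)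
  refine ⟨min h₁ h₂, lt_min hh₁ hh₂, fun α a X hX h hh hhh => ?_⟩
  have e1 := H₁ α a X hX h hh (hhh.trans (min_le_left _ _))
  have e2 := H₂ α a X hX h hh (hhh.trans (min_le_right _ _))
  have e3 : ∫ τ in (0 : ℝ)..h, (P.β * delta0 (gradient φ x) * a τ
      + inner ℝ (gradient φ x + gradient g x) (α τ)) =
      (∫ τ in (0 : ℝ)..h, (inner ℝ (α τ) (gradient φ x) + P.β * delta0 (gradient φ x) * a τ)) +
      ∫ τ in (0 : ℝ)..h, inner ℝ (α τ) (gradient g x) := by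
    rw [← intervalIntegral.integral_add ((hX.intervalIntegrable_inner S _ _ _).add
      ((hX.intervalIntegrable_bdry S _ _).const_mul _)) (hX.intervalIntegrable_inner S _ _ _)]
    refine intervalIntegral.integral_congr fun τ _ => ?_
    rw [real_inner_comm, inner_add_right]
    ring
  rw [e3, inner_smul_right, inner_add_left]
  linarith

theorem le_of_forall_pos_mul_le {a b c : ℝ} (hc : 0 < c) (h : ∀ η > 0, a ≤ b + c * η) :
    a ≤ b := by
  refine le_of_forall_pos_le_add fun ε hε => ?_
  have := h (ε / c) (by positivity)
  rwa [mul_div_cancel₀ _ hc.ne'] at this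

/-- Fix constant controls `(α, a)`. Dynamic programming bounds the value at `x` from above, the
local maximum bounds the increment of the value by that of `φ + g`, and the expansions, divided by
`h`, give the inequality for this pair. Each of the three expansions costs one `η`. -/
theorem Standing.value_isSubsolution (S : P.Standing CL) : P.IsSubsolution P.value := by
  refine ⟨S.value_admissible, fun φ g g₀ hφ hg x hmax => ?_⟩
  set A := inner ℝ (Astar P.β (gradient φ x)) x
    + inner ℝ (gradient φ x + gradient g x) (-P.μ • x)
    + radialCoeff g₀ ‖x‖ * (P.β * P.normΓ ^ 2 / 2) with hA
  suffices h : P.ρ * P.value x - A ≤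
      P.infTerm x (P.β * delta0 (gradient φ x)) (gradient φ x + gradient g x) by
    rw [hA] at h
    linarith
  refine S.le_infTerm fun α hα a ha => ?_
  refine le_of_forall_pos_mul_le (c := 3) (by norm_num) fun η hη => ?_
  obtain ⟨X, hX⟩ := S.exists_trajectory_const x α a
  obtain ⟨hαc, hac⟩ := const_mem_controls hα ha
  have hG := hX.global S hαc hac
  obtain ⟨r, hr, hball⟩ := Metric.eventually_nhds_iff.1 hmax
  obtain ⟨h₁, hh₁, H₁⟩ := S.exists_test_expansion hφ hg x hη
  obtain ⟨h₂, hh₂, H₂⟩ := S.exists_running_expansion x hη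
  obtain ⟨h₃, hh₃, H₃⟩ := S.exists_discount_expansion x hη
  obtain ⟨h₄, hh₄, H₄⟩ := S.exists_trajectory_near x (half_pos hr)
  obtain ⟨h, hh0, hle⟩ : ∃ h > 0, h ≤ min (min h₁ h₂) (min h₃ h₄) :=
    ⟨_, by positivity, le_rfl⟩
  simp only [le_min_iff] at hle
  have e1 := H₁ _ _ _ hG h hh0.le hle.1.1
  have e2 := abs_le.1 (H₂ _ _ _ hG h hh0.le hle.1.2)
  have e3 := abs_le.1 (H₃ _ _ _ hG h hh0.le hle.2.1)
  have e4 := H₄ _ _ _ hG h hh0.le hle.2.2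
  have e5 := S.value_le_dynamic_programming hαc hac hX hh0.le
  have hmax0 : max h 0 = h := max_eq_left hh0.le
  have e6 : ∫ t in (0 : ℝ)..h, Real.exp (-P.ρ * t) * P.L (X (max t 0)) α a =
      ∫ t in (0 : ℝ)..h, Real.exp (-P.ρ * t) * P.L (X t) α a := by
    refine intervalIntegral.integral_congr fun t ht => ?_
    rw [uIcc_of_le hh0.le] at ht
    simp only [max_eq_left ht.1]
  simp only [hmax0, intervalIntegral.integral_const, sub_zero, smul_eq_mul, e6] at e1 e2 e3 e4
  have e7 := hball (show dist (X h) x < r by rw [dist_eq_norm]; linarith)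
  rw [← hA] at e1
  have e8 : h * (P.ρ * P.value x) ≤ h * (A + (P.β * delta0 (gradient φ x) * a
      + inner ℝ (gradient φ x + gradient g x) α) + P.L x α a + 3 * η) := by
    linarith
  have := le_of_mul_le_mul_left e8 hh0
  linarith

/-- The local minimum bounds the decrease of the value by the increase of `φ + g`, so the same upper
expansion serves, now along nearly optimal controls. -/
theorem Standing.value_isSupersolution (S : P.Standing CL) : P.IsSupersolution P.value := by
  refine ⟨S.value_admissible, fun φ g g₀ hφ hg x hmin => ?_⟩
  set A := inner ℝ (Astar P.β (gradient φ x)) x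
    + inner ℝ (gradient φ x + gradient g x) (-P.μ • x)
    + radialCoeff g₀ ‖x‖ * (P.β * P.normΓ ^ 2 / 2) with hA
  set m := P.infTerm x (-(P.β * delta0 (gradient φ x))) (-(gradient φ x + gradient g x)) with hm
  suffices h : m ≤ P.ρ * P.value x + A by
    rw [hA] at h
    linarith
  refine le_of_forall_pos_mul_le (c := 4) (by norm_num) fun η hη => ?_
  obtain ⟨r, hr, hball⟩ := Metric.eventually_nhds_iff.1 hmin
  obtain ⟨h₁, hh₁, H₁⟩ := S.exists_test_expansion hφ hg x hη
  obtain ⟨h₂, hh₂, H₂⟩ := S.exists_running_expansion x hη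
  obtain ⟨h₃, hh₃, H₃⟩ := S.exists_discount_expansion x hη
  obtain ⟨h₄, hh₄, H₄⟩ := S.exists_trajectory_near x (half_pos hr)
  obtain ⟨h, hh0, hle⟩ : ∃ h > 0, h ≤ min (min h₁ h₂) (min h₃ h₄) :=
    ⟨_, by positivity, le_rfl⟩
  simp only [le_min_iff] at hle
  -- The control is `η h`-optimal and so depends on `h`. This is legitimate only because all
  -- thresholds were uniform in the controls; it is the source of the fourth `η`.
  obtain ⟨α, hα, a, ha, X, hX, hcost⟩ := S.exists_cost_lt x (show 0 < η * h by positivity)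
  have hG := hX.global S hα ha
  have e1 := H₁ _ _ _ hG h hh0.le hle.1.1
  have e2 := abs_le.1 (H₂ _ _ _ hG h hh0.le hle.1.2)
  have e3 := abs_le.1 (H₃ _ _ _ hG h hh0.le hle.2.1)
  have e4 := H₄ _ _ _ hG h hh0.le hle.2.2
  have e5 := S.dynamic_programming_le_cost hα ha hX hh0.le
  have hmax0 : max h 0 = h := max_eq_left hh0.le
  have e6 : ∫ t in (0 : ℝ)..h, Real.exp (-P.ρ * t) *
      P.L (X (max t 0)) (α (max t 0)) (a (max t 0)) =
      ∫ t in (0 : ℝ)..h, Real.exp (-P.ρ * t) * P.L (X t) (α t) (a t) := by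
    refine intervalIntegral.integral_congr fun t ht => ?_
    rw [uIcc_of_le hh0.le] at ht
    simp only [max_eq_left ht.1]
  rw [e6] at e2
  simp only [hmax0] at e1 e3 e4
  have e7 := hball (show dist (X h) x < r by rw [dist_eq_norm]; linarith)
  simp only at e7
  rw [← hA] at e1
  set D : ℝ → ℝ := fun τ => P.β * delta0 (gradient φ x) * a (max τ 0)
    + inner ℝ (gradient φ x + gradient g x) (α (max τ 0)) with hD
  have iD : IntervalIntegrable D volume 0 h := by
    have := ((hG.intervalIntegrable_bdry S 0 h).const_mul (P.β * delta0 (gradient φ x))).add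
      (hG.intervalIntegrable_inner S (gradient φ x + gradient g x) 0 h)
    refine this.congr_uIoo fun τ _ => ?_
    simp only [hD]
    rw [real_inner_comm]
  have iL : IntervalIntegrable (fun t => P.L x (α (max t 0)) (a (max t 0))) volume 0 h :=
    (intervalIntegrable_const (c := CL)).mono_fun
      (hG.measurable_running S (fun _ => x) continuous_const).aestronglyMeasurable
      (Eventually.of_forall fun t => (S.hL2 _ _ (hG.memα t) _ (hG.mema t)).trans (le_abs_self _))
  -- At each time the current controls are one competitor in the infimum `m`; integrating over `[0,
  -- h]` removes them.
  have e8 : ∫ _ in (0 : ℝ)..h, m ≤ ∫ t in (0 : ℝ)..h,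
      (P.L x (α (max t 0)) (a (max t 0)) - D t) := by
    refine intervalIntegral.integral_mono_on hh0.le intervalIntegrable_const (iL.sub iD)
      fun t _ => ?_
    have := S.infTerm_le x (-(P.β * delta0 (gradient φ x))) (-(gradient φ x + gradient g x))
      (hG.memα t) (hG.mema t)
    rw [inner_neg_left] at this
    simp only [hD]
    rw [hm]
    linarith
  rw [intervalIntegral.integral_sub iL iD, intervalIntegral.integral_const, sub_zero,
    smul_eq_mul] at e8
  have e9 : h * m ≤ h * (P.ρ * P.value x + A + 4 * η) := by linarith
  exact le_of_mul_le_mul_left e9 hh0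

end Problem

end TransportHJB

end

theorem mainTheorem2 (P : TransportHJB.Problem)
    (hs : 0 < P.s) (hβ : 0 < P.β) (hρ : 0 < P.ρ) (hlam : 0 < P.lam) (hlam1 : P.lam < 1)
    (hΓ : IsCompact P.Γ) (hΓne : P.Γ.Nonempty) (hΛ : IsCompact P.Λ) (hΛne : P.Λ.Nonempty)
    (hL : UniformContinuousOn
      (fun w : TransportHJB.H P.s × TransportHJB.H P.s × ℝ => P.L w.1 w.2.1 w.2.2)
      (Set.univ ×ˢ P.Sig ×ˢ P.Γ))
    (CL : ℝ) (hCL : 0 ≤ CL)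
    (hL1 : ∀ x y : TransportHJB.H P.s, ∀ α ∈ P.Sig, ∀ a ∈ P.Γ,
      |P.L x α a - P.L y α a| ≤ CL * TransportHJB.normB P.s P.β P.lam (x - y))
    (hL2 : ∀ x : TransportHJB.H P.s, ∀ α ∈ P.Sig, ∀ a ∈ P.Γ, |P.L x α a| ≤ CL) :
    (∀ u v : TransportHJB.H P.s → ℝ, P.IsSubsolution u → P.IsSupersolution v →
      ∀ x, u x ≤ v x) ∧
    (∀ w₁ w₂ : TransportHJB.H P.s → ℝ, P.IsSolution w₁ → P.IsSolution w₂ → w₁ = w₂) ∧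
    P.IsSolution P.value := by
  have S : P.Standing CL := ⟨hs, hβ, hρ, hlam, hΓ, hΓne, hΛ, hΛne, hL, hCL, hL1, hL2⟩
  refine ⟨fun u v hu hv x => S.comparison hu hv x, fun w₁ w₂ h₁ h₂ => ?_,
    S.value_isSubsolution, S.value_isSupersolution⟩
  exact funext fun x => le_antisymm (S.comparison h₁.1 h₂.2 x) (S.comparison h₂.1 h₁.2 x)
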